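/- Let $d\ge 2$, let $\mathbb T^d=(\mathbb R/\mathbb Z)^d$, and let the collision kernel be $B(u,\sigma)=|u|^\beta\,h(\cos\theta)$, $\cos\theta=u\cdot\sigma/|u|$, $u\in\mathbb R^d$, $\sigma\in S^{d-1}$, where $0<\beta\le 1$ and the measurable function $h\ge 0$ on $(-1,1)$ satisfies $h(\cos\theta)\sin^\alpha\theta\le C_h$ for $\theta\in(0,\pi)$, with constants $\alpha<d-1$ and $C_h$, and is normalized by $\int_{S^{d-1}}h(e\cdot\sigma)\,d\sigma=1$ for unit vectors $e$. For $f=f(x,v,t)\ge 0$ put $Q(f)=Q^+(f)-Q^-(f)$, $$Q^+(f)=\int_{\mathbb R^d}\int_{S^{d-1}} f(x,v'_*,t)\,f(x,v',t)\,B(v-v_*,\sigma)\,d\sigma\,dv_*,\qquad Q^-(f)=\int_{\mathbb R^d}\int_{S^{d-1}} f(x,v_*,t)\,f(x,v,t)\,B(v-v_*,\sigma)\,d\sigma\,dv_*,$$ where $v'=\frac{v+v_*}2+\frac{|v-v_*|}2\sigma$ and $v'_*=\frac{v+v_*}2-\frac{|v-v_*|}2\sigma$. Let $a_0>a_1>a>0$,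 $\rho_0>0$ and $c_0,c_1,C_0,C_1\in\mathbb R$, and put $M_0(v)=e^{-a_0|v|^2+c_0}$, $M_1(v)=e^{-a_1|v|^2+c_1}$. Then there is a constant $c\in\mathbb R$, depending only on $a,a_0,c_0,a_1,c_1,\rho_0,C_0,C_1$ (and on the kernel only through $d,\beta,\alpha,C_h$), with the following property. Let $T>0$ and let $0\le f\in C([0,T];L^1(\mathbb T^d\times\mathbb R^d))$ be a solution of the Boltzmann equation $(\partial_t+v\cdot\nabla_x)f=Q(f)$ on $[0,T]$ in at least one of the following two senses: (mild) for almost every $(x,v)$ the functions $t\mapsto Q^{\pm}(f)(x+tv,v,t)$ are integrable on $[0,T]$, and, for all $0\le s\le t\le T$ and almost every $(x,v)$, $f(x+tv,v,t)-f(x+sv,v,s)=\int_s^t Q(f)(x+\tau v,v,\tau)\,d\tau$; (renormalized) $Q^{\pm}(f)/(1+f)\in L^1_{\rm loc}(\mathbb T^d\times\mathbb R^d\times(0,T))$ and $(\partial_t+v\cdot\nabla_x)\log(1+f)=Q(f)/(1+f)$ in the sense of distributions on $\mathbb T^d\times\mathbb R^d\times(0,T)$. Suppose that $f(x,v,0)\le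 M_0(v)$ for almost all $(x,v)$ and that, for every $t\in[0,T]$ and almost every $x\in\mathbb T^d$, $$\int_{\mathbb R^d} f(x,v,t)\,dv\ge\rho_0,\qquad \|f(x,\cdot,t)\|_{L^\infty_v}\le C_0,\qquad \int_{\mathbb R^d}\frac{f(x,v,t)}{M_1(v)}\,dv\le C_1 .$$ Then, for every $t\in[0,T]$, $$f(x,v,t)\le e^{-a|v|^2+c}\quad\text{for almost all }(x,v)\in\mathbb T^d\times\mathbb R^d .$$ -/

import Mathlib

open MeasureTheory Set Filter Topology
open scoped ENNReal ContDiff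

namespace Boltzmann

/-- The `d`-dimensional torus `(ℝ/ℤ)^d`, with its product (Haar, total mass one) measure. -/
abbrev Torus (d : ℕ) : Type := Fin d → UnitAddCircle

/-- Velocity space `ℝ^d` with the Euclidean norm. -/
abbrev Vel (d : ℕ) : Type := EuclideanSpace ℝ (Fin d)

/-- The unit sphere `S^{d-1}`. -/
abbrev Sph (d : ℕ) : Type := Metric.sphere (0 : Vel d) 1

/-- The surface measure on `S^{d-1}`. -/
noncomputable abbrev surf (d : ℕ) : Measure (Sph d) := (volume : Measure (Vel d)).toSphere

/-- The Maxwellian `exp (-a |v|² + c)`. -/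
noncomputable def maxwellian {d : ℕ} (a c : ℝ) (v : Vel d) : ℝ := Real.exp (-a * ‖v‖ ^ 2 + c)

/-- The angular part `h` of a cutoff collision kernel: `h` is measurable,
`0 ≤ h (cos θ) (sin θ)^α ≤ C` for `θ ∈ (0, π)`, and `∫_{S^{d-1}} h (cos θ) dσ = 1`
(`θ` being the angle between `σ` and an arbitrary fixed direction `e`). -/
structure IsCutoff (d : ℕ) (α C : ℝ) (h : ℝ → ℝ) : Prop where
  measurable : Measurable h
  nonneg : ∀ z ∈ Ioo (-1 : ℝ) 1, 0 ≤ h z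
  bound : ∀ θ ∈ Ioo 0 Real.pi, h (Real.cos θ) * Real.sin θ ^ α ≤ C
  normalized : ∀ e : Sph d, ∫ σ : Sph d, h (inner ℝ (e : Vel d) (σ : Vel d)) ∂(surf d) = 1

/-- The collision kernel `B (u, σ) = |u|^β h (cos θ)`, `cos θ = (u · σ) / |u|`. -/
noncomputable def kernel {d : ℕ} (β : ℝ) (h : ℝ → ℝ) (u : Vel d) (σ : Sph d) : ℝ :=
  ‖u‖ ^ β * h (inner ℝ u (σ : Vel d) / ‖u‖)

/-- The transformed velocity `v' = (v + v_*)/2 + (|v - v_*|/2) σ`. -/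
noncomputable def post {d : ℕ} (v vs : Vel d) (σ : Sph d) : Vel d :=
  (1 / 2 : ℝ) • (v + vs) + (‖v - vs‖ / 2) • (σ : Vel d)

/-- The transformed velocity `v'_* = (v + v_*)/2 - (|v - v_*|/2) σ`. -/
noncomputable def postStar {d : ℕ} (v vs : Vel d) (σ : Sph d) : Vel d :=
  (1 / 2 : ℝ) • (v + vs) - (‖v - vs‖ / 2) • (σ : Vel d)

/-- The gain term `Q⁺(F)(v) = ∫∫ F(v'_*) F(v') B(v - v_*, σ) dσ dv_*` of a nonnegative velocity
profile `F`, as an element of `[0, ∞]`. -/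
noncomputable def gain {d : ℕ} (β : ℝ) (h : ℝ → ℝ) (F : Vel d → ℝ) (v : Vel d) : ℝ≥0∞ :=
  ∫⁻ vs : Vel d, ∫⁻ σ : Sph d,
    ENNReal.ofReal (F (postStar v vs σ) * F (post v vs σ) * kernel β h (v - vs) σ) ∂(surf d)

/-- The loss term `Q⁻(F)(v) = ∫∫ F(v_*) F(v) B(v - v_*, σ) dσ dv_*` of a nonnegative velocity
profile `F`, as an element of `[0, ∞]`. -/
noncomputable def loss {d : ℕ} (β : ℝ) (h : ℝ → ℝ) (F : Vel d → ℝ) (v : Vel d) : ℝ≥0∞ :=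
  ∫⁻ vs : Vel d, ∫⁻ σ : Sph d,
    ENNReal.ofReal (F vs * F v * kernel β h (v - vs) σ) ∂(surf d)

/-- The Boltzmann collision operator `Q(F) = Q⁺(F) - Q⁻(F)`; it is only used where both terms
are finite. -/
noncomputable def collision {d : ℕ} (β : ℝ) (h : ℝ → ℝ) (F : Vel d → ℝ) (v : Vel d) : ℝ :=
  (gain β h F v).toReal - (loss β h F v).toReal

/-- Free motion on the torus: the point `x + t v`. -/
def move {d : ℕ} (t : ℝ) (x : Torus d) (v : Vel d) : Torus d :=
  fun i => x i + ((t * v i : ℝ) : UnitAddCircle)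

/-- `0 ≤ f ∈ C([0,T]; L¹(𝕋^d × ℝ^d))`, for a jointly measurable representative `f (t, x, v)`. -/
structure IsNonnegL1Curve {d : ℕ} (T : ℝ) (f : ℝ → Torus d → Vel d → ℝ) : Prop where
  measurable : Measurable fun p : ℝ × Torus d × Vel d => f p.1 p.2.1 p.2.2
  nonneg : ∀ t ∈ Icc 0 T, ∀ x v, 0 ≤ f t x v
  integrable : ∀ t ∈ Icc 0 T, Integrable fun p : Torus d × Vel d => f t p.1 p.2
  continuous : ∀ t ∈ Icc 0 T,
    Tendsto (fun s => eLpNorm (fun p : Torus d × Vel d => f s p.1 p.2 - f t p.1 p.2) 1 volume)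
      (𝓝[Icc 0 T] t) (𝓝 0)

/-- `f` solves `(∂_t + v · ∇_x) f = Q(f)` on `[0,T]` in the mild sense: for almost every
characteristic `t ↦ (x + t v, v)` the functions `Q^±(f)` are integrable along it, and the equation
holds in integrated form along it. -/
structure IsMildSolution {d : ℕ} (β : ℝ) (h : ℝ → ℝ) (T : ℝ) (f : ℝ → Torus d → Vel d → ℝ) :
    Prop where
  gain_integrable : ∀ᵐ p : Torus d × Vel d,
    ∫⁻ t in Icc 0 T, gain β h (f t (move t p.1 p.2)) p.2 < ⊤
  loss_integrable : ∀ᵐ p : Torus d × Vel d,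
    ∫⁻ t in Icc 0 T, loss β h (f t (move t p.1 p.2)) p.2 < ⊤
  equation : ∀ s t, 0 ≤ s → s ≤ t → t ≤ T → ∀ᵐ p : Torus d × Vel d,
    f t (move t p.1 p.2) p.2 - f s (move s p.1 p.2) p.2
      = ∫ τ in s..t, collision β h (f τ (move τ p.1 p.2)) p.2

/-- Test functions: smooth functions of `(t, x, v)` with compact support in
`(0,T) × 𝕋^d × ℝ^d`. Smoothness is that of the `ℤ^d`-periodic lift. -/
structure IsTest {d : ℕ} (T : ℝ) (φ : ℝ × Torus d × Vel d → ℝ) : Prop where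
  smooth : ContDiff ℝ ∞ fun q : ℝ × (Fin d → ℝ) × Vel d =>
    φ (q.1, (fun i => ((q.2.1 i : ℝ) : UnitAddCircle)), q.2.2)
  compact : HasCompactSupport φ
  support : tsupport φ ⊆ Ioo 0 T ×ˢ univ

/-- The transport derivative `(∂_t + v · ∇_x) φ`. -/
noncomputable def transport {d : ℕ} (φ : ℝ × Torus d × Vel d → ℝ) (p : ℝ × Torus d × Vel d) : ℝ :=
  deriv (fun s : ℝ => φ (p.1 + s, move s p.2.1 p.2.2, p.2.2)) 0

/-- `f` is a renormalized solution on `(0,T)`: `Q^±(f) / (1 + f)` are locally integrable and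
`(∂_t + v · ∇_x) log (1 + f) = Q(f) / (1 + f)` in the sense of distributions on
`(0,T) × 𝕋^d × ℝ^d`. -/
structure IsRenormalizedSolution {d : ℕ} (β : ℝ) (h : ℝ → ℝ) (T : ℝ)
    (f : ℝ → Torus d → Vel d → ℝ) : Prop where
  gain_integrable : ∀ K : Set (ℝ × Torus d × Vel d), IsCompact K → K ⊆ Ioo 0 T ×ˢ univ →
    ∫⁻ p in K, gain β h (f p.1 p.2.1) p.2.2 / ENNReal.ofReal (1 + f p.1 p.2.1 p.2.2) < ⊤
  loss_integrable : ∀ K : Set (ℝ × Torus d × Vel d), IsCompact K → K ⊆ Ioo 0 T ×ˢ univ →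
    ∫⁻ p in K, loss β h (f p.1 p.2.1) p.2.2 / ENNReal.ofReal (1 + f p.1 p.2.1 p.2.2) < ⊤
  equation : ∀ φ : ℝ × Torus d × Vel d → ℝ, IsTest T φ →
    -∫ p in Ioo 0 T ×ˢ (univ : Set (Torus d × Vel d)),
        Real.log (1 + f p.1 p.2.1 p.2.2) * transport φ p
      = ∫ p in Ioo 0 T ×ˢ (univ : Set (Torus d × Vel d)),
        collision β h (f p.1 p.2.1) p.2.2 / (1 + f p.1 p.2.1 p.2.2) * φ p

end Boltzmann

namespace Boltzmann

/-! Put `M = exp (-a|v|² + c)`. Since `M` depends only on `v`, it is stationary under free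
transport, and the excess `(f - M)₊` vanishes at time `0` if `c ≥ c₀`. The bound therefore
propagates if, for each time and almost every position, the integral of `Q(f)` over `{v | f > M}` is
nonpositive.

To obtain this sign, split only one factor of the gain: `Q⁺(f,f) ≤ Q⁺(f,(f-M)₊) + Q⁺(f,M)`.
Conservation of mass in collisions (`lintegral_bilinearGain`) gives `∫ Q⁺(f,g) = ∫ g ν`, where `ν(v)
= ∫ f(v_*) |v-v_*|^β dv_*`; with `g = (f-M)₊` the right side lives on `{f > M}`. If moreover
`Q⁺(f,M) ≤ M ν` there, the two pieces add up to `∫ f ν` over `{f > M}`, which is exactly the loss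
(`setLIntegral_gain_le_loss`).

The inequality `Q⁺(f,M) ≤ M ν` is needed only for `|v| ≥ R`, because a large `c` makes `M` exceed
the sup bound `C₀` on the ball of radius `R`. For large `v` it is `exists_radius_gain_le`. Energy
conservation gives `M(v') = M(v) exp(a|v'_*|²) exp(-a|v_*|²)`, and with `w = v'_*` as integration
variable (Carleman) one gets `Q⁺(f,M)(v) ≲ M(v) ∫ f(w) exp(a|w|²) |v-w|^β D(v,w) dw`. The angular
factor `D` tends to `0` as `|v-w| → ∞` with `w` bounded, because `v_*` is then far from the origin
for almost every direction; large `w` are paid for by the moment with `a₁ > a`. The integral is thus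
at most a small multiple of `|v|^β`, while mass and moment bounds force `ν ≥ κ|v|^β` with a fixed `κ
> 0`. Neither `R` nor `κ` depends on `c`.

The time evolution is handled along characteristics (`ae_le_of_integral_nonpos`). The derivative of
the positive part is replaced by a convexity inequality on time grids, which also covers the unknown
`log (1 + f)` through the convex function `exp`. A renormalized solution is first brought to
integrated form (`IsRenormalizedSolution.integrated`) by test functions that follow the flow. -/

/-! ### Polar coordinates and integrals over the sphere -/

theorem lintegral_polar {d : ℕ} [Nontrivial (Vel d)] {F : Vel d → ℝ≥0∞} (hF : Measurable F) :
    ∫⁻ x, F x = ∫⁻ r, ∫⁻ σ : Sph d, F ((r : ℝ) • (σ : Vel d)) ∂(surf d)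
      ∂(Measure.volumeIoiPow (Module.finrank ℝ (Vel d) - 1)) := by
  have h1 := (volume : Measure (Vel d)).measurePreserving_homeomorphUnitSphereProd
  have h2 := h1.symm (homeomorphUnitSphereProd (Vel d)).toMeasurableEquiv
  rw [← restrict_compl_singleton (μ := (volume : Measure (Vel d))) 0]
  rw [← lintegral_subtype_comap (measurableSet_singleton (0 : Vel d)).compl]
  rw [← h2.lintegral_comp (f := fun x : ({0}ᶜ : Set (Vel d)) => F x)
    (hF.comp measurable_subtype_coe)]
  rw [lintegral_prod_symm]
  · rfl
  · refine Measurable.aemeasurable ?_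
    exact hF.comp (measurable_subtype_coe.comp
      (homeomorphUnitSphereProd (Vel d)).toMeasurableEquiv.symm.measurable)

/-- In polar coordinates `u = rω` and `|u|σ = rσ` share the radius, so the exchange is Fubini on the
product of two spheres. It is the involution behind the pre/post-collisional change of variables. -/
theorem lintegral_sphere_swap {d : ℕ} [Nontrivial (Vel d)] {Φ : Vel d → Vel d → ℝ≥0∞}
    (hΦ : Measurable (Function.uncurry Φ)) :
    ∫⁻ u, ∫⁻ σ : Sph d, Φ u (‖u‖ • (σ : Vel d)) ∂(surf d) =
      ∫⁻ u, ∫⁻ σ : Sph d, Φ (‖u‖ • (σ : Vel d)) u ∂(surf d) := by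
  have m1 : Measurable fun p : Vel d × Sph d => Φ p.1 (‖p.1‖ • (p.2 : Vel d)) :=
    hΦ.comp (f := fun p : Vel d × Sph d => (p.1, ‖p.1‖ • (p.2 : Vel d))) (by fun_prop)
  have m2 : Measurable fun p : Vel d × Sph d => Φ (‖p.1‖ • (p.2 : Vel d)) p.1 :=
    hΦ.comp (f := fun p : Vel d × Sph d => (‖p.1‖ • (p.2 : Vel d), p.1)) (by fun_prop)
  rw [lintegral_polar m1.lintegral_prod_right', lintegral_polar m2.lintegral_prod_right']
  refine lintegral_congr fun r => ?_
  have hn : ∀ σ : Sph d, ‖(r : ℝ) • (σ : Vel d)‖ = r := fun σ => by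
    rw [norm_smul, norm_eq_of_mem_sphere, mul_one, Real.norm_of_nonneg (le_of_lt r.2)]
  simp only [hn]
  rw [lintegral_lintegral_swap]
  refine Measurable.aemeasurable ?_
  exact hΦ.comp (f := fun p : Sph d × Sph d => ((r : ℝ) • (p.1 : Vel d), (r : ℝ) • (p.2 : Vel d)))
    (by fun_prop)

/-- Trades surface integrals for Lebesgue integrals over the ball, so that invariance and
integrability can be checked in `ℝ^d`. -/
theorem lintegral_ball_radial {d : ℕ} [Nontrivial (Vel d)] {g : Vel d → ℝ≥0∞} (hg : Measurable g)
    (hom : ∀ r : ℝ, 0 < r → ∀ x, g (r • x) = g x) :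
    ∫⁻ x in Metric.ball (0 : Vel d) 1, g x =
      (Measure.volumeIoiPow (Module.finrank ℝ (Vel d) - 1)
        (Iio (⟨1, mem_Ioi.2 one_pos⟩ : Ioi (0 : ℝ)))) * ∫⁻ σ : Sph d, g σ ∂(surf d) := by
  rw [← lintegral_indicator measurableSet_ball,
    lintegral_polar (hg.indicator measurableSet_ball)]
  have : ∀ r : Ioi (0 : ℝ), (∫⁻ σ : Sph d, (Metric.ball (0 : Vel d) 1).indicator g
      ((r : ℝ) • (σ : Vel d)) ∂(surf d)) =
      (Iio (⟨1, mem_Ioi.2 one_pos⟩ : Ioi (0 : ℝ))).indicator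
        (fun _ => ∫⁻ σ : Sph d, g σ ∂(surf d)) r := by
    intro r
    have hn : ∀ σ : Sph d, ‖(r : ℝ) • (σ : Vel d)‖ = r := fun σ => by
      rw [norm_smul, norm_eq_of_mem_sphere, mul_one, Real.norm_of_nonneg (le_of_lt r.2)]
    by_cases hr : (r : ℝ) < 1
    · rw [indicator_of_mem (show r ∈ Iio (⟨1, mem_Ioi.2 one_pos⟩ : Ioi (0 : ℝ)) from hr)]
      refine lintegral_congr fun σ => ?_
      rw [indicator_of_mem (by simpa [hn] using hr), hom _ r.2]
    · rw [indicator_of_notMem (show r ∉ Iio (⟨1, mem_Ioi.2 one_pos⟩ : Ioi (0 : ℝ)) from hr)]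
      rw [← lintegral_zero (μ := surf d)]
      refine lintegral_congr fun σ => ?_
      rw [indicator_of_notMem (by simpa [hn] using hr)]
  simp_rw [this]
  rw [lintegral_indicator measurableSet_Iio, lintegral_const, Measure.restrict_apply_univ, mul_comm]

theorem volumeIoiPow_Iio_one (n : ℕ) :
    Measure.volumeIoiPow n (Iio (⟨1, mem_Ioi.2 one_pos⟩ : Ioi (0 : ℝ))) ≠ 0 ∧
    Measure.volumeIoiPow n (Iio (⟨1, mem_Ioi.2 one_pos⟩ : Ioi (0 : ℝ))) ≠ ⊤ := by
  rw [Measure.volumeIoiPow_apply_Iio]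
  refine ⟨?_, ENNReal.ofReal_ne_top⟩
  simp only [ne_eq, ENNReal.ofReal_eq_zero, not_le]
  positivity

/-- Integrals over the sphere are invariant under linear isometries, stated for the homogeneous
extension of the integrand. -/
theorem lintegral_sphere_isometry {d : ℕ} [Nontrivial (Vel d)] {g : Vel d → ℝ≥0∞}
    (hg : Measurable g) (hom : ∀ r : ℝ, 0 < r → ∀ x, g (r • x) = g x)
    (L : Vel d ≃ₗᵢ[ℝ] Vel d) :
    ∫⁻ σ : Sph d, g (L σ) ∂(surf d) = ∫⁻ σ : Sph d, g σ ∂(surf d) := by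
  have hL : Measurable L := L.continuous.measurable
  have h1 := lintegral_ball_radial (hg.comp hL) (fun r hr x => by simp [hom r hr])
  have h2 := lintegral_ball_radial hg hom
  have h3 : ∫⁻ x in Metric.ball (0 : Vel d) 1, (g ∘ L) x = ∫⁻ x in Metric.ball (0 : Vel d) 1, g x := by
    have := (L.measurePreserving).setLIntegral_comp_preimage (s := Metric.ball (0 : Vel d) 1)
      measurableSet_ball hg
    rw [← this]
    congr 2
    ext x; simp
  rw [h3, h2] at h1
  -- The radial factor common to both sides is neither `0` nor `⊤`, hence cancels.
  have := volumeIoiPow_Iio_one (Module.finrank ℝ (Vel d) - 1)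
  exact ((ENNReal.mul_right_inj this.1 this.2).1 h1).symm

theorem lintegral_sphere_neg {d : ℕ} [Nontrivial (Vel d)] {g : Sph d → ℝ≥0∞} (hg : Measurable g) :
    ∫⁻ σ : Sph d, g (-σ) ∂(surf d) = ∫⁻ σ : Sph d, g σ ∂(surf d) := by
  classical
  have hne : ∀ x : Vel d, x ≠ 0 → ‖x‖⁻¹ • x ∈ Metric.sphere (0 : Vel d) 1 := fun x hx => by
    simp [norm_smul, hx]
  obtain ⟨e⟩ : Nonempty (Sph d) := by
    obtain ⟨x, hx⟩ := exists_ne (0 : Vel d)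
    exact ⟨⟨_, hne x hx⟩⟩
  -- Radial projection, with an arbitrary value at the origin: `g ∘ π` is the homogeneous extension
  -- of `g` of degree zero.
  let π : Vel d → Sph d := fun x => if hx : x = 0 then e else ⟨‖x‖⁻¹ • x, hne x hx⟩
  have hπm : Measurable π := by
    refine Measurable.dite (s := {x : Vel d | x = 0}) (f := fun _ => e) measurable_const
      (g := fun x => ⟨‖(x : Vel d)‖⁻¹ • (x : Vel d), hne x x.2⟩) ?_ (measurableSet_singleton 0)
    refine Measurable.subtype_mk ?_
    fun_prop
  have hπ : ∀ σ : Sph d, π σ = σ := fun σ => by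
    have h0 : (σ : Vel d) ≠ 0 := ne_zero_of_mem_unit_sphere σ
    simp [π, h0]
  have hhom : ∀ r : ℝ, 0 < r → ∀ x, π (r • x) = π x := fun r hr x => by
    by_cases hx : x = 0
    · simp [π, hx]
    · have : r • x ≠ 0 := smul_ne_zero hr.ne' hx
      simp only [π, hx, this, dif_neg, not_false_iff]
      ext1
      simp only [norm_smul, smul_smul, Real.norm_of_nonneg hr.le]
      congr 1
      field_simp
  have := lintegral_sphere_isometry (g := g ∘ π) (hg.comp hπm) (fun r hr x => by simp [hhom r hr])
    (LinearIsometryEquiv.neg ℝ)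
  simp only [Function.comp, hπ] at this
  rw [← this]
  refine lintegral_congr fun σ => ?_
  congr 1
  rw [← hπ (-σ)]
  rfl

theorem lintegral_sphere_inner_eq {d : ℕ} [Nontrivial (Vel d)] {g : ℝ → ℝ≥0∞} (hg : Measurable g)
    (e e' : Sph d) :
    ∫⁻ σ : Sph d, g (inner ℝ (e : Vel d) (σ : Vel d)) ∂(surf d) =
      ∫⁻ σ : Sph d, g (inner ℝ (e' : Vel d) (σ : Vel d)) ∂(surf d) := by
  -- The reflection in the hyperplane orthogonal to `e - e'` exchanges the two unit vectors.
  set L : Vel d ≃ₗᵢ[ℝ] Vel d := (ℝ ∙ ((e : Vel d) - e'))ᗮ.reflection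
  have hL : L e = e' := Submodule.reflection_sub (by simp)
  have := lintegral_sphere_isometry (g := fun x => g (inner ℝ (e' : Vel d) x / ‖x‖))
    (hg.comp (by fun_prop)) (fun r hr x => by
      simp only [inner_smul_right, norm_smul, Real.norm_of_nonneg hr.le]
      rw [mul_div_mul_left _ _ hr.ne']) L
  simp only [LinearIsometryEquiv.norm_map, norm_eq_of_mem_sphere, div_one] at this
  rw [← this]
  refine lintegral_congr fun σ => ?_
  rw [← hL, LinearIsometryEquiv.inner_map_map]

/-! ### The singular angular weight and the decay of the angular integral -/

/-- The angular weight `(1 - z²)^(-α/2)`, with value `∞` at `z = ± 1` if `α > 0`. -/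
noncomputable def angularWeight (α z : ℝ) : ℝ≥0∞ := ENNReal.ofReal (1 - z ^ 2) ^ (-(α / 2))

theorem measurable_angularWeight (α : ℝ) : Measurable (angularWeight α) := by
  unfold angularWeight
  fun_prop

theorem lintegral_ball_norm_rpow_lt_top {E : Type*} [NormedAddCommGroup E] [NormedSpace ℝ E]
    [Nontrivial E] [FiniteDimensional ℝ E] [MeasurableSpace E] [BorelSpace E] (μ : Measure E)
    [μ.IsAddHaarMeasure] {α : ℝ} (hα : α < Module.finrank ℝ E) :
    ∫⁻ y in Metric.ball (0 : E) 1, ENNReal.ofReal ‖y‖ ^ (-α) ∂μ < ⊤ := by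
  have h1 : IntegrableOn (fun y : E => ‖y‖ ^ (-α)) (Metric.ball 0 1) μ := by
    refine (integrableOn_fun_norm_addHaar μ (f := fun r : ℝ => r ^ (-α))).2 ?_
    have : IntegrableOn (fun y : ℝ => y ^ ((Module.finrank ℝ E : ℝ) - 1 - α)) (Ioo 0 1) := by
      have := intervalIntegral.intervalIntegrable_rpow' (a := 0) (b := 1)
        (r := (Module.finrank ℝ E : ℝ) - 1 - α) (by linarith)
      rw [intervalIntegrable_iff_integrableOn_Ioo_of_le zero_le_one] at this
      exact this
    refine this.congr_fun (fun y hy => ?_) measurableSet_Ioo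
    have hpos : 0 < Module.finrank ℝ E := Module.finrank_pos
    simp only [smul_eq_mul]
    rw [← Real.rpow_natCast, ← Real.rpow_add hy.1, Nat.cast_sub hpos]
    simp [sub_eq_add_neg]
  have h2 := h1.lintegral_lt_top
  refine lt_of_eq_of_lt (lintegral_congr_ae ?_) h2
  have h0 : ∀ᵐ y ∂(μ.restrict (Metric.ball 0 1)), y ≠ 0 := by
    refine ae_restrict_of_ae ?_
    simp [ae_iff]
  filter_upwards [h0] with y hy
  rw [ENNReal.ofReal_rpow_of_pos (norm_pos_iff.2 hy)]

/-- Pass to the unit ball and write `x = (x₀, y)`. There `1 - (x₀/|x|)² = (|x|² - x₀²)/|x|²`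
dominates `‖y‖²`, even with the sup norm of `y`, so the weight is at most `‖y‖^(-α)`. This is
integrable near `0` in dimension `d - 1 > α`. -/
theorem lintegral_angularWeight_lt_top {d : ℕ} (hd : 2 ≤ d) {α : ℝ} (hα0 : 0 ≤ α)
    (hα : α < (d : ℝ) - 1) (e : Sph d) :
    ∫⁻ σ : Sph d, angularWeight α (inner ℝ (e : Vel d) (σ : Vel d)) ∂(surf d) < ⊤ := by
  obtain ⟨n, rfl⟩ : ∃ n, d = n + 2 := ⟨d - 2, by omega⟩
  have : Nontrivial (Vel (n + 2)) := inferInstance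
  let e₀ : Sph (n + 2) := ⟨EuclideanSpace.single 0 1, by simp⟩
  rw [lintegral_sphere_inner_eq (measurable_angularWeight α) e e₀]
  have hball := lintegral_ball_radial
    (g := fun x : Vel (n + 2) => angularWeight α (inner ℝ (e₀ : Vel (n + 2)) x / ‖x‖))
    ((measurable_angularWeight α).comp (by fun_prop)) (fun r hr x => by
      simp only [inner_smul_right, norm_smul, Real.norm_of_nonneg hr.le]
      rw [mul_div_mul_left _ _ hr.ne'])
  simp only [norm_eq_of_mem_sphere, div_one] at hball
  have hv := volumeIoiPow_Iio_one (Module.finrank ℝ (Vel (n + 2)) - 1)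
  suffices H : ∫⁻ x in Metric.ball (0 : Vel (n + 2)) 1,
      angularWeight α (inner ℝ (e₀ : Vel (n + 2)) x / ‖x‖) < ⊤ by
    rw [hball] at H
    rcases ENNReal.mul_lt_top_iff.1 H with h | h | h
    · exact h.2
    · exact absurd h hv.1
    · rw [h]; exact ENNReal.zero_lt_top
  let T : Vel (n + 2) ≃ᵐ ℝ × (Fin (n + 1) → ℝ) :=
    (MeasurableEquiv.toLp 2 (Fin (n + 2) → ℝ)).symm.trans
      (MeasurableEquiv.piFinSuccAbove (fun _ => ℝ) 0)
  have hT : MeasurePreserving T :=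
    (EuclideanSpace.volume_preserving_symm_measurableEquiv_toLp (Fin (n + 2))).trans
      (volume_preserving_piFinSuccAbove (fun _ => ℝ) 0)
  have hT1 : ∀ x, (T x).1 = x 0 := fun x => rfl
  have hT2 : ∀ x i, (T x).2 i = x (Fin.succ i) := fun x i => rfl
  have hsum : ∀ x : Vel (n + 2), ‖(T x).2‖ ^ 2 ≤ ‖x‖ ^ 2 - x 0 ^ 2 := fun x => by
    have h1 : ‖x‖ ^ 2 = x 0 ^ 2 + ∑ i : Fin (n + 1), x i.succ ^ 2 := by
      rw [EuclideanSpace.norm_sq_eq, Fin.sum_univ_succ]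
      simp
    rw [h1, add_sub_cancel_left]
    have h2 : ‖(T x).2‖ ≤ √ (∑ i : Fin (n + 1), x i.succ ^ 2) := by
      refine (pi_norm_le_iff_of_nonneg (Real.sqrt_nonneg _)).2 fun i => ?_
      rw [hT2, Real.norm_eq_abs]
      refine Real.abs_le_sqrt ?_
      exact Finset.single_le_sum (f := fun i : Fin (n + 1) => x i.succ ^ 2)
        (fun j _ => sq_nonneg _) (Finset.mem_univ i)
    calc ‖(T x).2‖ ^ 2 ≤ √ (∑ i : Fin (n + 1), x i.succ ^ 2) ^ 2 := by gcongr
      _ = _ := Real.sq_sqrt (Finset.sum_nonneg fun _ _ => sq_nonneg _)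
  let G : ℝ × (Fin (n + 1) → ℝ) → ℝ≥0∞ := (Ioo (-1 : ℝ) 1 ×ˢ Metric.ball 0 1).indicator
    fun z => ENNReal.ofReal ‖z.2‖ ^ (-α)
  have hle : ∀ x ∈ Metric.ball (0 : Vel (n + 2)) 1,
      angularWeight α (inner ℝ (e₀ : Vel (n + 2)) x / ‖x‖) ≤ G (T x) := by
    intro x hx
    have hx1 : ‖x‖ < 1 := by simpa using hx
    have hs := hsum x
    have hx2 : ‖x‖ ^ 2 < 1 := by nlinarith [norm_nonneg x]
    have hmem : T x ∈ Ioo (-1 : ℝ) 1 ×ˢ Metric.ball (0 : Fin (n + 1) → ℝ) 1 := by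
      refine ⟨?_, ?_⟩
      · rw [hT1]
        rw [mem_Ioo, ← abs_lt, ← sq_lt_one_iff_abs_lt_one]
        nlinarith [sq_nonneg ‖(T x).2‖]
      · rw [mem_ball_zero_iff, ← abs_of_nonneg (norm_nonneg _), ← sq_lt_one_iff_abs_lt_one]
        nlinarith [sq_nonneg (x 0)]
    simp only [G]
    rw [indicator_of_mem hmem]
    have hin : inner ℝ (e₀ : Vel (n + 2)) x = x 0 := by
      simp [e₀, EuclideanSpace.inner_single_left]
    have key : ‖(T x).2‖ ^ 2 ≤ 1 - (x 0 / ‖x‖) ^ 2 := by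
      by_cases h0 : x = 0
      · have : ‖(T x).2‖ ^ 2 ≤ 0 := by simpa [h0] using hs
        simp only [h0, norm_zero, div_zero] at this ⊢
        linarith
      · have hp : 0 < ‖x‖ ^ 2 := by positivity
        rw [div_pow, ← sub_nonneg]
        have : 1 - x 0 ^ 2 / ‖x‖ ^ 2 - ‖(T x).2‖ ^ 2 =
          ((‖x‖ ^ 2 - x 0 ^ 2) - ‖x‖ ^ 2 * ‖(T x).2‖ ^ 2) / ‖x‖ ^ 2 := by field_simp
        rw [this]
        refine div_nonneg ?_ hp.le
        nlinarith [sq_nonneg ‖(T x).2‖]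
    rw [hin]
    unfold angularWeight
    calc ENNReal.ofReal (1 - (x 0 / ‖x‖) ^ 2) ^ (-(α / 2))
        ≤ ENNReal.ofReal (‖(T x).2‖ ^ 2) ^ (-(α / 2)) := by
          rw [ENNReal.rpow_neg, ENNReal.rpow_neg, ENNReal.inv_le_inv]
          gcongr
      _ = ENNReal.ofReal ‖(T x).2‖ ^ (-α) := by
          rw [ENNReal.ofReal_pow (norm_nonneg _), ← ENNReal.rpow_natCast, ← ENNReal.rpow_mul]
          congr 1
          push_cast
          ring
  have hGm : Measurable G := by
    refine Measurable.indicator ?_ (measurableSet_Ioo.prod measurableSet_ball)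
    fun_prop
  calc ∫⁻ x in Metric.ball (0 : Vel (n + 2)) 1, angularWeight α (inner ℝ (e₀ : Vel (n + 2)) x / ‖x‖)
      ≤ ∫⁻ x in Metric.ball (0 : Vel (n + 2)) 1, G (T x) :=
        setLIntegral_mono' measurableSet_ball hle
    _ ≤ ∫⁻ x, G (T x) := setLIntegral_le_lintegral _ _
    _ = ∫⁻ z, G z := hT.lintegral_comp hGm
    _ = ∫⁻ z in Ioo (-1 : ℝ) 1 ×ˢ Metric.ball (0 : Fin (n + 1) → ℝ) 1,
          ENNReal.ofReal ‖z.2‖ ^ (-α) :=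
        lintegral_indicator (measurableSet_Ioo.prod measurableSet_ball) _
    _ = ∫⁻ _t in Ioo (-1 : ℝ) 1, ∫⁻ y in Metric.ball (0 : Fin (n + 1) → ℝ) 1,
          ENNReal.ofReal ‖y‖ ^ (-α) := by
        rw [Measure.volume_eq_prod, ← Measure.prod_restrict, lintegral_prod _ (by fun_prop)]
    _ < ⊤ := by
        rw [lintegral_const]
        refine ENNReal.mul_lt_top (lintegral_ball_norm_rpow_lt_top volume ?_) (by simp)
        simp only [Module.finrank_fin_fun]
        push_cast at hα ⊢
        linarith

/-- For exponent `1/2 < d - 1` the weight is integrable and takes the value `⊤` at the poles, so the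
poles form a null set. -/
theorem ae_inner_sq_lt_one {d : ℕ} (hd : 2 ≤ d) (e : Sph d) :
    ∀ᵐ σ : Sph d ∂(surf d), (inner ℝ (e : Vel d) (σ : Vel d)) ^ 2 < 1 := by
  have hd' : (2 : ℝ) ≤ d := by exact_mod_cast hd
  have h := lintegral_angularWeight_lt_top hd (α := 1 / 2) (by norm_num) (by linarith) e
  have := ae_lt_top ((measurable_angularWeight (1 / 2)).comp
    (g := angularWeight (1 / 2)) (f := fun σ : Sph d => inner ℝ (e : Vel d) (σ : Vel d))
    (by fun_prop)) h.ne
  filter_upwards [this] with σ hσ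
  by_contra hc
  have : ENNReal.ofReal (1 - (inner ℝ (e : Vel d) (σ : Vel d)) ^ 2) = 0 :=
    ENNReal.ofReal_eq_zero.2 (by linarith)
  simp only [Function.comp, angularWeight, this] at hσ
  norm_num at hσ

/-- The angular integral that controls the Carleman kernel of the gain term. -/
noncomputable def angularDecay {d : ℕ} (α a W : ℝ) (e : Sph d) (L : ℝ) : ℝ≥0∞ :=
  ∫⁻ σ : Sph d, angularWeight α (inner ℝ (e : Vel d) (σ : Vel d)) *
    ENNReal.ofReal (Real.exp (-a * (max 0 (L * √(1 - (inner ℝ (e : Vel d) (σ : Vel d)) ^ 2) - W)) ^ 2))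
    ∂(surf d)

theorem angularDecay_eq {d : ℕ} [Nontrivial (Vel d)] (α a W : ℝ) (e e' : Sph d) (L : ℝ) :
    angularDecay α a W e L = angularDecay α a W e' L := by
  unfold angularDecay
  exact lintegral_sphere_inner_eq (g := fun z => angularWeight α z *
    ENNReal.ofReal (Real.exp (-a * (max 0 (L * √(1 - z ^ 2) - W)) ^ 2)))
    ((measurable_angularWeight α).mul (by fun_prop)) e e'

theorem angularDecay_le {d : ℕ} {α a W : ℝ} (ha : 0 ≤ a) (e : Sph d) (L : ℝ) :
    angularDecay α a W e L ≤
      ∫⁻ σ : Sph d, angularWeight α (inner ℝ (e : Vel d) (σ : Vel d)) ∂(surf d) := by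
  refine lintegral_mono fun σ => ?_
  refine mul_le_of_le_one_right (zero_le) ?_
  rw [ENNReal.ofReal_le_one, Real.exp_le_one_iff]
  nlinarith [sq_nonneg (max 0 (L * √(1 - (inner ℝ (e : Vel d) (σ : Vel d)) ^ 2) - W))]

theorem angularDecay_anti {d : ℕ} {α a W W' L L' : ℝ} (ha : 0 ≤ a) (e : Sph d) (hL : L ≤ L')
    (hW : W' ≤ W) : angularDecay α a W' e L' ≤ angularDecay α a W e L := by
  refine lintegral_mono fun σ => ?_
  simp only [neg_mul]
  gcongr

/-- Dominated convergence, with the weight itself as majorant: off the poles `√(1 - z²) > 0`, and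
the Gaussian factor tends to `0`. -/
theorem tendsto_angularDecay {d : ℕ} (hd : 2 ≤ d) {α a : ℝ} (hα0 : 0 ≤ α)
    (hα : α < (d : ℝ) - 1) (ha : 0 < a) (W : ℝ) (e : Sph d) :
    Tendsto (angularDecay α a W e) atTop (𝓝 0) := by
  have h := lintegral_angularWeight_lt_top hd hα0 hα e
  have hm : Measurable fun σ : Sph d => angularWeight α (inner ℝ (e : Vel d) (σ : Vel d)) :=
    (measurable_angularWeight α).comp (by fun_prop)
  rw [← lintegral_zero (μ := surf d)]
  unfold angularDecay
  refine tendsto_lintegral_filter_of_dominated_convergence _ ?_ ?_ h.ne ?_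
  · exact Eventually.of_forall fun L => hm.mul (by fun_prop)
  · refine Eventually.of_forall fun L => Eventually.of_forall fun σ => ?_
    refine mul_le_of_le_one_right (zero_le) ?_
    rw [ENNReal.ofReal_le_one, Real.exp_le_one_iff]
    nlinarith [sq_nonneg (max 0 (L * √(1 - (inner ℝ (e : Vel d) (σ : Vel d)) ^ 2) - W))]
  · filter_upwards [ae_lt_top hm h.ne, ae_inner_sq_lt_one hd e] with σ h1 h2
    rw [← mul_zero (angularWeight α (inner ℝ (e : Vel d) (σ : Vel d)))]
    refine ENNReal.Tendsto.const_mul ?_ (Or.inr h1.ne)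
    rw [← ENNReal.ofReal_zero]
    refine ENNReal.tendsto_ofReal (Real.tendsto_exp_atBot.comp ?_)
    have hs : 0 < √(1 - (inner ℝ (e : Vel d) (σ : Vel d)) ^ 2) := Real.sqrt_pos.2 (by linarith)
    have t1 : Tendsto (fun L : ℝ => max 0 (L * √(1 - (inner ℝ (e : Vel d) (σ : Vel d)) ^ 2) - W))
        atTop atTop :=
      tendsto_atTop_mono (fun L => le_max_right _ _)
        (tendsto_atTop_add_const_right _ _ (tendsto_id.atTop_mul_const hs))
    exact ((tendsto_pow_atTop two_ne_zero).comp t1).const_mul_atTop_of_neg (by linarith)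

/-! ### Folded kernels, gain and loss, conservation of mass -/

/-- The angular part of the collision kernel, folded onto `cos θ ≥ 0`. -/
noncomputable def foldedAngular (h : ℝ → ℝ) (z : ℝ) : ℝ≥0∞ :=
  (Ici 0).indicator (fun z => ENNReal.ofReal (h z)) z +
    (Ioi 0).indicator (fun z => ENNReal.ofReal (h (-z))) z

/-- The kernel `|u|^β H (cos θ)` with an extended nonnegative angular part. -/
noncomputable def angularKernel {d : ℕ} (β : ℝ) (H : ℝ → ℝ≥0∞) (u : Vel d) (σ : Sph d) : ℝ≥0∞ :=
  ENNReal.ofReal (‖u‖ ^ β) * H (inner ℝ u (σ : Vel d) / ‖u‖)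

/-- The bilinear gain term with kernel `|u|^β H (cos θ)`. -/
noncomputable def bilinearGain {d : ℕ} (β : ℝ) (H : ℝ → ℝ≥0∞) (P Q : Vel d → ℝ≥0∞) (v : Vel d) :
    ℝ≥0∞ :=
  ∫⁻ vs : Vel d, ∫⁻ σ : Sph d,
    P (postStar v vs σ) * Q (post v vs σ) * angularKernel β H (v - vs) σ ∂(surf d)

/-- The collision frequency `∫ P(v_*) |v - v_*|^β dv_*`. -/
noncomputable def frequency {d : ℕ} (β : ℝ) (P : Vel d → ℝ≥0∞) (v : Vel d) : ℝ≥0∞ :=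
  ∫⁻ vs : Vel d, P vs * ENNReal.ofReal (‖v - vs‖ ^ β)

theorem measurable_foldedAngular {h : ℝ → ℝ} (hh : Measurable h) : Measurable (foldedAngular h) := by
  unfold foldedAngular
  refine Measurable.add ?_ ?_
  · exact Measurable.indicator (by fun_prop) measurableSet_Ici
  · exact Measurable.indicator (by fun_prop) measurableSet_Ioi

@[fun_prop]
theorem Measurable.angularKernel {d : ℕ} {β : ℝ} {H : ℝ → ℝ≥0∞} (hH : Measurable H) {X : Type*}
    [MeasurableSpace X] {u : X → Vel d} {σ : X → Sph d} (hu : Measurable u) (hσ : Measurable σ) :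
    Measurable fun x => angularKernel β H (u x) (σ x) := by
  unfold Boltzmann.angularKernel
  refine Measurable.mul (by fun_prop) (hH.comp ?_)
  exact (hu.inner hσ.subtype_val).div hu.norm

@[fun_prop]
theorem Measurable.post {d : ℕ} {X : Type*} [MeasurableSpace X] {v vs : X → Vel d} {σ : X → Sph d}
    (hv : Measurable v) (hvs : Measurable vs) (hσ : Measurable σ) :
    Measurable fun x => post (v x) (vs x) (σ x) := by
  unfold Boltzmann.post
  fun_prop

@[fun_prop]
theorem Measurable.postStar {d : ℕ} {X : Type*} [MeasurableSpace X] {v vs : X → Vel d}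
    {σ : X → Sph d} (hv : Measurable v) (hvs : Measurable vs) (hσ : Measurable σ) :
    Measurable fun x => postStar (v x) (vs x) (σ x) := by
  unfold Boltzmann.postStar
  fun_prop

/-- Folding the angular variable against a function that is even on the sphere. -/
theorem lintegral_folded {d : ℕ} [Nontrivial (Vel d)] {h : ℝ → ℝ} (hh : Measurable h)
    {G : Sph d → ℝ≥0∞} (hG : Measurable G) (heven : ∀ σ, G (-σ) = G σ) (u : Vel d) (c : ℝ) :
    ∫⁻ σ : Sph d, G σ * ENNReal.ofReal (h (inner ℝ u (σ : Vel d) / c)) ∂(surf d) =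
      ∫⁻ σ : Sph d, G σ * foldedAngular h (inner ℝ u (σ : Vel d) / c) ∂(surf d) := by
  have hz : Measurable fun σ : Sph d => inner ℝ u (σ : Vel d) / c := by fun_prop
  have m1 : Measurable ((Ici (0 : ℝ)).indicator fun z => ENNReal.ofReal (h z)) :=
    Measurable.indicator (by fun_prop) measurableSet_Ici
  have m2 : Measurable ((Iio (0 : ℝ)).indicator fun z => ENNReal.ofReal (h z)) :=
    Measurable.indicator (by fun_prop) measurableSet_Iio
  have h1 : ∀ z : ℝ, ENNReal.ofReal (h z) =
      (Ici (0 : ℝ)).indicator (fun z => ENNReal.ofReal (h z)) z +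
      (Iio (0 : ℝ)).indicator (fun z => ENNReal.ofReal (h z)) z := fun z => by
    by_cases hz : 0 ≤ z
    · simp [hz]
    · simp [hz, not_le.1 hz]
  have h2 : ∀ σ : Sph d, G σ * ENNReal.ofReal (h (inner ℝ u (σ : Vel d) / c)) =
      G σ * (Ici (0 : ℝ)).indicator (fun z => ENNReal.ofReal (h z)) (inner ℝ u (σ : Vel d) / c) +
      G σ * (Iio (0 : ℝ)).indicator (fun z => ENNReal.ofReal (h z)) (inner ℝ u (σ : Vel d) / c) :=
    fun σ => by rw [h1, mul_add]
  simp_rw [h2, foldedAngular, mul_add]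
  have m1z : Measurable fun σ : Sph d => G σ *
      (Ici (0 : ℝ)).indicator (fun z => ENNReal.ofReal (h z)) (inner ℝ u (σ : Vel d) / c) :=
    hG.mul (m1.comp hz)
  have m2z : Measurable fun σ : Sph d => G σ *
      (Iio (0 : ℝ)).indicator (fun z => ENNReal.ofReal (h z)) (inner ℝ u (σ : Vel d) / c) :=
    hG.mul (m2.comp hz)
  rw [lintegral_add_left m1z, lintegral_add_left m1z]
  congr 1
  rw [← lintegral_sphere_neg m2z]
  refine lintegral_congr fun σ => ?_
  simp only [heven]
  congr 1
  have : inner ℝ u ((-σ : Sph d) : Vel d) / c = -(inner ℝ u (σ : Vel d) / c) := by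
    simp [inner_neg_right, neg_div]
  rw [this]
  simp only [indicator, mem_Iio, mem_Ioi, neg_lt_zero]

theorem post_neg {d : ℕ} (v vs : Vel d) (σ : Sph d) : post v vs (-σ) = postStar v vs σ := by
  simp [post, postStar, sub_eq_add_neg]

theorem postStar_neg {d : ℕ} (v vs : Vel d) (σ : Sph d) : postStar v vs (-σ) = post v vs σ := by
  simp [post, postStar]

/-- The change `σ ↦ -σ` exchanges `v'` and `v'_*`, so `F(v'_*) F(v')` is even in `σ` and the angular
part may be folded onto `cos θ ≥ 0`. -/
theorem gain_eq {d : ℕ} [Nontrivial (Vel d)] {β : ℝ} {h : ℝ → ℝ} (hh : Measurable h)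
    {F : Vel d → ℝ} (hF : Measurable F) (hF0 : ∀ v, 0 ≤ F v) (v : Vel d) :
    gain β h F v = bilinearGain β (foldedAngular h) (fun w => ENNReal.ofReal (F w))
      (fun w => ENNReal.ofReal (F w)) v := by
  unfold gain bilinearGain
  refine lintegral_congr fun vs => ?_
  have := lintegral_folded hh (G := fun σ => ENNReal.ofReal (F (postStar v vs σ)) *
    ENNReal.ofReal (F (post v vs σ)) * ENNReal.ofReal (‖v - vs‖ ^ β)) (by fun_prop)
    (fun σ => by
      simp only [post_neg, postStar_neg]
      rw [mul_comm (ENNReal.ofReal (F (post v vs σ)))]) (v - vs) ‖v - vs‖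
  simp only [angularKernel, ← mul_assoc] at this ⊢
  rw [← this]
  refine lintegral_congr fun σ => ?_
  rw [kernel, ← mul_assoc, ENNReal.ofReal_mul, ENNReal.ofReal_mul, ENNReal.ofReal_mul (hF0 _)]
  · exact mul_nonneg (hF0 _) (hF0 _)
  · exact mul_nonneg (mul_nonneg (hF0 _) (hF0 _)) (by positivity)

theorem IsCutoff.lintegral_eq_one {d : ℕ} (hd : 2 ≤ d) {α C : ℝ} {h : ℝ → ℝ}
    (hh : IsCutoff d α C h) (e : Sph d) :
    ∫⁻ σ : Sph d, ENNReal.ofReal (h (inner ℝ (e : Vel d) (σ : Vel d))) ∂(surf d) = 1 := by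
  have hint : Integrable (fun σ : Sph d => h (inner ℝ (e : Vel d) (σ : Vel d))) (surf d) := by
    -- The Bochner integral of a nonintegrable function is `0`, so the normalization to `1` already
    -- forces integrability.
    by_contra hc
    have := hh.normalized e
    rw [integral_undef hc] at this
    exact zero_ne_one this
  rw [← ofReal_integral_eq_lintegral_ofReal hint, hh.normalized, ENNReal.ofReal_one]
  filter_upwards [ae_inner_sq_lt_one hd e] with σ hσ
  exact hh.nonneg _ (abs_lt.1 ((sq_lt_one_iff_abs_lt_one _).1 hσ))

theorem IsCutoff.lintegral_folded_eq_one {d : ℕ} [Nontrivial (Vel d)] (hd : 2 ≤ d) {α C : ℝ}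
    {h : ℝ → ℝ} (hh : IsCutoff d α C h) (e : Sph d) :
    ∫⁻ σ : Sph d, foldedAngular h (inner ℝ (e : Vel d) (σ : Vel d)) ∂(surf d) = 1 := by
  have := lintegral_folded hh.measurable (G := fun _ => 1) (by fun_prop) (fun _ => rfl) (e : Vel d) 1
  simp only [one_mul, div_one] at this
  rw [← this, hh.lintegral_eq_one hd]

theorem lintegral_angularKernel {d : ℕ} {β : ℝ} (hβ : 0 < β) {H : ℝ → ℝ≥0∞} (hH : Measurable H)
    (h1 : ∀ e : Sph d, ∫⁻ σ : Sph d, H (inner ℝ (e : Vel d) (σ : Vel d)) ∂(surf d) = 1)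
    (u : Vel d) :
    ∫⁻ σ : Sph d, angularKernel β H u σ ∂(surf d) = ENNReal.ofReal (‖u‖ ^ β) := by
  by_cases hu : u = 0
  · simp [angularKernel, hu, hβ.ne']
  unfold angularKernel
  have hm : Measurable fun σ : Sph d => H (inner ℝ u (σ : Vel d) / ‖u‖) := hH.comp (by fun_prop)
  rw [lintegral_const_mul _ hm]
  have := h1 ⟨‖u‖⁻¹ • u, by simp [norm_smul, hu]⟩
  simp only [real_inner_smul_left, inv_mul_eq_div] at this
  rw [this, mul_one]

theorem loss_eq {d : ℕ} [Nontrivial (Vel d)] (hd : 2 ≤ d) {α C β : ℝ} (hβ : 0 < β) {h : ℝ → ℝ}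
    (hh : IsCutoff d α C h)
    {F : Vel d → ℝ} (hF : Measurable F) (hF0 : ∀ v, 0 ≤ F v) (v : Vel d) :
    loss β h F v = ENNReal.ofReal (F v) * frequency β (fun w => ENNReal.ofReal (F w)) v := by
  have hH : Measurable fun z => ENNReal.ofReal (h z) := hh.measurable.ennreal_ofReal
  unfold loss frequency
  rw [← lintegral_const_mul _ (by fun_prop)]
  refine lintegral_congr fun vs => ?_
  rw [← lintegral_angularKernel hβ hH (hh.lintegral_eq_one hd),
    ← lintegral_const_mul _ (by fun_prop), ← lintegral_const_mul _ (by fun_prop)]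
  refine lintegral_congr fun σ => ?_
  rw [kernel, angularKernel, ← mul_assoc, ENNReal.ofReal_mul, ENNReal.ofReal_mul,
    ENNReal.ofReal_mul (hF0 _)]
  · ring
  · exact mul_nonneg (hF0 _) (hF0 _)
  · exact mul_nonneg (mul_nonneg (hF0 _) (hF0 _)) (by positivity)

/-- In terms of the center of mass `z` and relative velocity `u`, the collision replaces `z ± u/2`
by `z ± |u|σ/2`. Exchanging `u` with `|u|σ` keeps the kernel, since `|u|` and `cos θ` are symmetric;
then `σ` occurs in the kernel alone and integrates out. -/
theorem lintegral_bilinearGain {d : ℕ} [Nontrivial (Vel d)] {β : ℝ} (hβ : 0 < β) {H : ℝ → ℝ≥0∞}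
    (hH : Measurable H)
    (h1 : ∀ e : Sph d, ∫⁻ σ : Sph d, H (inner ℝ (e : Vel d) (σ : Vel d)) ∂(surf d) = 1)
    {P Q : Vel d → ℝ≥0∞} (hP : Measurable P) (hQ : Measurable Q) :
    ∫⁻ v, bilinearGain β H P Q v = ∫⁻ v, Q v * frequency β P v := by
  unfold bilinearGain frequency
  have e1 : ∀ vs u : Vel d, ∀ σ : Sph d, postStar (vs + u) vs σ =
      (vs + (1 / 2 : ℝ) • u) - (1 / 2 : ℝ) • (‖u‖ • (σ : Vel d)) := fun vs u σ => by
    simp only [postStar, add_sub_cancel_left]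
    module
  have e2 : ∀ vs u : Vel d, ∀ σ : Sph d, post (vs + u) vs σ =
      (vs + (1 / 2 : ℝ) • u) + (1 / 2 : ℝ) • (‖u‖ • (σ : Vel d)) := fun vs u σ => by
    simp only [post, add_sub_cancel_left]
    module
  calc ∫⁻ v, ∫⁻ vs, ∫⁻ σ : Sph d, P (postStar v vs σ) * Q (post v vs σ) *
        angularKernel β H (v - vs) σ ∂(surf d)
      = ∫⁻ vs, ∫⁻ v, ∫⁻ σ : Sph d, P (postStar v vs σ) * Q (post v vs σ) *
        angularKernel β H (v - vs) σ ∂(surf d) := by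
        rw [lintegral_lintegral_swap]
        refine Measurable.aemeasurable ?_
        refine Measurable.lintegral_prod_right' (f := fun p : (Vel d × Vel d) × Sph d =>
          P (postStar p.1.1 p.1.2 p.2) * Q (post p.1.1 p.1.2 p.2) *
          angularKernel β H (p.1.1 - p.1.2) p.2) ?_
        fun_prop
    _ = ∫⁻ vs, ∫⁻ u, ∫⁻ σ : Sph d, P (postStar (vs + u) vs σ) * Q (post (vs + u) vs σ) *
        angularKernel β H u σ ∂(surf d) := by
        refine lintegral_congr fun vs => ?_
        rw [← lintegral_add_left_eq_self _ vs]
        simp only [add_sub_cancel_left]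
    _ = ∫⁻ u, ∫⁻ vs, ∫⁻ σ : Sph d, P (postStar (vs + u) vs σ) * Q (post (vs + u) vs σ) *
        angularKernel β H u σ ∂(surf d) := by
        rw [lintegral_lintegral_swap]
        refine Measurable.aemeasurable ?_
        refine Measurable.lintegral_prod_right' (f := fun p : (Vel d × Vel d) × Sph d =>
          P (postStar (p.1.1 + p.1.2) p.1.1 p.2) * Q (post (p.1.1 + p.1.2) p.1.1 p.2) *
          angularKernel β H p.1.2 p.2) ?_
        fun_prop
    -- For fixed `u`, translate `v_*` to the center of mass `z = v_* + u/2`.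
    _ = ∫⁻ u, ∫⁻ z, ∫⁻ σ : Sph d, P (z - (1 / 2 : ℝ) • (‖u‖ • (σ : Vel d))) *
        Q (z + (1 / 2 : ℝ) • (‖u‖ • (σ : Vel d))) * angularKernel β H u σ ∂(surf d) := by
        refine lintegral_congr fun u => ?_
        simp_rw [e1, e2]
        exact lintegral_add_right_eq_self (fun z => ∫⁻ σ : Sph d,
          P (z - (1 / 2 : ℝ) • (‖u‖ • (σ : Vel d))) *
          Q (z + (1 / 2 : ℝ) • (‖u‖ • (σ : Vel d))) * angularKernel β H u σ ∂(surf d)) _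
    _ = ∫⁻ z, ∫⁻ u, ∫⁻ σ : Sph d, P (z - (1 / 2 : ℝ) • (‖u‖ • (σ : Vel d))) *
        Q (z + (1 / 2 : ℝ) • (‖u‖ • (σ : Vel d))) * angularKernel β H u σ ∂(surf d) := by
        rw [lintegral_lintegral_swap]
        refine Measurable.aemeasurable ?_
        refine Measurable.lintegral_prod_right' (f := fun p : (Vel d × Vel d) × Sph d =>
          P (p.1.2 - (1 / 2 : ℝ) • (‖p.1.1‖ • (p.2 : Vel d))) *
          Q (p.1.2 + (1 / 2 : ℝ) • (‖p.1.1‖ • (p.2 : Vel d))) * angularKernel β H p.1.1 p.2) ?_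
        fun_prop
    _ = ∫⁻ z, ∫⁻ u, ∫⁻ σ : Sph d, P (z - (1 / 2 : ℝ) • u) *
        Q (z + (1 / 2 : ℝ) • u) * angularKernel β H u σ ∂(surf d) := by
        refine lintegral_congr fun z => ?_
        -- The cosine is written as `u·y / (|u||y|)` with `y = |u|σ`, a form symmetric in `u` and
        -- `y`.
        have := lintegral_sphere_swap (d := d) (Φ := fun u y => P (z - (1 / 2 : ℝ) • y) *
          Q (z + (1 / 2 : ℝ) • y) *
          (ENNReal.ofReal (‖u‖ ^ β) * H (inner ℝ u y / (‖u‖ * ‖y‖)))) (by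
            simp only [Function.uncurry_def]
            have : Measurable fun p : Vel d × Vel d => H (inner ℝ p.1 p.2 / (‖p.1‖ * ‖p.2‖)) :=
              hH.comp (by fun_prop)
            fun_prop)
        simp only [norm_smul, norm_norm, norm_eq_of_mem_sphere, mul_one, real_inner_smul_left,
          real_inner_smul_right] at this
        have hz : ∀ (u : Vel d) (σ : Sph d), ‖u‖ * inner ℝ u (σ : Vel d) / (‖u‖ * ‖u‖) =
            inner ℝ u (σ : Vel d) / ‖u‖ := fun u σ => by
          by_cases hu : u = 0
          · simp [hu]
          · have : ‖u‖ ≠ 0 := norm_ne_zero_iff.2 hu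
            field_simp
        simp only [hz, real_inner_comm] at this
        simp only [angularKernel]
        rw [this]
    _ = ∫⁻ z, ∫⁻ u, P (z - (1 / 2 : ℝ) • u) * Q (z + (1 / 2 : ℝ) • u) *
        ENNReal.ofReal (‖u‖ ^ β) := by
        refine lintegral_congr fun z => lintegral_congr fun u => ?_
        rw [lintegral_const_mul _ (by fun_prop), lintegral_angularKernel hβ hH h1]
    _ = ∫⁻ u, ∫⁻ z, P (z - (1 / 2 : ℝ) • u) * Q (z + (1 / 2 : ℝ) • u) *
        ENNReal.ofReal (‖u‖ ^ β) := by
        rw [lintegral_lintegral_swap]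
        exact Measurable.aemeasurable (by simp only [Function.uncurry_def]; fun_prop)
    _ = ∫⁻ u, ∫⁻ vs, P vs * Q (vs + u) * ENNReal.ofReal (‖u‖ ^ β) := by
        refine lintegral_congr fun u => ?_
        rw [← lintegral_add_right_eq_self _ ((1 / 2 : ℝ) • u)]
        refine lintegral_congr fun vs => ?_
        rw [add_sub_cancel_right, add_assoc, ← add_smul]
        norm_num
    _ = ∫⁻ vs, ∫⁻ u, P vs * Q (vs + u) * ENNReal.ofReal (‖u‖ ^ β) := by
        rw [lintegral_lintegral_swap]
        exact Measurable.aemeasurable (by simp only [Function.uncurry_def]; fun_prop)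
    _ = ∫⁻ vs, ∫⁻ v, P vs * Q v * ENNReal.ofReal (‖v - vs‖ ^ β) := by
        refine lintegral_congr fun vs => ?_
        rw [← lintegral_add_left_eq_self (fun v => P vs * Q v * ENNReal.ofReal (‖v - vs‖ ^ β)) vs]
        simp only [add_sub_cancel_left]
    _ = ∫⁻ v, ∫⁻ vs, P vs * Q v * ENNReal.ofReal (‖v - vs‖ ^ β) := by
        rw [lintegral_lintegral_swap]
        exact Measurable.aemeasurable (by simp only [Function.uncurry_def]; fun_prop)
    _ = ∫⁻ v, Q v * ∫⁻ vs, P vs * ENNReal.ofReal (‖v - vs‖ ^ β) := by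
        refine lintegral_congr fun v => ?_
        rw [← lintegral_const_mul _ (by fun_prop)]
        refine lintegral_congr fun vs => ?_
        ring

/-! ### The half-angle map and the Carleman-type bound -/

/-- The map `u ↦ (u + |u| σ) / 2`, which sends `v - v_*` to `v - v'_*`. -/
noncomputable def halfReflect {d : ℕ} (σ : Sph d) (u : Vel d) : Vel d :=
  (1 / 2 : ℝ) • (u + ‖u‖ • (σ : Vel d))

/-- The inverse of `halfReflect σ`. -/
noncomputable def halfReflectInv {d : ℕ} (σ : Sph d) (q : Vel d) : Vel d :=
  (2 : ℝ) • q - (‖q‖ ^ 2 / inner ℝ q (σ : Vel d)) • (σ : Vel d)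

theorem inner_self_sph {d : ℕ} (σ : Sph d) : inner ℝ (σ : Vel d) (σ : Vel d) = 1 := by
  rw [real_inner_self_eq_norm_sq, norm_eq_of_mem_sphere, one_pow]

theorem inner_halfReflect {d : ℕ} (σ : Sph d) (u : Vel d) :
    inner ℝ (halfReflect σ u) (σ : Vel d) = (inner ℝ u (σ : Vel d) + ‖u‖) / 2 := by
  simp only [halfReflect, real_inner_smul_left, inner_add_left, inner_self_sph]
  ring

theorem norm_sq_halfReflect {d : ℕ} (σ : Sph d) (u : Vel d) :
    ‖halfReflect σ u‖ ^ 2 = ‖u‖ * inner ℝ (halfReflect σ u) (σ : Vel d) := by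
  rw [inner_halfReflect, halfReflect, norm_smul, mul_pow, norm_add_sq_real, norm_smul,
    real_inner_smul_right, norm_norm, norm_eq_of_mem_sphere]
  norm_num
  ring

/-- With `q` the image of `u`, one has `|q|² = |u| (q·σ)`. On the half-space `q·σ > 0`, so `|u|`,
and with it `u = 2q - |u|σ`, is recovered from `q`. -/
theorem halfReflectInv_halfReflect {d : ℕ} (σ : Sph d) {u : Vel d} (hu : u ≠ 0)
    (hσ : 0 ≤ inner ℝ u (σ : Vel d)) : halfReflectInv σ (halfReflect σ u) = u := by
  have hp : 0 < inner ℝ (halfReflect σ u) (σ : Vel d) := by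
    rw [inner_halfReflect]
    have := norm_pos_iff.2 hu
    linarith
  rw [halfReflectInv, norm_sq_halfReflect, mul_div_cancel_right₀ _ hp.ne', halfReflect, smul_smul]
  norm_num

theorem hasFDerivAt_halfReflect {d : ℕ} (σ : Sph d) {u : Vel d} (hu : u ≠ 0) :
    HasFDerivAt (halfReflect σ) ((1 / 2 : ℝ) • (ContinuousLinearMap.id ℝ (Vel d) +
      (‖u‖⁻¹ • innerSL ℝ u).smulRight (σ : Vel d))) u := by
  have hn : HasFDerivAt (fun x : Vel d => ‖x‖) (‖u‖⁻¹ • innerSL ℝ u) u := by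
    have h1 := (hasStrictFDerivAt_norm_sq u).hasFDerivAt.sqrt (by positivity)
    simp only [Real.sqrt_sq (norm_nonneg _)] at h1
    have h2 : ‖u‖⁻¹ • innerSL ℝ u = (1 / (2 * ‖u‖)) • (2 • innerSL ℝ u) := by
      rw [← Nat.cast_smul_eq_nsmul ℝ, smul_smul]
      congr 1
      have := norm_ne_zero_iff.2 hu
      push_cast
      field_simp
    rw [h2]
    exact h1
  exact ((hasFDerivAt_id u).add (hn.smul_const (σ : Vel d))).const_smul (1 / 2 : ℝ)

/-- The derivative is half of a rank-one perturbation of the identity, whose determinant is `1 + cos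
θ`. -/
theorem det_fderiv_halfReflect {d : ℕ} (σ : Sph d) (u : Vel d) :
    ((1 / 2 : ℝ) • (ContinuousLinearMap.id ℝ (Vel d) +
      (‖u‖⁻¹ • innerSL ℝ u).smulRight (σ : Vel d))).det =
      (1 / 2) ^ d * (1 + inner ℝ u (σ : Vel d) / ‖u‖) := by
  have h1 : (((1 / 2 : ℝ) • (ContinuousLinearMap.id ℝ (Vel d) +
      (‖u‖⁻¹ • innerSL ℝ u).smulRight (σ : Vel d)) : Vel d →L[ℝ] Vel d) : Vel d →ₗ[ℝ] Vel d) =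
      (1 / 2 : ℝ) • LinearMap.transvection
        ((‖u‖⁻¹ • innerSL ℝ u : Vel d →L[ℝ] ℝ) : Vel d →ₗ[ℝ] ℝ) (σ : Vel d) := by
    ext x
    simp [LinearMap.transvection]
  rw [ContinuousLinearMap.det, h1, LinearMap.det_smul, LinearMap.transvection.det]
  simp [inv_mul_eq_div]

/-- On `cos θ ≥ 0` the Jacobian `2^(-d) (1 + cos θ)` is at least `2^(-d)`. This is why the kernel
was folded: the Jacobian degenerates at `θ = π`. -/
theorem lintegral_comp_halfReflect_le {d : ℕ} (σ : Sph d) (g : Vel d → ℝ≥0∞) :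
    ∫⁻ u in {u : Vel d | u ≠ 0 ∧ 0 ≤ inner ℝ u (σ : Vel d)}, g (halfReflect σ u) ≤
      2 ^ d * ∫⁻ q, g q := by
  set s : Set (Vel d) := {u : Vel d | u ≠ 0 ∧ 0 ≤ inner ℝ u (σ : Vel d)}
  have hs : MeasurableSet s := by
    exact (measurableSet_singleton (0 : Vel d)).compl.inter
      (measurableSet_le (g := fun u : Vel d => inner ℝ u (σ : Vel d)) measurable_const
        (by fun_prop))
  have hinj : InjOn (halfReflect σ) s := fun u hu u' hu' he => by
    rw [← halfReflectInv_halfReflect σ hu.1 hu.2, he, halfReflectInv_halfReflect σ hu'.1 hu'.2]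
  have key := lintegral_image_eq_lintegral_abs_det_fderiv_mul volume hs
    (fun u hu => (hasFDerivAt_halfReflect σ hu.1).hasFDerivWithinAt) hinj g
  calc ∫⁻ u in s, g (halfReflect σ u)
      ≤ ∫⁻ u in s, 2 ^ d * (ENNReal.ofReal |((1 / 2 : ℝ) • (ContinuousLinearMap.id ℝ (Vel d) +
      (‖u‖⁻¹ • innerSL ℝ u).smulRight (σ : Vel d))).det| * g (halfReflect σ u)) := by
        refine setLIntegral_mono' hs fun u hu => ?_
        rw [det_fderiv_halfReflect, ← mul_assoc]
        refine le_mul_of_one_le_left zero_le ?_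
        have h2 : (2 : ℝ≥0∞) ^ d = ENNReal.ofReal (2 ^ d) := by
          rw [ENNReal.ofReal_pow (by norm_num)]; norm_num
        rw [h2, ← ENNReal.ofReal_mul (by positivity), ENNReal.one_le_ofReal]
        have h3 : 0 ≤ inner ℝ u (σ : Vel d) / ‖u‖ := div_nonneg hu.2 (norm_nonneg _)
        rw [abs_of_nonneg (by positivity), ← mul_assoc, ← mul_pow]
        norm_num
        exact h3
    _ = 2 ^ d * ∫⁻ q in halfReflect σ '' s, g q := by
        rw [lintegral_const_mul' _ _ (by simp), key]
    _ ≤ 2 ^ d * ∫⁻ q, g q := by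
        exact mul_le_mul_right (setLIntegral_le_lintegral _ _) _

theorem postStar_sub {d : ℕ} (v u : Vel d) (σ : Sph d) :
    postStar v (v - u) σ = v - halfReflect σ u := by
  simp only [postStar, halfReflect, sub_sub_cancel]
  module

theorem norm_halfReflectInv {d : ℕ} (σ : Sph d) {q : Vel d}
    (hq : 0 < inner ℝ q (σ : Vel d)) :
    ‖halfReflectInv σ q‖ = ‖q‖ ^ 2 / inner ℝ q (σ : Vel d) := by
  rw [← sq_eq_sq₀ (norm_nonneg _) (by positivity), halfReflectInv, norm_sub_sq_real, norm_smul,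
    norm_smul, real_inner_smul_right, real_inner_smul_left, norm_eq_of_mem_sphere, mul_one,
    Real.norm_eq_abs, Real.norm_eq_abs, sq_abs, mul_pow]
  norm_num
  field_simp
  ring

theorem inner_halfReflectInv {d : ℕ} (σ : Sph d) (q : Vel d) :
    inner ℝ (halfReflectInv σ q) (σ : Vel d) =
      2 * inner ℝ q (σ : Vel d) - ‖q‖ ^ 2 / inner ℝ q (σ : Vel d) := by
  rw [halfReflectInv, inner_sub_left, real_inner_smul_left, real_inner_smul_left, inner_self_sph,
    mul_one]

theorem norm_sq_halfReflectInv_sub {d : ℕ} (σ : Sph d) {q : Vel d}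
    (hq : 0 < inner ℝ q (σ : Vel d)) :
    ‖halfReflectInv σ q - q‖ ^ 2 =
      (‖q‖ ^ 2 / inner ℝ q (σ : Vel d)) ^ 2 - ‖q‖ ^ 2 := by
  have : halfReflectInv σ q - q = q - (‖q‖ ^ 2 / inner ℝ q (σ : Vel d)) • (σ : Vel d) := by
    rw [halfReflectInv]; module
  rw [this, norm_sub_sq_real, norm_smul, real_inner_smul_right, norm_eq_of_mem_sphere, mul_one,
    Real.norm_eq_abs, sq_abs]
  field_simp
  ring

/-- With `u = v - v_*` and `q = v - v'_*`, the vector `u - q` is orthogonal to `q` and has length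
`|q| tan(θ/2) ≥ |q| sin(θ/2)`. As `u - q = v'_* - v_*`, the triangle inequality makes `v_*` large
once `|q| sin(θ/2)` exceeds `|v'_*|`. -/
theorem sqrt_mul_le_norm_sub {d : ℕ} (σ : Sph d) (v : Vel d) {q : Vel d}
    (hq : 0 < inner ℝ q (σ : Vel d)) :
    ‖q‖ * √(1 - (inner ℝ q (σ : Vel d) / ‖q‖) ^ 2) - ‖v - q‖ ≤ ‖v - halfReflectInv σ q‖ := by
  have hq0 : 0 < ‖q‖ := by
    rw [norm_pos_iff]; rintro rfl; simp at hq
  have hle : inner ℝ q (σ : Vel d) ≤ ‖q‖ := by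
    simpa using real_inner_le_norm q (σ : Vel d)
  have h1 : ‖q‖ * √(1 - (inner ℝ q (σ : Vel d) / ‖q‖) ^ 2) ≤ ‖halfReflectInv σ q - q‖ := by
    refine (abs_le_of_sq_le_sq' ?_ (norm_nonneg _)).2
    rw [norm_sq_halfReflectInv_sub σ hq, mul_pow, Real.sq_sqrt]
    · set i := inner ℝ q (σ : Vel d)
      have : (‖q‖ ^ 2 / i) ^ 2 - ‖q‖ ^ 2 - ‖q‖ ^ 2 * (1 - (i / ‖q‖) ^ 2) =
          (‖q‖ ^ 2 - i ^ 2) ^ 2 / i ^ 2 := by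
        field_simp
      have h2 : 0 ≤ (‖q‖ ^ 2 - i ^ 2) ^ 2 / i ^ 2 := by positivity
      linarith
    · rw [sub_nonneg, div_pow, div_le_one (by positivity)]
      gcongr
  have h2 : ‖halfReflectInv σ q - q‖ ≤ ‖v - halfReflectInv σ q‖ + ‖v - q‖ := by
    have : halfReflectInv σ q - q = (v - q) - (v - halfReflectInv σ q) := by abel
    rw [this, add_comm]
    exact norm_sub_le _ _
  linarith

/-- A folded kernel whose singularity at `θ = 0` is of order at most `α`. -/
structure IsFolded (α : ℝ) (A : ℝ≥0∞) (H : ℝ → ℝ≥0∞) : Prop where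
  measurable : Measurable H
  zero : ∀ z < 0, H z = 0
  bound : ∀ s, 0 < s → s < 1 → 1 ≤ 2 * s ^ 2 → H (2 * s ^ 2 - 1) ≤ A * angularWeight α s

/-- Here `s = (q·σ)/|q|` is `cos(θ/2)`, hence `cos θ = 2s² - 1`; the singularity of the kernel
becomes a singularity in the angle between `q` and `σ`. -/
theorem IsFolded.kernel_le {d : ℕ} {α β a : ℝ} {A : ℝ≥0∞} {H : ℝ → ℝ≥0∞} (hH : IsFolded α A H)
    (hβ : 0 < β) (ha : 0 ≤ a) (v : Vel d) {q : Vel d} {σ : Sph d}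
    (hq : 0 < inner ℝ q (σ : Vel d)) (hq2 : ‖q‖ ^ 2 ≤ 2 * inner ℝ q (σ : Vel d) ^ 2)
    (hq1 : inner ℝ q (σ : Vel d) < ‖q‖) :
    ENNReal.ofReal (Real.exp (-a * ‖v - halfReflectInv σ q‖ ^ 2)) *
        angularKernel β H (halfReflectInv σ q) σ ≤
      A * ENNReal.ofReal (2 ^ β) * ENNReal.ofReal (‖q‖ ^ β) *
        (angularWeight α (inner ℝ q (σ : Vel d) / ‖q‖) *
          ENNReal.ofReal (Real.exp (-a * (max 0
            (‖q‖ * √(1 - (inner ℝ q (σ : Vel d) / ‖q‖) ^ 2) - ‖v - q‖)) ^ 2))) := by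
  have hq0 : 0 < ‖q‖ := hq.trans hq1
  set i := inner ℝ q (σ : Vel d) with hi
  have hn := norm_halfReflectInv σ hq
  have hin := inner_halfReflectInv σ q
  have hs := sqrt_mul_le_norm_sub σ v hq
  rw [← hi] at hn hin hs
  have hz : inner ℝ (halfReflectInv σ q) (σ : Vel d) / ‖halfReflectInv σ q‖ =
      2 * (i / ‖q‖) ^ 2 - 1 := by
    rw [hn, hin]; field_simp
  have hb := hH.bound (i / ‖q‖) (by positivity) ((div_lt_one hq0).2 hq1) (by
    rw [div_pow, ← mul_div_assoc, one_le_div (by positivity)]; exact hq2)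
  have hpow : ENNReal.ofReal (‖halfReflectInv σ q‖ ^ β) ≤
      ENNReal.ofReal (2 ^ β) * ENNReal.ofReal (‖q‖ ^ β) := by
    rw [← ENNReal.ofReal_mul (by positivity), ← Real.mul_rpow (by norm_num) hq0.le]
    refine ENNReal.ofReal_le_ofReal (Real.rpow_le_rpow (norm_nonneg _) ?_ hβ.le)
    -- The cone condition `|q|² ≤ 2i²` gives `|u| = |q|²/i ≤ 2i ≤ 2|q|`, the source of the factor
    -- `2^β`.
    rw [hn, div_le_iff₀ hq]
    nlinarith
  have hexp : Real.exp (-a * ‖v - halfReflectInv σ q‖ ^ 2) ≤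
      Real.exp (-a * (max 0 (‖q‖ * √(1 - (i / ‖q‖) ^ 2) - ‖v - q‖)) ^ 2) := by
    simp only [neg_mul]
    gcongr
    exact max_le (norm_nonneg _) hs
  rw [angularKernel, hz]
  calc _ ≤ ENNReal.ofReal (Real.exp (-a * (max 0 (‖q‖ * √(1 - (i / ‖q‖) ^ 2) - ‖v - q‖)) ^ 2)) *
        (ENNReal.ofReal (2 ^ β) * ENNReal.ofReal (‖q‖ ^ β) * (A * angularWeight α (i / ‖q‖))) := by
        gcongr
    _ = _ := by ring

/-- Carleman-type bound: the gain term with a Gaussian factor at `v_*`, written as an integral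
over `w = v'_*`. -/
theorem IsFolded.lintegral_le {d : ℕ} (hd : 2 ≤ d) {α β a : ℝ} {A : ℝ≥0∞} {H : ℝ → ℝ≥0∞}
    (hH : IsFolded α A H) (hβ : 0 < β) (ha : 0 ≤ a) {G : Vel d → ℝ≥0∞} (hG : Measurable G)
    (v : Vel d) (e : Sph d) :
    ∫⁻ vs, ∫⁻ σ : Sph d, G (postStar v vs σ) * ENNReal.ofReal (Real.exp (-a * ‖vs‖ ^ 2)) *
        angularKernel β H (v - vs) σ ∂(surf d) ≤
      2 ^ d * (A * ENNReal.ofReal (2 ^ β)) * ∫⁻ w, G w * (ENNReal.ofReal (‖v - w‖ ^ β) *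
        angularDecay α a ‖w‖ e ‖v - w‖) := by
  have : Nontrivial (Vel d) := by
    obtain ⟨n, rfl⟩ : ∃ n, d = n + 1 := ⟨d - 1, by omega⟩
    infer_instance
  have hHm := hH.measurable
  -- The cone where `q` and `σ` make an angle at most `π/4`; it contains the image of `cos θ ≥ 0`,
  -- because this angle is `θ/2`.
  let S : Set (Vel d × Sph d) :=
    {p | 0 < inner ℝ p.1 (p.2 : Vel d) ∧ ‖p.1‖ ^ 2 ≤ 2 * inner ℝ p.1 (p.2 : Vel d) ^ 2}
  have hS : MeasurableSet S :=
    (measurableSet_lt (g := fun p : Vel d × Sph d => inner ℝ p.1 (p.2 : Vel d)) measurable_const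
      (by fun_prop)).inter
      (measurableSet_le (f := fun p : Vel d × Sph d => ‖p.1‖ ^ 2)
        (g := fun p : Vel d × Sph d => 2 * inner ℝ p.1 (p.2 : Vel d) ^ 2)
        (by fun_prop) (by fun_prop))
  let Θ : Vel d × Sph d → ℝ≥0∞ := S.indicator fun p =>
    ENNReal.ofReal (Real.exp (-a * ‖v - halfReflectInv p.2 p.1‖ ^ 2)) *
        angularKernel β H (halfReflectInv p.2 p.1) p.2
  have hinv : Measurable fun p : Vel d × Sph d => halfReflectInv p.2 p.1 := by
    unfold halfReflectInv
    fun_prop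
  have hΘ : Measurable Θ := Measurable.indicator (by fun_prop) hS
  calc ∫⁻ vs, ∫⁻ σ : Sph d, G (postStar v vs σ) * ENNReal.ofReal (Real.exp (-a * ‖vs‖ ^ 2)) *
        angularKernel β H (v - vs) σ ∂(surf d)
      = ∫⁻ u, ∫⁻ σ : Sph d, G (v - halfReflect σ u) *
          ENNReal.ofReal (Real.exp (-a * ‖v - u‖ ^ 2)) * angularKernel β H u σ ∂(surf d) := by
        rw [← lintegral_sub_left_eq_self _ v]
        simp only [postStar_sub, sub_sub_cancel]
    _ = ∫⁻ σ : Sph d, ∫⁻ u, G (v - halfReflect σ u) *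
          ENNReal.ofReal (Real.exp (-a * ‖v - u‖ ^ 2)) * angularKernel β H u σ ∂volume ∂(surf d) := by
        rw [lintegral_lintegral_swap]
        refine Measurable.aemeasurable ?_
        have : Measurable fun p : Vel d × Sph d => halfReflect p.2 p.1 := by
          unfold halfReflect
          fun_prop
        simp only [Function.uncurry_def]
        fun_prop
    _ ≤ ∫⁻ σ : Sph d, 2 ^ d * ∫⁻ q, G (v - q) * Θ (q, σ) ∂volume ∂(surf d) := by
        refine lintegral_mono fun σ => ?_
        refine le_trans (le_of_eq ?_) (lintegral_comp_halfReflect_le σ fun q => G (v - q) * Θ (q, σ))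
        have hs : MeasurableSet {u : Vel d | u ≠ 0 ∧ 0 ≤ inner ℝ u (σ : Vel d)} :=
          (measurableSet_singleton (0 : Vel d)).compl.inter
            (measurableSet_le (g := fun u : Vel d => inner ℝ u (σ : Vel d)) measurable_const
              (by fun_prop))
        rw [← lintegral_indicator hs]
        refine lintegral_congr fun u => ?_
        by_cases hu : u ∈ {u : Vel d | u ≠ 0 ∧ 0 ≤ inner ℝ u (σ : Vel d)}
        · rw [indicator_of_mem hu]
          have hp := norm_pos_iff.2 hu.1
          have hpos : 0 < inner ℝ (halfReflect σ u) (σ : Vel d) := by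
            rw [inner_halfReflect]
            linarith [hu.2]
          have hmem : (halfReflect σ u, σ) ∈ S := by
            refine ⟨hpos, ?_⟩
            have h1 : ‖u‖ ≤ 2 * inner ℝ (halfReflect σ u) (σ : Vel d) := by
              rw [inner_halfReflect]
              linarith [hu.2]
            rw [norm_sq_halfReflect]
            simp only
            nlinarith
          simp only [Θ]
          rw [indicator_of_mem hmem]
          simp only [halfReflectInv_halfReflect σ hu.1 hu.2, mul_assoc]
        · rw [indicator_of_notMem hu]
          have : angularKernel β H u σ = 0 := by
            rw [angularKernel]
            by_cases h0 : u = 0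
            · simp [h0, hβ.ne']
            · rw [hH.zero, mul_zero]
              refine div_neg_of_neg_of_pos ?_ (norm_pos_iff.2 h0)
              by_contra hc
              exact hu ⟨h0, not_lt.1 hc⟩
          rw [this, mul_zero]
    _ = 2 ^ d * ∫⁻ q, G (v - q) * ∫⁻ σ : Sph d, Θ (q, σ) ∂(surf d) := by
        rw [lintegral_const_mul' _ _ (by simp), lintegral_lintegral_swap]
        · congr 1
          refine lintegral_congr fun q => ?_
          exact lintegral_const_mul _ (hΘ.comp measurable_prodMk_left)
        · refine Measurable.aemeasurable ?_
          have : Measurable fun p : Sph d × Vel d => Θ (p.2, p.1) := hΘ.comp measurable_swap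
          simp only [Function.uncurry_def]
          fun_prop
    _ ≤ 2 ^ d * ∫⁻ q, A * ENNReal.ofReal (2 ^ β) * (G (v - q) * (ENNReal.ofReal (‖q‖ ^ β) *
        angularDecay α a ‖v - q‖ e ‖q‖)) := by
        refine mul_le_mul_right (lintegral_mono fun q => ?_) _
        have hmain : ∫⁻ σ : Sph d, Θ (q, σ) ∂(surf d) ≤ A * ENNReal.ofReal (2 ^ β) *
            ENNReal.ofReal (‖q‖ ^ β) * angularDecay α a ‖v - q‖ e ‖q‖ := by
          by_cases hq : q = 0
          · have : ∀ σ, Θ (q, σ) = 0 := fun σ => by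
              simp only [Θ]
              rw [indicator_of_notMem]
              simp [S, hq]
            simp [this]
          have hqp := norm_pos_iff.2 hq
          -- The bound first appears with the direction of `q`; rotation invariance replaces it by
          -- the fixed direction `e`.
          let e' : Sph d := ⟨‖q‖⁻¹ • q, by simp [norm_smul, hq]⟩
          have hin : ∀ σ : Sph d, inner ℝ (e' : Vel d) (σ : Vel d) = inner ℝ q (σ : Vel d) / ‖q‖ :=
            fun σ => by simp [e', real_inner_smul_left, inv_mul_eq_div]
          rw [angularDecay_eq α a _ e e', angularDecay, ← lintegral_const_mul]
          · refine lintegral_mono_ae ?_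
            filter_upwards [ae_inner_sq_lt_one hd e'] with σ hσ
            by_cases hmem : (q, σ) ∈ S
            · simp only [Θ]
              rw [indicator_of_mem hmem]
              rw [hin] at hσ ⊢
              refine hH.kernel_le hβ ha v hmem.1 hmem.2 ?_
              have := (abs_lt.1 ((sq_lt_one_iff_abs_lt_one _).1 hσ)).2
              rwa [div_lt_one hqp] at this
            · simp only [Θ]
              rw [indicator_of_notMem hmem]
              exact zero_le
          · exact ((measurable_angularWeight α).comp (by fun_prop)).mul (by fun_prop)
        calc _ ≤ G (v - q) * (A * ENNReal.ofReal (2 ^ β) *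
            ENNReal.ofReal (‖q‖ ^ β) * angularDecay α a ‖v - q‖ e ‖q‖) := by gcongr
          _ = _ := by ring
    _ = 2 ^ d * (A * ENNReal.ofReal (2 ^ β)) * ∫⁻ w, G w * (ENNReal.ofReal (‖v - w‖ ^ β) *
        angularDecay α a ‖w‖ e ‖v - w‖) := by
        rw [lintegral_const_mul, ← mul_assoc]
        · congr 1
          rw [← lintegral_sub_left_eq_self (fun w => G w * (ENNReal.ofReal (‖v - w‖ ^ β) *
            angularDecay α a ‖w‖ e ‖v - w‖)) v]
          simp only [sub_sub_cancel]
        · refine Measurable.mul (by fun_prop) (Measurable.mul (by fun_prop) ?_)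
          unfold angularDecay
          refine Measurable.lintegral_prod_right' (f := fun p : Vel d × Sph d =>
            angularWeight α (inner ℝ (e : Vel d) (p.2 : Vel d)) * ENNReal.ofReal (Real.exp (-a *
              (max 0 (‖p.1‖ * √(1 - (inner ℝ (e : Vel d) (p.2 : Vel d)) ^ 2) - ‖v - p.1‖)) ^ 2))) ?_
          exact ((measurable_angularWeight α).comp (by fun_prop)).mul (by fun_prop)

/-- For `α ≥ 0` the bound is monotone in `sin θ = √(1 - z²)`. For `α < 0` it gives boundedness of
`h`, as `sin θ ≤ 1`; hence the exponent `max α 0`. -/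
theorem IsCutoff.ofReal_le {d : ℕ} {α C : ℝ} {h : ℝ → ℝ} (hh : IsCutoff d α C h) {z s : ℝ}
    (hz : z ∈ Ioo (-1 : ℝ) 1) (hs : s ^ 2 < 1) (hzs : 1 - s ^ 2 ≤ 1 - z ^ 2) :
    ENNReal.ofReal (h z) ≤ ENNReal.ofReal (max C 0) * angularWeight (max α 0) s := by
  have hs0 : 0 < 1 - s ^ 2 := by linarith
  have hθ : Real.arccos z ∈ Ioo 0 Real.pi :=
    ⟨Real.arccos_pos.2 hz.2, lt_of_le_of_ne (Real.arccos_le_pi z) fun hc => by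
      have := Real.arccos_eq_pi.1 hc; linarith [hz.1]⟩
  have hb := hh.bound _ hθ
  rw [Real.cos_arccos hz.1.le hz.2.le, Real.sin_arccos] at hb
  set S := √(1 - z ^ 2) with hS
  have hS0 : 0 < S := Real.sqrt_pos.2 (by linarith)
  have hS1 : S ≤ 1 := Real.sqrt_le_one.2 (by nlinarith [sq_nonneg z])
  have h1 : h z ≤ max C 0 * S ^ (-α) := by
    rw [Real.rpow_neg hS0.le, ← div_eq_mul_inv, le_div_iff₀ (by positivity)]
    exact hb.trans (le_max_left _ _)
  have h2 : S ^ (-α) ≤ (1 - s ^ 2) ^ (-(max α 0 / 2)) := by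
    rcases le_total 0 α with hα | hα
    · rw [max_eq_left hα]
      have : (1 - s ^ 2) ^ (-(α / 2)) = √(1 - s ^ 2) ^ (-α) := by
        rw [Real.sqrt_eq_rpow, ← Real.rpow_mul hs0.le]
        congr 1
        ring
      rw [this]
      exact Real.rpow_le_rpow_of_nonpos (Real.sqrt_pos.2 hs0) (Real.sqrt_le_sqrt hzs)
        (by linarith)
    · rw [max_eq_right hα]
      simpa using Real.rpow_le_one hS0.le hS1 (by linarith : 0 ≤ -α)
  rw [angularWeight, ENNReal.ofReal_rpow_of_pos hs0, ← ENNReal.ofReal_mul (le_max_right _ _)]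
  refine ENNReal.ofReal_le_ofReal (h1.trans ?_)
  gcongr

/-- With `s = cos(θ/2)` and `2s² ≥ 1`, `sin² θ = 4s²(1 - s²) ≥ 1 - s²`. The two folded pieces obey
the same bound, whence the factor `2`. -/
theorem IsCutoff.isFolded {d : ℕ} {α C : ℝ} {h : ℝ → ℝ} (hh : IsCutoff d α C h) :
    IsFolded (max α 0) (2 * ENNReal.ofReal (max C 0)) (foldedAngular h) where
  measurable := measurable_foldedAngular hh.measurable
  zero z hz := by
    simp [foldedAngular, hz, hz.le]
  bound s hs0 hs1 hs2 := by
    have hsq : s ^ 2 < 1 := by nlinarith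
    have hz1 : 2 * s ^ 2 - 1 ∈ Ioo (-1 : ℝ) 1 := ⟨by nlinarith, by linarith⟩
    have hz2 : -(2 * s ^ 2 - 1) ∈ Ioo (-1 : ℝ) 1 := ⟨by linarith, by nlinarith⟩
    have hzs : 1 - s ^ 2 ≤ 1 - (2 * s ^ 2 - 1) ^ 2 := by
      nlinarith
    have b1 := hh.ofReal_le hz1 hsq hzs
    have b2 := hh.ofReal_le hz2 hsq (by rw [neg_sq]; exact hzs)
    rw [mul_assoc, two_mul (ENNReal.ofReal (max C 0) * angularWeight (max α 0) s), foldedAngular]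
    exact add_le_add ((indicator_le_self _ (fun z => ENNReal.ofReal (h z)) _).trans b1)
      ((indicator_le_self _ (fun z => ENNReal.ofReal (h (-z))) _).trans b2)

/-! ### Moments and estimates at large velocity -/

theorem norm_sub_rpow_le {E : Type*} [NormedAddCommGroup E] {β : ℝ} (hβ0 : 0 < β) (hβ1 : β ≤ 1)
    {v : E} (hv : 1 ≤ ‖v‖) (w : E) : ‖v - w‖ ^ β ≤ ‖v‖ ^ β * (1 + ‖w‖) := by
  have h1 : ‖v - w‖ ≤ ‖v‖ * (1 + ‖w‖) := by
    have := norm_sub_le v w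
    nlinarith [norm_nonneg w]
  calc ‖v - w‖ ^ β ≤ (‖v‖ * (1 + ‖w‖)) ^ β := Real.rpow_le_rpow (norm_nonneg _) h1 hβ0.le
    _ = ‖v‖ ^ β * (1 + ‖w‖) ^ β := Real.mul_rpow (norm_nonneg _) (by positivity)
    _ ≤ ‖v‖ ^ β * (1 + ‖w‖) := by
      gcongr
      exact Real.rpow_le_self_of_one_le (by linarith [norm_nonneg w]) hβ1

theorem one_add_mul_exp_le {a : ℝ} (ha : 0 < a) (c r : ℝ) :
    (1 + r) * Real.exp (c - a * r ^ 2) ≤ Real.exp (c + 1 / (4 * a)) := by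
  have h1 : 1 + r ≤ Real.exp r := by linarith [Real.add_one_le_exp r]
  calc (1 + r) * Real.exp (c - a * r ^ 2) ≤ Real.exp r * Real.exp (c - a * r ^ 2) := by gcongr
    _ = Real.exp (r + (c - a * r ^ 2)) := (Real.exp_add _ _).symm
    _ ≤ Real.exp (c + 1 / (4 * a)) := by
      refine Real.exp_le_exp.2 ?_
      have : c + 1 / (4 * a) - (r + (c - a * r ^ 2)) = (2 * a * r - 1) ^ 2 / (4 * a) := by
        field_simp
        ring
      have h2 : 0 ≤ (2 * a * r - 1) ^ 2 / (4 * a) := by positivity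
      linarith

theorem tendsto_one_add_mul_exp {a : ℝ} (ha : 0 < a) (c : ℝ) :
    Tendsto (fun r : ℝ => (1 + r) * Real.exp (c - a * r ^ 2)) atTop (𝓝 0) := by
  have h1 : Tendsto (fun r : ℝ => Real.exp (c + 1 / (4 * (a / 2)) - a / 2 * r ^ 2)) atTop (𝓝 0) := by
    refine Real.tendsto_exp_atBot.comp ?_
    simp only [sub_eq_add_neg]
    refine tendsto_atBot_add_const_left _ _ ?_
    exact tendsto_neg_atTop_atBot.comp ((tendsto_pow_atTop two_ne_zero).const_mul_atTop (by positivity))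
  refine squeeze_zero' ?_ ?_ h1
  · filter_upwards [eventually_ge_atTop 0] with r hr
    positivity
  · refine Eventually.of_forall fun r => ?_
    -- Half of the Gaussian absorbs `1 + r`; the other half supplies the decay.
    have h2 := one_add_mul_exp_le (half_pos ha) c r
    calc (1 + r) * Real.exp (c - a * r ^ 2)
        = (1 + r) * Real.exp (c - a / 2 * r ^ 2) * Real.exp (-(a / 2 * r ^ 2)) := by
          rw [mul_assoc, ← Real.exp_add]; congr 2; ring
      _ ≤ Real.exp (c + 1 / (4 * (a / 2))) * Real.exp (-(a / 2 * r ^ 2)) := by gcongr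
      _ = _ := by rw [← Real.exp_add]; congr 1

/-- Uniform smallness of the weighted Carleman kernel relative to `|v|^β`. -/
theorem exists_radius_kernel_le {d : ℕ} (hd : 2 ≤ d) {α β a δ : ℝ} (hα0 : 0 ≤ α)
    (hα : α < (d : ℝ) - 1) (hβ0 : 0 < β) (hβ1 : β ≤ 1) (ha : 0 < a) (hδ : 0 < δ) (c : ℝ)
    (e : Sph d) {ε : ℝ≥0∞} (hε : 0 < ε) :
    ∃ R : ℝ, ∀ v w : Vel d, R ≤ ‖v‖ →
      ENNReal.ofReal (Real.exp (c - δ * ‖w‖ ^ 2)) * (ENNReal.ofReal (‖v - w‖ ^ β) *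
        angularDecay α a ‖w‖ e ‖v - w‖) ≤ ε * ENNReal.ofReal (‖v‖ ^ β) := by
  set Ψ := ∫⁻ σ : Sph d, angularWeight α (inner ℝ (e : Vel d) (σ : Vel d)) ∂(surf d)
  have hΨ : Ψ < ⊤ := lintegral_angularWeight_lt_top hd hα0 hα e
  have t1 : Tendsto (fun r : ℝ => ENNReal.ofReal ((1 + r) * Real.exp (c - δ * r ^ 2)) * Ψ) atTop
      (𝓝 0) := by
    have := ENNReal.Tendsto.mul_const (ENNReal.tendsto_ofReal (tendsto_one_add_mul_exp hδ c))
      (Or.inr hΨ.ne : _ ∨ Ψ ≠ ⊤)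
    simpa using this
  obtain ⟨W, hW0, hW⟩ := ((eventually_ge_atTop (0 : ℝ)).and
    (eventually_forall_ge_atTop.2 (t1.eventually (eventually_lt_nhds hε)))).exists
  have t2 : Tendsto (fun L : ℝ => ENNReal.ofReal ((1 + W) * Real.exp c) * angularDecay α a W e L)
      atTop (𝓝 0) := by
    have := ENNReal.Tendsto.const_mul (tendsto_angularDecay hd hα0 hα ha W e)
      (Or.inr ENNReal.ofReal_ne_top : _ ∨ ENNReal.ofReal ((1 + W) * Real.exp c) ≠ ⊤)
    simpa using this
  obtain ⟨L, hL⟩ := (t2.eventually (eventually_lt_nhds hε)).exists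
  -- The bound `|v| ≥ 1` allows `|v-w|^β ≤ |v|^β (1 + |w|)`; the bound `|v| ≥ L + W` gives `|v-w| ≥
  -- L` when `|w| ≤ W`.
  refine ⟨max 1 (L + W), fun v w hv => ?_⟩
  have hv1 : 1 ≤ ‖v‖ := (le_max_left _ _).trans hv
  have hvL : L + W ≤ ‖v‖ := (le_max_right _ _).trans hv
  have hpow := norm_sub_rpow_le hβ0 hβ1 hv1 w
  rcases le_total W ‖w‖ with hw | hw
  -- Large `w`: the Gaussian in `w` is small and the angular integral is merely bounded.
  · have h1 := (hW ‖w‖ hw).le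
    calc _ ≤ ENNReal.ofReal (Real.exp (c - δ * ‖w‖ ^ 2)) *
          (ENNReal.ofReal (‖v‖ ^ β * (1 + ‖w‖)) * Ψ) := by
          gcongr
          exact angularDecay_le ha.le e _
      _ = ENNReal.ofReal ((1 + ‖w‖) * Real.exp (c - δ * ‖w‖ ^ 2)) * Ψ *
          ENNReal.ofReal (‖v‖ ^ β) := by
          rw [ENNReal.ofReal_mul (by positivity), ENNReal.ofReal_mul (by positivity)]
          ring
      _ ≤ _ := by gcongr
  -- Bounded `w`: the smallness comes from the angular integral.
  · have h2 : L ≤ ‖v - w‖ := by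
      have := norm_sub_norm_le v w
      linarith
    calc _ ≤ ENNReal.ofReal (Real.exp c) *
          (ENNReal.ofReal (‖v‖ ^ β * (1 + W)) * angularDecay α a W e L) := by
          gcongr
          · nlinarith [sq_nonneg ‖w‖]
          · exact hpow.trans (by gcongr)
          · exact angularDecay_anti ha.le e h2 hw
      _ = ENNReal.ofReal ((1 + W) * Real.exp c) * angularDecay α a W e L *
          ENNReal.ofReal (‖v‖ ^ β) := by
          rw [ENNReal.ofReal_mul (by positivity), ENNReal.ofReal_mul (by positivity)]
          ring
      _ ≤ _ := by gcongr

/-- `P` has total mass at least `ρ` and exponential moment `∫ P / M₁` at most `C`. -/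
structure HasMoments {d : ℕ} (ρ a c C : ℝ) (P : Vel d → ℝ≥0∞) : Prop where
  measurable : Measurable P
  mass : ENNReal.ofReal ρ ≤ ∫⁻ v, P v
  moment : ∫⁻ v, P v * ENNReal.ofReal (Real.exp (a * ‖v‖ ^ 2 - c)) ≤ ENNReal.ofReal C

/-- Inserting `1 = exp(a|w|² - c) exp(c - a|w|²)` reduces integrals against `P` to a pointwise bound
on the kernel. Tail mass, collision rates and the Carleman integral are all estimated in this way.
-/
theorem HasMoments.lintegral_mul_le {d : ℕ} {ρ a c C : ℝ} {P : Vel d → ℝ≥0∞}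
    (hP : HasMoments ρ a c C P) {K : Vel d → ℝ≥0∞} {κ : ℝ≥0∞} {s : Set (Vel d)}
    (hs : MeasurableSet s)
    (hK : ∀ w ∈ s, ENNReal.ofReal (Real.exp (c - a * ‖w‖ ^ 2)) * K w ≤ κ) :
    ∫⁻ w in s, P w * K w ≤ κ * ENNReal.ofReal C := by
  have hm := hP.measurable
  calc ∫⁻ w in s, P w * K w
      = ∫⁻ w in s, P w * ENNReal.ofReal (Real.exp (a * ‖w‖ ^ 2 - c)) *
          (ENNReal.ofReal (Real.exp (c - a * ‖w‖ ^ 2)) * K w) := by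
        refine lintegral_congr fun w => ?_
        have : ENNReal.ofReal (Real.exp (a * ‖w‖ ^ 2 - c)) *
            ENNReal.ofReal (Real.exp (c - a * ‖w‖ ^ 2)) = 1 := by
          rw [← ENNReal.ofReal_mul (by positivity), ← Real.exp_add]
          simp
        calc P w * K w = P w * (ENNReal.ofReal (Real.exp (a * ‖w‖ ^ 2 - c)) *
            ENNReal.ofReal (Real.exp (c - a * ‖w‖ ^ 2))) * K w := by rw [this, mul_one]
          _ = _ := by ring
    _ ≤ ∫⁻ w in s, κ * (P w * ENNReal.ofReal (Real.exp (a * ‖w‖ ^ 2 - c))) := by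
        refine setLIntegral_mono' hs fun w hw => ?_
        rw [mul_comm κ]
        gcongr
        exact hK w hw
    _ = κ * ∫⁻ w in s, P w * ENNReal.ofReal (Real.exp (a * ‖w‖ ^ 2 - c)) :=
        lintegral_const_mul _ (by fun_prop)
    _ ≤ κ * ENNReal.ofReal C := by
        gcongr
        exact (setLIntegral_le_lintegral _ _).trans hP.moment

/-- The exponential moment leaves at most half of the mass `ρ` outside a ball of radius `W`. For
`|v| ≥ 2W` every point of that ball lies at distance at least `|v|/2` from `v`. -/
theorem exists_radius_frequency_ge {d : ℕ} {β ρ a : ℝ} (hβ : 0 < β) (hρ : 0 < ρ) (ha : 0 < a)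
    (c C : ℝ) :
    ∃ R : ℝ, ∀ P : Vel d → ℝ≥0∞, HasMoments ρ a c C P → ∀ v, R ≤ ‖v‖ →
      ENNReal.ofReal (ρ / 2 * 2⁻¹ ^ β) * ENNReal.ofReal (‖v‖ ^ β) ≤ frequency β P v := by
  have t1 : Tendsto (fun r : ℝ => ENNReal.ofReal ((1 + r) * Real.exp (c - a * r ^ 2)) *
      ENNReal.ofReal C) atTop (𝓝 0) := by
    have := ENNReal.Tendsto.mul_const (ENNReal.tendsto_ofReal (tendsto_one_add_mul_exp ha c))
      (Or.inr ENNReal.ofReal_ne_top : _ ∨ ENNReal.ofReal C ≠ ⊤)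
    simpa using this
  have hρ2 : (0 : ℝ≥0∞) < ENNReal.ofReal (ρ / 2) := ENNReal.ofReal_pos.2 (by positivity)
  obtain ⟨W, hW0, hW⟩ := ((eventually_ge_atTop (0 : ℝ)).and
    (t1.eventually (eventually_lt_nhds hρ2))).exists
  refine ⟨2 * W, fun P hP v hv => ?_⟩
  have hm := hP.measurable
  set s : Set (Vel d) := {w | ‖w‖ ≤ W}
  have hs : MeasurableSet s := measurableSet_le measurable_norm measurable_const
  have htail : ∫⁻ w in sᶜ, P w ≤ ENNReal.ofReal (ρ / 2) := by
    have := hP.lintegral_mul_le (K := fun _ => 1) hs.compl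
      (κ := ENNReal.ofReal ((1 + W) * Real.exp (c - a * W ^ 2))) (fun w hw => by
        rw [mul_one]
        refine ENNReal.ofReal_le_ofReal ?_
        have hw' : W < ‖w‖ := not_le.1 hw
        calc Real.exp (c - a * ‖w‖ ^ 2) ≤ 1 * Real.exp (c - a * W ^ 2) := by
              rw [one_mul]; gcongr
          _ ≤ _ := by gcongr; linarith)
    simp only [mul_one] at this
    exact this.trans hW.le
  have hmass : ENNReal.ofReal (ρ / 2) ≤ ∫⁻ w in s, P w := by
    have h1 := hP.mass
    rw [← lintegral_add_compl _ hs] at h1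
    have h2 : ENNReal.ofReal ρ = ENNReal.ofReal (ρ / 2) + ENNReal.ofReal (ρ / 2) := by
      rw [← ENNReal.ofReal_add (by positivity) (by positivity)]; congr 1; ring
    rw [h2] at h1
    exact (ENNReal.add_le_add_iff_right ENNReal.ofReal_ne_top).1 (h1.trans (by gcongr))
  calc ENNReal.ofReal (ρ / 2 * 2⁻¹ ^ β) * ENNReal.ofReal (‖v‖ ^ β)
      = ENNReal.ofReal (ρ / 2) * ENNReal.ofReal ((2⁻¹ * ‖v‖) ^ β) := by
        rw [Real.mul_rpow (by norm_num) (norm_nonneg _), ENNReal.ofReal_mul (by positivity),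
          ENNReal.ofReal_mul (by positivity), mul_assoc]
    _ ≤ (∫⁻ w in s, P w) * ENNReal.ofReal ((2⁻¹ * ‖v‖) ^ β) := by gcongr
    _ = ∫⁻ w in s, P w * ENNReal.ofReal ((2⁻¹ * ‖v‖) ^ β) := (lintegral_mul_const _ hm).symm
    _ ≤ ∫⁻ w in s, P w * ENNReal.ofReal (‖v - w‖ ^ β) := by
        refine setLIntegral_mono' hs fun w hw => ?_
        gcongr
        have h1 := norm_sub_norm_le v w
        have h2 : ‖w‖ ≤ W := hw
        linarith
    _ ≤ frequency β P v := setLIntegral_le_lintegral _ _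

theorem norm_sq_post_add {d : ℕ} (v vs : Vel d) (σ : Sph d) :
    ‖post v vs σ‖ ^ 2 + ‖postStar v vs σ‖ ^ 2 = ‖v‖ ^ 2 + ‖vs‖ ^ 2 := by
  have h1 : ‖post v vs σ‖ ^ 2 + ‖postStar v vs σ‖ ^ 2 =
      2 * (‖(1 / 2 : ℝ) • (v + vs)‖ ^ 2 + ‖(‖v - vs‖ / 2) • (σ : Vel d)‖ ^ 2) := by
    rw [post, postStar, norm_add_sq_real, norm_sub_sq_real]
    ring
  rw [h1, norm_smul, norm_smul, norm_eq_of_mem_sphere, mul_pow, mul_pow, norm_add_sq_real]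
  have h2 := norm_sub_sq_real v vs
  simp only [Real.norm_eq_abs, sq_abs, one_pow, mul_one, div_pow, h2]
  ring

/-- For large velocities, the gain term applied to a Maxwellian is dominated by the loss term. -/
theorem exists_radius_gain_le {d : ℕ} (hd : 2 ≤ d) {α β Ch a a₁ ρ : ℝ} (hα : α < (d : ℝ) - 1)
    (hβ0 : 0 < β) (hβ1 : β ≤ 1) (ha : 0 < a) (haa₁ : a < a₁) (hρ : 0 < ρ) (c₁ C₁ : ℝ) :
    ∃ R : ℝ, ∀ h : ℝ → ℝ, IsCutoff d α Ch h → ∀ P : Vel d → ℝ≥0∞, HasMoments ρ a₁ c₁ C₁ P →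
      ∀ c : ℝ, ∀ v, R ≤ ‖v‖ →
      bilinearGain β (foldedAngular h) P (fun w => ENNReal.ofReal (maxwellian a c w)) v ≤
        ENNReal.ofReal (maxwellian a c v) * frequency β P v := by
  obtain ⟨n, rfl⟩ : ∃ n, d = n + 1 := ⟨d - 1, by omega⟩
  let e : Sph (n + 1) := ⟨EuclideanSpace.single 0 1, by simp⟩
  have hα' : max α 0 < ((n + 1 : ℕ) : ℝ) - 1 := by
    refine max_lt hα ?_
    have : (2 : ℝ) ≤ (n + 1 : ℕ) := by exact_mod_cast hd
    linarith
  set κ := ENNReal.ofReal (ρ / 2 * 2⁻¹ ^ β)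
  have hκ : 0 < κ := ENNReal.ofReal_pos.2 (by positivity)
  set A : ℝ≥0∞ := 2 ^ (n + 1) * (2 * ENNReal.ofReal (max Ch 0) * ENNReal.ofReal (2 ^ β))
  have hA : A * ENNReal.ofReal C₁ ≠ ⊤ := by
    refine ENNReal.mul_ne_top (ENNReal.mul_ne_top (by simp) (ENNReal.mul_ne_top
      (ENNReal.mul_ne_top (by simp) ENNReal.ofReal_ne_top) ENNReal.ofReal_ne_top))
      ENNReal.ofReal_ne_top
  obtain ⟨ε, hε, hεκ⟩ : ∃ ε : ℝ≥0∞, 0 < ε ∧ A * ENNReal.ofReal C₁ * ε ≤ κ := by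
    -- If the denominator is `0`, then `ε = ⊤`, which is harmless because the product is `0`.
    refine ⟨κ / (A * ENNReal.ofReal C₁), ENNReal.div_pos hκ.ne' hA, ?_⟩
    exact ENNReal.mul_div_le
  obtain ⟨R₁, hR₁⟩ := exists_radius_kernel_le hd (le_max_right α 0) hα' hβ0 hβ1 ha
    (sub_pos.2 haa₁) c₁ e hε
  obtain ⟨R₂, hR₂⟩ := exists_radius_frequency_ge (d := n + 1) hβ0 hρ (ha.trans haa₁) c₁ C₁
  refine ⟨max R₁ R₂, fun h hh P hP c v hv => ?_⟩
  have hm := hP.measurable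
  have hfold := hh.isFolded
  have hHm := hfold.measurable
  have hG : Measurable fun w : Vel (n + 1) => P w * ENNReal.ofReal (Real.exp (a * ‖w‖ ^ 2)) := by
    fun_prop
  -- Energy conservation. The value `M(v)` factors out and carries all dependence on `c`, so the
  -- radius does not depend on `c`.
  have hM : ∀ vs σ, maxwellian a c (post v vs σ) =
      maxwellian a c v * (Real.exp (a * ‖postStar v vs σ‖ ^ 2) * Real.exp (-a * ‖vs‖ ^ 2)) := by
    intro vs σ
    rw [maxwellian, maxwellian, ← Real.exp_add, ← Real.exp_add]
    congr 1
    have := norm_sq_post_add v vs σ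
    linear_combination (-a) * this
  have hM0 : ∀ w : Vel (n + 1), 0 ≤ maxwellian a c w := fun w => (Real.exp_pos _).le
  calc bilinearGain β (foldedAngular h) P (fun w => ENNReal.ofReal (maxwellian a c w)) v
      = ENNReal.ofReal (maxwellian a c v) * ∫⁻ vs, ∫⁻ σ : Sph (n + 1),
          P (postStar v vs σ) * ENNReal.ofReal (Real.exp (a * ‖postStar v vs σ‖ ^ 2)) *
          ENNReal.ofReal (Real.exp (-a * ‖vs‖ ^ 2)) *
          angularKernel β (foldedAngular h) (v - vs) σ ∂(surf (n + 1)) := by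
        unfold bilinearGain
        rw [← lintegral_const_mul' _ _ ENNReal.ofReal_ne_top]
        refine lintegral_congr fun vs => ?_
        rw [← lintegral_const_mul' _ _ ENNReal.ofReal_ne_top]
        refine lintegral_congr fun σ => ?_
        simp only
        rw [hM, ENNReal.ofReal_mul (hM0 v), ENNReal.ofReal_mul (Real.exp_pos _).le]
        ring
    _ ≤ ENNReal.ofReal (maxwellian a c v) * (A * ∫⁻ w, P w *
          ENNReal.ofReal (Real.exp (a * ‖w‖ ^ 2)) * (ENNReal.ofReal (‖v - w‖ ^ β) *
        angularDecay (max α 0) a ‖w‖ e ‖v - w‖)) :=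
        mul_le_mul_right (hfold.lintegral_le hd hβ0 ha.le hG v e) _
    _ ≤ ENNReal.ofReal (maxwellian a c v) * (A * (ε * ENNReal.ofReal (‖v‖ ^ β) *
          ENNReal.ofReal C₁)) := by
        refine mul_le_mul_right (mul_le_mul_right ?_ _) _
        have := hP.lintegral_mul_le (K := fun w => ENNReal.ofReal (Real.exp (a * ‖w‖ ^ 2)) *
          (ENNReal.ofReal (‖v - w‖ ^ β) * angularDecay (max α 0) a ‖w‖ e ‖v - w‖))
          (κ := ε * ENNReal.ofReal (‖v‖ ^ β)) MeasurableSet.univ (fun w _ => by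
            refine le_trans (le_of_eq ?_) (hR₁ v w ((le_max_left _ _).trans hv))
            rw [← mul_assoc, ← ENNReal.ofReal_mul (Real.exp_pos _).le, ← Real.exp_add]
            congr 3
            ring)
        simpa only [Measure.restrict_univ, mul_assoc] using this
    _ = ENNReal.ofReal (maxwellian a c v) * (A * ENNReal.ofReal C₁ * ε *
          ENNReal.ofReal (‖v‖ ^ β)) := by ring
    _ ≤ ENNReal.ofReal (maxwellian a c v) * (κ * ENNReal.ofReal (‖v‖ ^ β)) := by gcongr
    _ ≤ _ := by
        gcongr
        exact hR₂ P hP v ((le_max_right _ _).trans hv)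

/-! ### Collision rates and the sign of the collision term above the Maxwellian -/

/-- Total collision rate. -/
theorem HasMoments.lintegral_mul_frequency_le {d : ℕ} {β ρ a c C : ℝ} (hβ0 : 0 < β) (hβ1 : β ≤ 1)
    (ha : 0 < a) {P : Vel d → ℝ≥0∞} (hP : HasMoments ρ a c C P) :
    ∫⁻ v, P v * frequency β P v ≤
      (ENNReal.ofReal (Real.exp (c + 1 / (4 * a))) * ENNReal.ofReal C) ^ 2 := by
  have hm := hP.measurable
  set B := ENNReal.ofReal (Real.exp (c + 1 / (4 * a))) * ENNReal.ofReal C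
  have hB : ∫⁻ w, P w * ENNReal.ofReal (1 + ‖w‖) ≤ B := by
    have := hP.lintegral_mul_le (K := fun w => ENNReal.ofReal (1 + ‖w‖))
      (κ := ENNReal.ofReal (Real.exp (c + 1 / (4 * a)))) MeasurableSet.univ (fun w _ => by
        rw [← ENNReal.ofReal_mul (Real.exp_pos _).le, mul_comm]
        exact ENNReal.ofReal_le_ofReal (one_add_mul_exp_le ha c _))
    simpa only [Measure.restrict_univ] using this
  have hfreq : ∀ v, frequency β P v ≤ ENNReal.ofReal (1 + ‖v‖) * B := fun v => by
    calc frequency β P v ≤ ∫⁻ w, ENNReal.ofReal (1 + ‖v‖) * (P w * ENNReal.ofReal (1 + ‖w‖)) := by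
          refine lintegral_mono fun w => ?_
          calc P w * ENNReal.ofReal (‖v - w‖ ^ β)
              ≤ P w * ENNReal.ofReal ((1 + ‖v‖) * (1 + ‖w‖)) := by
                gcongr
                have h1 : ‖v - w‖ ≤ (1 + ‖v‖) * (1 + ‖w‖) := by
                  have := norm_sub_le v w
                  nlinarith [norm_nonneg w, norm_nonneg v, mul_nonneg (norm_nonneg v) (norm_nonneg w)]
                have h3 : (1 : ℝ) ≤ (1 + ‖v‖) * (1 + ‖w‖) := by
                  nlinarith [norm_nonneg w, norm_nonneg v, mul_nonneg (norm_nonneg v) (norm_nonneg w)]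
                calc ‖v - w‖ ^ β ≤ ((1 + ‖v‖) * (1 + ‖w‖)) ^ β :=
                      Real.rpow_le_rpow (norm_nonneg _) h1 hβ0.le
                  _ ≤ _ := Real.rpow_le_self_of_one_le h3 hβ1
            _ = _ := by
              rw [ENNReal.ofReal_mul (by positivity)]
              ring
      _ = ENNReal.ofReal (1 + ‖v‖) * ∫⁻ w, P w * ENNReal.ofReal (1 + ‖w‖) :=
          lintegral_const_mul _ (by fun_prop)
      _ ≤ _ := by gcongr
  calc ∫⁻ v, P v * frequency β P v ≤ ∫⁻ v, B * (P v * ENNReal.ofReal (1 + ‖v‖)) := by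
        refine lintegral_mono fun v => ?_
        calc P v * frequency β P v ≤ P v * (ENNReal.ofReal (1 + ‖v‖) * B) := by
              gcongr; exact hfreq v
          _ = _ := by ring
    _ = B * ∫⁻ v, P v * ENNReal.ofReal (1 + ‖v‖) := lintegral_const_mul _ (by fun_prop)
    _ ≤ B ^ 2 := by rw [sq]; gcongr

/-- The linear part of the comparison: where `F` exceeds the Maxwellian, gains do not exceed
losses. -/
theorem setLIntegral_gain_le_loss {d : ℕ} (hd : 2 ≤ d) {α β Ch a c R : ℝ} (hβ : 0 < β)
    {h : ℝ → ℝ} (hh : IsCutoff d α Ch h) {F : Vel d → ℝ} (hF : Measurable F)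
    (hF0 : ∀ v, 0 ≤ F v)
    (hgain : ∀ v, R ≤ ‖v‖ → bilinearGain β (foldedAngular h) (fun w => ENNReal.ofReal (F w))
      (fun w => ENNReal.ofReal (maxwellian a c w)) v ≤
        ENNReal.ofReal (maxwellian a c v) * frequency β (fun w => ENNReal.ofReal (F w)) v)
    (hsmall : ∀ᵐ v, ‖v‖ < R → F v ≤ maxwellian a c v) :
    ∫⁻ v in {v | maxwellian a c v < F v}, gain β h F v ≤
      ∫⁻ v in {v | maxwellian a c v < F v}, loss β h F v := by
  have : Nontrivial (Vel d) := by
    obtain ⟨n, rfl⟩ : ∃ n, d = n + 1 := ⟨d - 1, by omega⟩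
    infer_instance
  set S := {v : Vel d | maxwellian a c v < F v}
  have hMm : Measurable (maxwellian a c : Vel d → ℝ) := by
    unfold maxwellian
    fun_prop
  have hS : MeasurableSet S := measurableSet_lt hMm hF
  have hHm := hh.isFolded.measurable
  set P : Vel d → ℝ≥0∞ := fun w => ENNReal.ofReal (F w)
  have hPm : Measurable P := by fun_prop
  set Q : Vel d → ℝ≥0∞ := fun w => ENNReal.ofReal (F w - maxwellian a c w)
  have hQm : Measurable Q := by fun_prop
  set M : Vel d → ℝ≥0∞ := fun w => ENNReal.ofReal (maxwellian a c w)
  have hMm' : Measurable M := by fun_prop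
  have hfm : Measurable (frequency β P) := by
    unfold frequency
    refine Measurable.lintegral_prod_right' (f := fun p : Vel d × Vel d =>
      P p.2 * ENNReal.ofReal (‖p.1 - p.2‖ ^ β)) ?_
    fun_prop
  have hbm : ∀ Q' : Vel d → ℝ≥0∞, Measurable Q' →
      Measurable (bilinearGain β (foldedAngular h) P Q') := fun Q' hQ' => by
    unfold bilinearGain
    refine Measurable.lintegral_prod_right' (f := fun p : Vel d × Vel d => ∫⁻ σ : Sph d,
      P (postStar p.1 p.2 σ) * Q' (post p.1 p.2 σ) *
      angularKernel β (foldedAngular h) (p.1 - p.2) σ ∂(surf d)) ?_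
    refine Measurable.lintegral_prod_right' (f := fun p : (Vel d × Vel d) × Sph d =>
      P (postStar p.1.1 p.1.2 p.2) * Q' (post p.1.1 p.1.2 p.2) *
      angularKernel β (foldedAngular h) (p.1.1 - p.1.2) p.2) ?_
    fun_prop
  -- Only the second argument is split, by `F ≤ (F - M)₊ + M`; the first stays whole, so the
  -- estimate is linear in the excess.
  have hsplit : ∀ v, bilinearGain β (foldedAngular h) P P v ≤
      bilinearGain β (foldedAngular h) P Q v + bilinearGain β (foldedAngular h) P M v := fun v => by
    unfold bilinearGain
    rw [← lintegral_add_left]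
    · refine lintegral_mono fun vs => ?_
      rw [← lintegral_add_left (by fun_prop)]
      refine lintegral_mono fun σ => ?_
      rw [← add_mul, ← mul_add]
      gcongr
      rw [← tsub_le_iff_right]
      simp only [P, M, Q]
      rw [ENNReal.ofReal_sub _ (show 0 ≤ maxwellian a c (post v vs σ) from (Real.exp_pos _).le)]
    · refine Measurable.lintegral_prod_right' (f := fun p : Vel d × Sph d =>
        P (postStar v p.1 p.2) * Q (post v p.1 p.2) *
        angularKernel β (foldedAngular h) (v - p.1) p.2) ?_
      fun_prop
  have hQsupp : ∀ v, Q v * frequency β P v = S.indicator (fun v => Q v * frequency β P v) v := by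
    intro v
    by_cases hv : v ∈ S
    · rw [indicator_of_mem hv]
    · rw [indicator_of_notMem hv]
      have : Q v = 0 := ENNReal.ofReal_eq_zero.2 (sub_nonpos.2 (not_lt.1 hv))
      rw [this, zero_mul]
  have hSR : ∀ᵐ v ∂(volume.restrict S), R ≤ ‖v‖ := by
    rw [ae_restrict_iff' hS]
    filter_upwards [hsmall] with v hv hvS
    by_contra hc
    exact absurd (hv (not_le.1 hc)) (not_le.2 hvS)
  calc ∫⁻ v in S, gain β h F v = ∫⁻ v in S, bilinearGain β (foldedAngular h) P P v := by
        refine lintegral_congr fun v => ?_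
        rw [gain_eq hh.measurable hF hF0]
    _ ≤ ∫⁻ v in S, (bilinearGain β (foldedAngular h) P Q v +
          bilinearGain β (foldedAngular h) P M v) := lintegral_mono hsplit
    _ = (∫⁻ v in S, bilinearGain β (foldedAngular h) P Q v) +
          ∫⁻ v in S, bilinearGain β (foldedAngular h) P M v := lintegral_add_left (hbm Q hQm) _
    -- For the excess the domain is enlarged to all velocities, where mass conservation applies. On
    -- `S` almost every velocity has norm at least `R`, so the Maxwellian part is below its loss.
    _ ≤ (∫⁻ v, bilinearGain β (foldedAngular h) P Q v) + ∫⁻ v in S, M v * frequency β P v := by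
        refine add_le_add (setLIntegral_le_lintegral _ _) (lintegral_mono_ae ?_)
        filter_upwards [hSR] with v hv
        exact hgain v hv
    _ = (∫⁻ v in S, Q v * frequency β P v) + ∫⁻ v in S, M v * frequency β P v := by
        rw [lintegral_bilinearGain hβ hHm (hh.lintegral_folded_eq_one hd) hPm hQm]
        congr 1
        rw [← lintegral_indicator hS]
        exact lintegral_congr hQsupp
    _ = ∫⁻ v in S, (Q v * frequency β P v + M v * frequency β P v) :=
        (lintegral_add_left (hQm.mul hfm) _).symm
    _ = ∫⁻ v in S, loss β h F v := by
        refine setLIntegral_congr_fun hS fun v hv => ?_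
        rw [loss_eq hd hβ hh hF hF0, ← add_mul, ← ENNReal.ofReal_add]
        · simp [P]
        · exact sub_nonneg.2 (le_of_lt hv)
        · exact (Real.exp_pos _).le

theorem lintegral_gain_eq_loss {d : ℕ} (hd : 2 ≤ d) {α β Ch : ℝ} (hβ : 0 < β)
    {h : ℝ → ℝ} (hh : IsCutoff d α Ch h) {F : Vel d → ℝ} (hF : Measurable F)
    (hF0 : ∀ v, 0 ≤ F v) :
    (∫⁻ v, gain β h F v =
      ∫⁻ v, ENNReal.ofReal (F v) * frequency β (fun w => ENNReal.ofReal (F w)) v) ∧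
    (∫⁻ v, loss β h F v =
      ∫⁻ v, ENNReal.ofReal (F v) * frequency β (fun w => ENNReal.ofReal (F w)) v) := by
  have : Nontrivial (Vel d) := by
    obtain ⟨n, rfl⟩ : ∃ n, d = n + 1 := ⟨d - 1, by omega⟩
    infer_instance
  refine ⟨?_, lintegral_congr fun v => loss_eq hd hβ hh hF hF0 v⟩
  rw [lintegral_congr fun v => gain_eq hh.measurable hF hF0 v]
  exact lintegral_bilinearGain hβ hh.isFolded.measurable (hh.lintegral_folded_eq_one hd)
    hF.ennreal_ofReal hF.ennreal_ofReal

/-! ### Comparison principle along paths -/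

/-- The tangent inequality of the convex function `e` at the later value `x`. If `x ≤ m` the left
side is nonpositive, whatever `y` is. -/
theorem posPart_sub_le {e e' : ℝ → ℝ} (hmono : Monotone e)
    (hconv : ∀ x y, e x - e y ≤ e' x * (x - y)) (m x y : ℝ) :
    max 0 (e x - e m) - max 0 (e y - e m) ≤ (if m < x then e' x else 0) * (x - y) := by
  by_cases hx : m < x
  · rw [if_pos hx, max_eq_right (sub_nonneg.2 (hmono hx.le))]
    linarith [le_max_right 0 (e y - e m), hconv x y]
  · rw [if_neg hx, max_eq_left (sub_nonpos.2 (hmono (not_lt.1 hx))), zero_mul]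
    linarith [le_max_left 0 (e y - e m)]

/-- Growth of the positive part of `e γ - e m` along a path `γ` with integrable derivative `r`, when
the path representation is known only at grid points and almost everywhere. -/
theorem posPart_le_integral {e e' : ℝ → ℝ} (hmono : Monotone e)
    (hconv : ∀ x y, e x - e y ≤ e' x * (x - y)) (he' : Continuous e') {γ r : ℝ → ℝ} {t m B : ℝ}
    (hγ : Measurable γ) (ht : 0 < t) (hr : IntervalIntegrable r volume 0 t)
    (hgrid : ∀ N i : ℕ, i ≤ N + 1 → γ (i * (t / (N + 1))) = γ 0 + ∫ s in (0)..(i * (t / (N + 1))), r s)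
    (hae : ∀ᵐ τ ∂(volume.restrict (Ioc 0 t)), γ τ = γ 0 + ∫ s in (0)..τ, r s)
    (hB : ∀ N i : ℕ, i ≤ N + 1 → |e' (γ (i * (t / (N + 1))))| ≤ B)
    (hne : ∀ᵐ τ ∂(volume.restrict (Ioc 0 t)), γ τ ≠ m) (h0 : γ 0 ≤ m) :
    max 0 (e (γ t) - e m) ≤ ∫ τ in (0)..t, (if m < γ τ then e' (γ τ) else 0) * r τ := by
  set w : ℝ → ℝ := fun τ => if m < γ τ then e' (γ τ) else 0 with hw
  have hwm : Measurable w :=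
    Measurable.ite (measurableSet_lt measurable_const hγ) (he'.measurable.comp hγ) measurable_const
  have hB0 : 0 ≤ B := (abs_nonneg _).trans (hB 0 0 (by simp))
  -- The right endpoint of the grid cell containing `τ`: the convexity inequality uses the weight at
  -- the later time.
  let c : ℕ → ℝ → ℝ := fun N τ => ⌈τ / (t / (N + 1))⌉₊ * (t / (N + 1))
  have hδ : ∀ N : ℕ, 0 < t / ((N : ℝ) + 1) := fun N => by positivity
  have hNt : ∀ N : ℕ, ((N + 1 : ℕ) : ℝ) * (t / ((N : ℝ) + 1)) = t := fun N => by
    push_cast; field_simp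
  have hsub : ∀ N i : ℕ, i ≤ N + 1 → (i : ℝ) * (t / ((N : ℝ) + 1)) ∈ Icc 0 t := fun N i hi => by
    refine ⟨by have := hδ N; positivity, ?_⟩
    have h1 := (hδ N).le
    have h2 : (i : ℝ) ≤ ((N + 1 : ℕ) : ℝ) := by exact_mod_cast hi
    exact (mul_le_mul_of_nonneg_right h2 h1).trans (hNt N).le
  have hrI : ∀ N i : ℕ, i < N + 1 → IntervalIntegrable r volume
      ((i : ℝ) * (t / ((N : ℝ) + 1))) (((i + 1 : ℕ) : ℝ) * (t / ((N : ℝ) + 1))) := fun N i hi => by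
    refine hr.mono_set ?_
    rw [uIcc_of_le ht.le]
    exact uIcc_subset_Icc (hsub N i hi.le) (hsub N (i + 1) hi)
  have hceil : ∀ N i : ℕ, ∀ τ ∈ Ioc ((i : ℝ) * (t / ((N : ℝ) + 1)))
      (((i + 1 : ℕ) : ℝ) * (t / ((N : ℝ) + 1))), c N τ = ((i + 1 : ℕ) : ℝ) * (t / ((N : ℝ) + 1)) :=
    fun N i τ hτ => by
      have : ⌈τ / (t / ((N : ℝ) + 1))⌉₊ = i + 1 := by
        rw [Nat.ceil_eq_iff (by omega)]
        constructor
        · rw [lt_div_iff₀ (hδ N)]; simpa using hτ.1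
        · rw [div_le_iff₀ (hδ N)]; exact hτ.2
      simp only [c, this]
  have hcN : ∀ N : ℕ, ∀ τ ∈ Ioc 0 t, ⌈τ / (t / ((N : ℝ) + 1))⌉₊ ≤ N + 1 := fun N τ hτ => by
    rw [Nat.ceil_le, div_le_iff₀ (hδ N), hNt N]
    exact hτ.2
  have hstep : ∀ N : ℕ, max 0 (e (γ t) - e m) ≤ ∫ τ in (0)..t, w (c N τ) * r τ := by
    intro N
    set x : ℕ → ℝ := fun i => (i : ℝ) * (t / ((N : ℝ) + 1)) with hx
    have hxle : ∀ i, x i ≤ x (i + 1) := fun i => by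
      have := hδ N
      simp only [hx]
      push_cast
      nlinarith
    have hint : ∀ i < N + 1, IntervalIntegrable (fun τ => w (c N τ) * r τ) volume (x i) (x (i + 1)) :=
      fun i hi => by
        refine ((hrI N i hi).const_mul (w (x (i + 1)))).congr ?_
        intro τ hτ
        rw [uIoc_of_le (hxle i)] at hτ
        simp only
        rw [hceil N i τ hτ]
    have hsum := intervalIntegral.sum_integral_adjacent_intervals hint
    have hx0 : x 0 = 0 := by simp [hx]
    have hxt : x (N + 1) = t := hNt N
    rw [hx0, hxt] at hsum
    rw [← hsum]
    have htel := Finset.sum_range_sub (fun i => max 0 (e (γ (x i)) - e m)) (N + 1)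
    simp only [hx0, hxt] at htel
    rw [max_eq_left (sub_nonpos.2 (hmono h0)), sub_zero] at htel
    rw [← htel]
    refine Finset.sum_le_sum fun i hi => ?_
    have hi := Finset.mem_range.1 hi
    have h1 : ∫ τ in (x i)..(x (i + 1)), w (c N τ) * r τ =
        w (x (i + 1)) * (γ (x (i + 1)) - γ (x i)) := by
      have h2 : ∫ τ in (x i)..(x (i + 1)), w (c N τ) * r τ =
          ∫ τ in (x i)..(x (i + 1)), w (x (i + 1)) * r τ := by
        refine intervalIntegral.integral_congr_ae (Eventually.of_forall fun τ hτ => ?_)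
        rw [uIoc_of_le (hxle i)] at hτ
        rw [hceil N i τ hτ]
      rw [h2, intervalIntegral.integral_const_mul, hgrid N (i + 1) hi, hgrid N i hi.le,
        add_sub_add_left_eq_sub, intervalIntegral.integral_interval_sub_left]
      · refine hr.mono_set ?_
        rw [uIcc_of_le ht.le]
        exact uIcc_subset_Icc ⟨le_rfl, ht.le⟩ (hsub N (i + 1) hi)
      · refine hr.mono_set ?_
        rw [uIcc_of_le ht.le]
        exact uIcc_subset_Icc ⟨le_rfl, ht.le⟩ (hsub N i hi.le)
    rw [h1]
    exact posPart_sub_le hmono hconv m _ _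
  have hcont : ContinuousOn (fun τ => γ 0 + ∫ s in (0)..τ, r s) (Icc 0 t) := by
    have := intervalIntegral.continuousOn_primitive_interval' hr (left_mem_uIcc)
    rw [uIcc_of_le ht.le] at this
    exact continuousOn_const.add this
  have hctend : ∀ τ ∈ Ioc 0 t, Tendsto (fun N => c N τ) atTop (𝓝[Icc 0 t] τ) := fun τ hτ => by
    refine tendsto_nhdsWithin_iff.2 ⟨?_, Eventually.of_forall fun N => hsub N _ (hcN N τ hτ)⟩
    have hd : Tendsto (fun N : ℕ => τ + t / ((N : ℝ) + 1)) atTop (𝓝 τ) := by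
      have := (tendsto_const_nhds (x := τ)).add (tendsto_const_div_atTop_nhds_zero_nat t |>.comp
        (tendsto_add_atTop_nat 1))
      simpa using this
    refine tendsto_of_tendsto_of_tendsto_of_le_of_le tendsto_const_nhds hd (fun N => ?_) (fun N => ?_)
    · have := Nat.le_ceil (τ / (t / ((N : ℝ) + 1)))
      rwa [div_le_iff₀ (hδ N)] at this
    · have h1 := (Nat.ceil_lt_add_one (div_nonneg hτ.1.le (hδ N).le)).le
      calc c N τ ≤ (τ / (t / ((N : ℝ) + 1)) + 1) * (t / ((N : ℝ) + 1)) :=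
            mul_le_mul_of_nonneg_right h1 (hδ N).le
        _ = τ + t / ((N : ℝ) + 1) := by
            have := (hδ N).ne'
            rw [add_mul, one_mul, div_mul_cancel₀ _ this]
  have hlim : Tendsto (fun N => ∫ τ in (0)..t, w (c N τ) * r τ) atTop
      (𝓝 (∫ τ in (0)..t, w τ * r τ)) := by
    refine intervalIntegral.tendsto_integral_filter_of_dominated_convergence
      (fun τ => B * |r τ|) ?_ ?_ ?_ ?_
    · refine Eventually.of_forall fun N => ?_
      have hc : Measurable (c N) := by
        simp only [c]
        exact ((measurable_from_nat (f := fun n : ℕ => (n : ℝ))).comp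
          (Nat.measurable_ceil.comp (by fun_prop))).mul_const _
      refine (hwm.comp hc).aestronglyMeasurable.mul ?_
      rw [uIoc_of_le ht.le]
      exact hr.1.aestronglyMeasurable
    · refine Eventually.of_forall fun N => Eventually.of_forall fun τ hτ => ?_
      rw [uIoc_of_le ht.le] at hτ
      rw [Real.norm_eq_abs, abs_mul]
      refine mul_le_mul_of_nonneg_right ?_ (abs_nonneg _)
      simp only [hw]
      split_ifs
      · exact hB N _ (hcN N τ hτ)
      · simpa using hB0
    · exact hr.abs.const_mul B
    · rw [← ae_restrict_iff' measurableSet_uIoc, uIoc_of_le ht.le]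
      -- The weight jumps at `γ = m`; since `γ τ ≠ m` for almost every `τ`, its values at the grid
      -- points still converge.
      filter_upwards [hae, hne, ae_restrict_mem measurableSet_Ioc] with τ h1 h2 hτ
      refine Tendsto.mul_const _ ?_
      have hγt : Tendsto (fun N => γ (c N τ)) atTop (𝓝 (γ τ)) := by
        have h3 := (hcont τ ⟨hτ.1.le, hτ.2⟩).tendsto.comp (hctend τ hτ)
        rw [h1]
        refine h3.congr fun N => ?_
        exact (hgrid N _ (hcN N τ hτ)).symm
      simp only [hw]
      rcases lt_or_gt_of_ne h2 with h | h
      · rw [if_neg (not_lt.2 h.le)]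
        refine tendsto_const_nhds.congr' ?_
        filter_upwards [hγt.eventually (eventually_lt_nhds h)] with N hN
        rw [if_neg (not_lt.2 hN.le)]
      · rw [if_pos h]
        refine ((he'.tendsto _).comp hγt).congr' ?_
        filter_upwards [hγt.eventually (eventually_gt_nhds h)] with N hN
        rw [if_pos hN]; rfl
  exact ge_of_tendsto' hlim hstep

/-- Comparison principle for a family of paths solving `∂_t g = r` in integrated form. -/
theorem ae_le_of_integral_nonpos {X : Type*} [MeasurableSpace X] {μ : Measure X} [SFinite μ]
    {e e' : ℝ → ℝ} (hmono : StrictMono e)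
    (hconv : ∀ x y, e x - e y ≤ e' x * (x - y)) (he' : Continuous e')
    {g r : ℝ → X → ℝ} {m : X → ℝ} {T B : ℝ}
    (hg : Measurable (Function.uncurry g)) (hrm : Measurable (Function.uncurry r))
    (hm : Measurable m)
    (hr : Integrable (Function.uncurry r) ((volume.restrict (Ioc 0 T)).prod μ))
    (heq : ∀ t ∈ Icc 0 T, ∀ᵐ p ∂μ, g t p - g 0 p = ∫ s in (0)..t, r s p)
    (hB : ∀ t ∈ Icc 0 T, ∀ᵐ p ∂μ, |e' (g t p)| ≤ B)
    (hne : ∀ᵐ z ∂((volume.restrict (Ioc 0 T)).prod μ), g z.1 z.2 ≠ m z.2)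
    (h0 : ∀ᵐ p ∂μ, g 0 p ≤ m p)
    (hsign : ∀ t ∈ Icc 0 T, ∫ z, (if m z.2 < g z.1 z.2 then e' (g z.1 z.2) else 0) * r z.1 z.2
      ∂((volume.restrict (Ioc 0 t)).prod μ) ≤ 0) :
    ∀ t ∈ Icc 0 T, ∀ᵐ p ∂μ, g t p ≤ m p := by
  intro t ht
  rcases ht.1.eq_or_lt with rfl | htpos
  · exact h0
  have hsubt : Ioc 0 t ⊆ Ioc 0 T := Ioc_subset_Ioc_right ht.2
  have hac : (volume.restrict (Ioc 0 t)).prod μ ≤ (volume.restrict (Ioc 0 T)).prod μ :=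
    Measure.prod_mono (Measure.restrict_mono hsubt le_rfl) le_rfl
  have hrt : Integrable (Function.uncurry r) ((volume.restrict (Ioc 0 t)).prod μ) :=
    hr.mono_measure hac
  set W : ℝ × X → ℝ := fun z => if m z.2 < g z.1 z.2 then e' (g z.1 z.2) else 0 with hW
  have hWm : Measurable W :=
    Measurable.ite (measurableSet_lt (hm.comp measurable_snd) hg)
      (he'.measurable.comp hg) measurable_const
  have hWB : ∀ᵐ z ∂((volume.restrict (Ioc 0 t)).prod μ), ‖W z‖ ≤ B := by
    rw [Measure.ae_prod_iff_ae_ae (measurableSet_le hWm.norm measurable_const)]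
    filter_upwards [ae_restrict_mem measurableSet_Ioc] with τ hτ
    filter_upwards [hB τ ⟨hτ.1.le, hτ.2.trans ht.2⟩] with p hp
    simp only [hW]
    split_ifs
    · exact hp
    · simpa using (abs_nonneg _).trans hp
  have hWr : Integrable (fun z => W z * r z.1 z.2) ((volume.restrict (Ioc 0 t)).prod μ) :=
    hrt.bdd_mul hWm.aestronglyMeasurable hWB
  have hprim : Measurable fun z : ℝ × X => ∫ s, (Ioc 0 z.1).indicator (fun s => r s z.2) s := by
    refine (StronglyMeasurable.integral_prod_right' (f := fun y : (ℝ × X) × ℝ =>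
      (Ioc 0 y.1.1).indicator (fun s => r s y.1.2) y.2) ?_).measurable
    refine Measurable.stronglyMeasurable ?_
    have : (fun y : (ℝ × X) × ℝ => (Ioc 0 y.1.1).indicator (fun s => r s y.1.2) y.2) =
        {y : (ℝ × X) × ℝ | 0 < y.2 ∧ y.2 ≤ y.1.1}.indicator fun y => r y.2 y.1.2 := by
      ext y
      simp only [indicator, mem_Ioc, mem_ofPred_eq]
    rw [this]
    refine Measurable.indicator ?_ ?_
    · exact hrm.comp (f := fun y : (ℝ × X) × ℝ => (y.2, y.1.2)) (by fun_prop)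
    · exact (measurableSet_lt measurable_const measurable_snd).inter
        (measurableSet_le measurable_snd (by fun_prop))
  have hprim_eq : ∀ τ, 0 ≤ τ → ∀ p, ∫ s, (Ioc 0 τ).indicator (fun s => r s p) s =
      ∫ s in (0)..τ, r s p := fun τ hτ p => by
    rw [integral_indicator measurableSet_Ioc, intervalIntegral.integral_of_le hτ]
  -- The equation holds for each time off a null set of paths depending on that time. Fubini turns
  -- this into almost every time for almost every path.
  have hpath : ∀ᵐ p ∂μ, ∀ᵐ τ ∂(volume.restrict (Ioc 0 t)), g τ p = g 0 p + ∫ s in (0)..τ, r s p := by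
    have hS : MeasurableSet {z : ℝ × X | g z.1 z.2 = g 0 z.2 +
        ∫ s, (Ioc 0 z.1).indicator (fun s => r s z.2) s} := by
      refine measurableSet_eq_fun hg (Measurable.add ?_ hprim)
      exact hg.comp (f := fun z : ℝ × X => ((0 : ℝ), z.2)) (by fun_prop)
    have h1 : ∀ᵐ τ ∂(volume.restrict (Ioc 0 t)), ∀ᵐ p ∂μ, g τ p = g 0 p +
        ∫ s, (Ioc 0 τ).indicator (fun s => r s p) s := by
      filter_upwards [ae_restrict_mem measurableSet_Ioc] with τ hτ
      filter_upwards [heq τ ⟨hτ.1.le, hτ.2.trans ht.2⟩] with p hp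
      rw [hprim_eq τ hτ.1.le, ← hp]
      ring
    rw [Measure.ae_ae_comm hS] at h1
    filter_upwards [h1] with p hp
    filter_upwards [hp, ae_restrict_mem measurableSet_Ioc] with τ hτ hτ2
    rw [hτ, hprim_eq τ hτ2.1.le]
  have hnep : ∀ᵐ p ∂μ, ∀ᵐ τ ∂(volume.restrict (Ioc 0 t)), g τ p ≠ m p := by
    have hS : MeasurableSet {z : ℝ × X | g z.1 z.2 ≠ m z.2} :=
      (measurableSet_eq_fun hg (hm.comp measurable_snd)).compl
    have h1 := Measure.ae_ae_of_ae_prod (hac.absolutelyContinuous.ae_le hne)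
    rwa [Measure.ae_ae_comm hS] at h1
  have hmem : ∀ N i : ℕ, i ≤ N + 1 → (i : ℝ) * (t / ((N : ℝ) + 1)) ∈ Icc 0 T := fun N i hi => by
    refine ⟨by positivity, le_trans ?_ ht.2⟩
    have : ((i : ℝ)) ≤ N + 1 := by exact_mod_cast hi
    calc (i : ℝ) * (t / ((N : ℝ) + 1)) ≤ (N + 1) * (t / ((N : ℝ) + 1)) := by gcongr
      _ = t := by field_simp
  -- All grids together have countably many points, so one null set of paths suffices for them.
  have hgrid : ∀ᵐ p ∂μ, ∀ N i : ℕ, i ≤ N + 1 →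
      g (i * (t / (N + 1))) p = g 0 p + ∫ s in (0)..(i * (t / (N + 1))), r s p := by
    refine ae_all_iff.2 fun N => ae_all_iff.2 fun i => ?_
    by_cases hi : i ≤ N + 1
    · filter_upwards [heq _ (hmem N i hi)] with p hp _
      rw [← hp]; ring
    · exact Eventually.of_forall fun p h => absurd h hi
  have hBgrid : ∀ᵐ p ∂μ, ∀ N i : ℕ, i ≤ N + 1 → |e' (g (i * (t / (N + 1))) p)| ≤ B := by
    refine ae_all_iff.2 fun N => ae_all_iff.2 fun i => ?_
    by_cases hi : i ≤ N + 1
    · filter_upwards [hB _ (hmem N i hi)] with p hp _ using hp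
    · exact Eventually.of_forall fun p h => absurd h hi
  have hrp : ∀ᵐ p ∂μ, Integrable (fun τ => r τ p) (volume.restrict (Ioc 0 t)) :=
    hrt.prod_left_ae
  have hJ : ∀ᵐ p ∂μ, max 0 (e (g t p) - e (m p)) ≤ ∫ τ in Ioc 0 t, W (τ, p) * r τ p := by
    filter_upwards [hpath, hnep, hgrid, hBgrid, hrp, h0] with p h1 h2 h3 h4 h5 h6
    have := posPart_le_integral hmono.monotone hconv he' (γ := fun τ => g τ p)
      (r := fun τ => r τ p) (hg.comp measurable_prodMk_right) htpos
      ((intervalIntegrable_iff_integrableOn_Ioc_of_le htpos.le).2 h5) h3 h1 h4 h2 h6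
    rwa [intervalIntegral.integral_of_le htpos.le] at this
  have hJint : Integrable (fun p => ∫ τ in Ioc 0 t, W (τ, p) * r τ p) μ :=
    hWr.integral_prod_right
  -- This integral dominates a positive part, hence is nonnegative, but its mean over the paths is
  -- at most `0`. So it vanishes almost everywhere, and the positive part with it.
  have hJ0 : 0 ≤ᵐ[μ] fun p => ∫ τ in Ioc 0 t, W (τ, p) * r τ p := by
    filter_upwards [hJ] with p hp using (le_max_left _ _).trans hp
  have hJz : ∫ p, ∫ τ in Ioc 0 t, W (τ, p) * r τ p ∂volume ∂μ ≤ 0 := by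
    have := hsign t ht
    rwa [integral_prod_symm _ hWr] at this
  have hJae := (integral_eq_zero_iff_of_nonneg_ae hJ0 hJint).1
    (le_antisymm hJz (integral_nonneg_of_ae hJ0))
  filter_upwards [hJ, hJae] with p h1 h2
  rw [h2] at h1
  have h3 := (le_max_right _ _).trans h1
  exact hmono.le_iff_le.1 (sub_nonpos.1 h3)

/-! ### Free transport and measurability of the collision terms -/

theorem continuous_move {d : ℕ} :
    Continuous fun z : ℝ × Torus d × Vel d => move z.1 z.2.1 z.2.2 := by
  unfold move
  refine continuous_pi fun i => ?_
  refine Continuous.add (by fun_prop) ?_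
  exact (AddCircle.continuous_mk' 1).comp (by fun_prop)

@[fun_prop]
theorem Measurable.move {d : ℕ} {X : Type*} [MeasurableSpace X] {t : X → ℝ} {x : X → Torus d}
    {v : X → Vel d} (ht : Measurable t) (hx : Measurable x) (hv : Measurable v) :
    Measurable fun z => move (t z) (x z) (v z) :=
  continuous_move.measurable.comp (ht.prodMk (hx.prodMk hv))

@[simp]
theorem move_zero {d : ℕ} (x : Torus d) (v : Vel d) : move 0 x v = x := by
  ext i
  simp [move]

theorem move_add {d : ℕ} (s t : ℝ) (x : Torus d) (v : Vel d) :
    move (s + t) x v = move t (move s x v) v := by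
  ext i
  simp only [move, add_mul, AddCircle.coe_add, add_assoc]

/-- For fixed `v` this is a translation of the torus, so the map is a skew product over the identity
in `v`. -/
theorem measurePreserving_move {d : ℕ} (t : ℝ) :
    MeasurePreserving (fun p : Torus d × Vel d => (move t p.1 p.2, p.2)) := by
  have h1 : MeasurePreserving (fun p : Vel d × Torus d => (p.1, move t p.2 p.1))
      (volume.prod volume) (volume.prod volume) := by
    refine (MeasurePreserving.id volume).skew_product
      (g := fun (v : Vel d) (x : Torus d) => move t x v)
      (by simp only [Function.uncurry_def]; fun_prop) (Eventually.of_forall fun v => ?_)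
    exact (measurePreserving_add_right (volume : Measure (Torus d))
      (fun i => ((t * v i : ℝ) : UnitAddCircle))).map_eq
  exact (Measure.measurePreserving_swap.comp h1).comp Measure.measurePreserving_swap

theorem measurePreserving_flow {d : ℕ} (ν : Measure ℝ) [SFinite ν] :
    MeasurePreserving (fun z : ℝ × Torus d × Vel d => (z.1, move z.1 z.2.1 z.2.2, z.2.2))
      (ν.prod volume) (ν.prod volume) := by
  refine (MeasurePreserving.id ν).skew_product
    (g := fun (t : ℝ) (p : Torus d × Vel d) => (move t p.1 p.2, p.2))
    (by simp only [Function.uncurry_def]; fun_prop) (Eventually.of_forall fun t => ?_)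
  exact (measurePreserving_move t).map_eq

theorem volume_torus_univ {d : ℕ} : (volume : Measure (Torus d)) univ = 1 := by
  rw [volume_pi, Measure.pi_univ]
  exact Finset.prod_eq_one fun i _ => UnitAddCircle.measure_univ

section Measurability

variable {d : ℕ} {β : ℝ} {h : ℝ → ℝ} {f : ℝ → Torus d → Vel d → ℝ}

theorem measurable_kernel (hh : Measurable h) :
    Measurable fun p : Vel d × Sph d => kernel β h p.1 p.2 := by
  unfold kernel
  refine Measurable.mul (by fun_prop) (hh.comp ?_)
  fun_prop

theorem measurable_gain (hh : Measurable h)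
    (hf : Measurable fun p : ℝ × Torus d × Vel d => f p.1 p.2.1 p.2.2) :
    Measurable fun z : ℝ × Torus d × Vel d => gain β h (f z.1 z.2.1) z.2.2 := by
  unfold gain
  refine Measurable.lintegral_prod_right' (f := fun p : (ℝ × Torus d × Vel d) × Vel d =>
    ∫⁻ σ : Sph d, ENNReal.ofReal (f p.1.1 p.1.2.1 (postStar p.1.2.2 p.2 σ) *
      f p.1.1 p.1.2.1 (post p.1.2.2 p.2 σ) * kernel β h (p.1.2.2 - p.2) σ) ∂(surf d)) ?_
  refine Measurable.lintegral_prod_right' (f := fun p : ((ℝ × Torus d × Vel d) × Vel d) × Sph d =>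
    ENNReal.ofReal (f p.1.1.1 p.1.1.2.1 (postStar p.1.1.2.2 p.1.2 p.2) *
      f p.1.1.1 p.1.1.2.1 (post p.1.1.2.2 p.1.2 p.2) * kernel β h (p.1.1.2.2 - p.1.2) p.2)) ?_
  refine Measurable.ennreal_ofReal (Measurable.mul (Measurable.mul ?_ ?_) ?_)
  · exact hf.comp (f := fun p : ((ℝ × Torus d × Vel d) × Vel d) × Sph d =>
      (p.1.1.1, p.1.1.2.1, postStar p.1.1.2.2 p.1.2 p.2)) (by fun_prop)
  · exact hf.comp (f := fun p : ((ℝ × Torus d × Vel d) × Vel d) × Sph d =>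
      (p.1.1.1, p.1.1.2.1, post p.1.1.2.2 p.1.2 p.2)) (by fun_prop)
  · exact (measurable_kernel hh).comp (f := fun p : ((ℝ × Torus d × Vel d) × Vel d) × Sph d =>
      (p.1.1.2.2 - p.1.2, p.2)) (by fun_prop)

theorem measurable_loss (hh : Measurable h)
    (hf : Measurable fun p : ℝ × Torus d × Vel d => f p.1 p.2.1 p.2.2) :
    Measurable fun z : ℝ × Torus d × Vel d => loss β h (f z.1 z.2.1) z.2.2 := by
  unfold loss
  refine Measurable.lintegral_prod_right' (f := fun p : (ℝ × Torus d × Vel d) × Vel d =>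
    ∫⁻ σ : Sph d, ENNReal.ofReal (f p.1.1 p.1.2.1 p.2 *
      f p.1.1 p.1.2.1 p.1.2.2 * kernel β h (p.1.2.2 - p.2) σ) ∂(surf d)) ?_
  refine Measurable.lintegral_prod_right' (f := fun p : ((ℝ × Torus d × Vel d) × Vel d) × Sph d =>
    ENNReal.ofReal (f p.1.1.1 p.1.1.2.1 p.1.2 *
      f p.1.1.1 p.1.1.2.1 p.1.1.2.2 * kernel β h (p.1.1.2.2 - p.1.2) p.2)) ?_
  refine Measurable.ennreal_ofReal (Measurable.mul (Measurable.mul ?_ ?_) ?_)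
  · exact hf.comp (f := fun p : ((ℝ × Torus d × Vel d) × Vel d) × Sph d =>
      (p.1.1.1, p.1.1.2.1, p.1.2)) (by fun_prop)
  · exact hf.comp (f := fun p : ((ℝ × Torus d × Vel d) × Vel d) × Sph d =>
      (p.1.1.1, p.1.1.2.1, p.1.1.2.2)) (by fun_prop)
  · exact (measurable_kernel hh).comp (f := fun p : ((ℝ × Torus d × Vel d) × Vel d) × Sph d =>
      (p.1.1.2.2 - p.1.2, p.2)) (by fun_prop)

theorem measurable_collision (hh : Measurable h)
    (hf : Measurable fun p : ℝ × Torus d × Vel d => f p.1 p.2.1 p.2.2) :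
    Measurable fun z : ℝ × Torus d × Vel d => collision β h (f z.1 z.2.1) z.2.2 :=
  (measurable_gain hh hf).ennreal_toReal.sub (measurable_loss hh hf).ennreal_toReal

end Measurability

/-! ### Comparison with a Maxwellian for the Boltzmann flow -/

/-- The collision operator at one time and position: bounded total rate, and a sign on the set
where the profile exceeds a Maxwellian. -/
structure HasCollisionBounds {d : ℕ} (β : ℝ) (h : ℝ → ℝ) (M : Vel d → ℝ) (K : ℝ≥0∞)
    (F : Vel d → ℝ) : Prop where
  gain_le : ∫⁻ v, gain β h F v ≤ K
  loss_le : ∫⁻ v, loss β h F v ≤ K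
  setGain_le : ∫⁻ v in {v | M v < F v}, gain β h F v ≤ ∫⁻ v in {v | M v < F v}, loss β h F v

section Comparison

variable {d : ℕ} {β T : ℝ} {h : ℝ → ℝ} {f : ℝ → Torus d → Vel d → ℝ} {M : Vel d → ℝ} {K : ℝ≥0∞}

theorem lintegral_phase_le {F : ℝ × Torus d × Vel d → ℝ≥0∞} (hF : Measurable F)
    (hK : ∀ t ∈ Icc 0 T, ∀ᵐ x : Torus d, ∫⁻ v, F (t, x, v) ≤ K) :
    ∫⁻ z, F z ∂((volume.restrict (Ioc 0 T)).prod volume) ≤ K * ENNReal.ofReal T := by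
  rw [lintegral_prod _ hF.aemeasurable]
  calc ∫⁻ t in Ioc 0 T, ∫⁻ p : Torus d × Vel d, F (t, p) ≤ ∫⁻ _t in Ioc 0 T, K := by
        refine setLIntegral_mono' measurableSet_Ioc fun t ht => ?_
        have hFt : Measurable fun p : Torus d × Vel d => F (t, p) := hF.comp measurable_prodMk_left
        rw [Measure.volume_eq_prod, lintegral_prod _ hFt.aemeasurable]
        calc ∫⁻ x : Torus d, ∫⁻ v, F (t, x, v) ≤ ∫⁻ _x : Torus d, K :=
              lintegral_mono_ae (hK t ⟨ht.1.le, ht.2⟩)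
          _ = K := by rw [lintegral_const, volume_torus_univ, mul_one]
    _ = K * ENNReal.ofReal T := by simp

theorem integrable_collision (hK : K ≠ ⊤) (hh : Measurable h)
    (hf : Measurable fun p : ℝ × Torus d × Vel d => f p.1 p.2.1 p.2.2)
    (hQ : ∀ t ∈ Icc 0 T, ∀ᵐ x : Torus d, HasCollisionBounds β h M K (f t x)) :
    Integrable (fun z : ℝ × Torus d × Vel d => collision β h (f z.1 z.2.1) z.2.2)
      ((volume.restrict (Ioc 0 T)).prod volume) := by
  refine Integrable.sub ?_ ?_
  · refine integrable_toReal_of_lintegral_ne_top (measurable_gain hh hf).aemeasurable ?_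
    refine ((lintegral_phase_le (K := K) (measurable_gain hh hf) fun t ht => ?_).trans_lt
      (ENNReal.mul_lt_top hK.lt_top ENNReal.ofReal_lt_top)).ne
    filter_upwards [hQ t ht] with x hx using hx.gain_le
  · refine integrable_toReal_of_lintegral_ne_top (measurable_loss hh hf).aemeasurable ?_
    refine ((lintegral_phase_le (K := K) (measurable_loss hh hf) fun t ht => ?_).trans_lt
      (ENNReal.mul_lt_top hK.lt_top ENNReal.ofReal_lt_top)).ne
    filter_upwards [hQ t ht] with x hx using hx.loss_le

/-- The sign is available separately at each time and position; the finite rate `K` permits iterated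
integration and the subtraction of gain and loss. -/
theorem integral_collision_nonpos (hK : K ≠ ⊤) (hh : Measurable h) (hM : Measurable M)
    (hf : Measurable fun p : ℝ × Torus d × Vel d => f p.1 p.2.1 p.2.2)
    (hQ : ∀ t ∈ Icc 0 T, ∀ᵐ x : Torus d, HasCollisionBounds β h M K (f t x)) :
    ∫ z : ℝ × Torus d × Vel d, (if M z.2.2 < f z.1 z.2.1 z.2.2 then
      collision β h (f z.1 z.2.1) z.2.2 else 0) ∂((volume.restrict (Ioc 0 T)).prod volume) ≤ 0 := by
  have hS : MeasurableSet {z : ℝ × Torus d × Vel d | M z.2.2 < f z.1 z.2.1 z.2.2} :=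
    measurableSet_lt (hM.comp (f := fun z : ℝ × Torus d × Vel d => z.2.2) (by fun_prop)) hf
  have hint := (integrable_collision (M := M) hK hh hf hQ).indicator hS
  have heq : (fun z : ℝ × Torus d × Vel d => (if M z.2.2 < f z.1 z.2.1 z.2.2 then
      collision β h (f z.1 z.2.1) z.2.2 else 0)) =
      {z : ℝ × Torus d × Vel d | M z.2.2 < f z.1 z.2.1 z.2.2}.indicator
        fun z => collision β h (f z.1 z.2.1) z.2.2 := by
    ext z
    simp [indicator]
  rw [heq, integral_prod _ hint]
  refine integral_nonpos_of_ae ?_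
  filter_upwards [hint.prod_right_ae, ae_restrict_mem measurableSet_Ioc] with t ht htT
  rw [Measure.volume_eq_prod] at ht ⊢
  rw [integral_prod _ ht]
  refine integral_nonpos_of_ae ?_
  filter_upwards [hQ t ⟨htT.1.le, htT.2⟩] with x hx
  have mg : Measurable (gain β h (f t x)) :=
    (measurable_gain hh hf).comp (f := fun v : Vel d => (t, x, v)) (by fun_prop)
  have ml : Measurable (loss β h (f t x)) :=
    (measurable_loss hh hf).comp (f := fun v : Vel d => (t, x, v)) (by fun_prop)
  have mS : MeasurableSet {v : Vel d | M v < f t x v} :=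
    measurableSet_lt hM (hf.comp (f := fun v : Vel d => (t, x, v)) (by fun_prop))
  have ig : Integrable (fun v => (gain β h (f t x) v).toReal) :=
    integrable_toReal_of_lintegral_ne_top mg.aemeasurable (hx.gain_le.trans_lt hK.lt_top).ne
  have il : Integrable (fun v => (loss β h (f t x) v).toReal) :=
    integrable_toReal_of_lintegral_ne_top ml.aemeasurable (hx.loss_le.trans_lt hK.lt_top).ne
  have hgt : ∀ᵐ v ∂(volume.restrict {v : Vel d | M v < f t x v}), gain β h (f t x) v < ⊤ :=
    ae_restrict_of_ae (ae_lt_top mg (hx.gain_le.trans_lt hK.lt_top).ne)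
  have hlt : ∀ᵐ v ∂(volume.restrict {v : Vel d | M v < f t x v}), loss β h (f t x) v < ⊤ :=
    ae_restrict_of_ae (ae_lt_top ml (hx.loss_le.trans_lt hK.lt_top).ne)
  have : ∫ v, {z : ℝ × Torus d × Vel d | M z.2.2 < f z.1 z.2.1 z.2.2}.indicator
      (fun z => collision β h (f z.1 z.2.1) z.2.2) (t, x, v) =
      ∫ v in {v : Vel d | M v < f t x v}, collision β h (f t x) v := by
    rw [← integral_indicator mS]
    rfl
  simp only [Pi.zero_apply]
  rw [this]
  unfold collision
  rw [integral_sub ig.integrableOn il.integrableOn, sub_nonpos, integral_toReal mg.aemeasurable hgt,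
    integral_toReal ml.aemeasurable hlt]
  refine ENNReal.toReal_mono ?_ hx.setGain_le
  exact ((setLIntegral_le_lintegral _ _).trans_lt (hx.loss_le.trans_lt hK.lt_top)).ne

/-- Comparison with a Maxwellian for solutions whose transform `ψ ∘ f` satisfies the integrated
equation along characteristics. -/
theorem ae_le_of_characteristics {ψ ϱ e e' : ℝ → ℝ} {C : ℝ} (hmono : StrictMono e)
    (hconv : ∀ x y, e x - e y ≤ e' x * (x - y)) (he' : Continuous e')
    (hψm : Measurable ψ) (hϱm : Measurable ϱ) (hψ : StrictMonoOn ψ (Ici 0))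
    (hinv : ∀ y, 0 ≤ y → e' (ψ y) * ϱ y = 1) (hϱ : ∀ y, 0 ≤ y → |ϱ y| ≤ 1)
    (hbd : ∀ y, 0 ≤ y → |e' (ψ y)| ≤ 1 + y)
    (hK : K ≠ ⊤) (hh : Measurable h) (hM : Measurable M) (hM0 : ∀ v, 0 ≤ M v)
    (hf : Measurable fun p : ℝ × Torus d × Vel d => f p.1 p.2.1 p.2.2)
    (hf0 : ∀ t ∈ Icc 0 T, ∀ x v, 0 ≤ f t x v)
    (hfC : ∀ t ∈ Icc 0 T, ∀ᵐ p : Torus d × Vel d, f t p.1 p.2 ≤ C)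
    (hQ : ∀ t ∈ Icc 0 T, ∀ᵐ x : Torus d, HasCollisionBounds β h M K (f t x))
    (heq : ∀ t ∈ Icc 0 T, ∀ᵐ p : Torus d × Vel d,
      ψ (f t (move t p.1 p.2) p.2) - ψ (f 0 p.1 p.2) =
        ∫ s in (0)..t, collision β h (f s (move s p.1 p.2)) p.2 * ϱ (f s (move s p.1 p.2) p.2))
    (hne : ∀ᵐ z : ℝ × Torus d × Vel d ∂((volume.restrict (Ioc 0 T)).prod volume),
      f z.1 z.2.1 z.2.2 ≠ M z.2.2)
    (hinit : ∀ᵐ p : Torus d × Vel d, f 0 p.1 p.2 ≤ M p.2) :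
    ∀ t ∈ Icc 0 T, ∀ᵐ p : Torus d × Vel d, f t p.1 p.2 ≤ M p.2 := by
  by_cases hT : 0 ≤ T
  swap
  · intro t ht
    exact absurd (ht.1.trans ht.2) hT
  have hflow := fun t => measurePreserving_flow (d := d) (volume.restrict (Ioc 0 t))
  have hcm := measurable_collision (β := β) hh hf
  have hfm : Measurable fun z : ℝ × Torus d × Vel d => f z.1 (move z.1 z.2.1 z.2.2) z.2.2 :=
    hf.comp (hflow T).measurable
  have hcm' : Measurable fun z : ℝ × Torus d × Vel d =>
      collision β h (f z.1 (move z.1 z.2.1 z.2.2)) z.2.2 := hcm.comp (hflow T).measurable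
  have hrm : Measurable fun z : ℝ × Torus d × Vel d =>
      collision β h (f z.1 (move z.1 z.2.1 z.2.2)) z.2.2 *
        ϱ (f z.1 (move z.1 z.2.1 z.2.2) z.2.2) := hcm'.mul (hϱm.comp hfm)
  have hmem : ∀ t ≤ T, ∀ᵐ z : ℝ × Torus d × Vel d ∂((volume.restrict (Ioc 0 t)).prod volume),
      z.1 ∈ Icc 0 T := fun t ht => by
    have h1 : ∀ᵐ s ∂(volume.restrict (Ioc 0 t)), s ∈ Icc 0 T := by
      filter_upwards [ae_restrict_mem measurableSet_Ioc] with s hs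
      exact ⟨hs.1.le, hs.2.trans ht⟩
    exact Measure.quasiMeasurePreserving_fst.ae h1
  have hcint : Integrable (fun z : ℝ × Torus d × Vel d =>
      collision β h (f z.1 (move z.1 z.2.1 z.2.2)) z.2.2)
      ((volume.restrict (Ioc 0 T)).prod volume) :=
    ((hflow T).integrable_comp hcm.aestronglyMeasurable).2 (integrable_collision hK hh hf hQ)
  -- The abstract principle is applied to `ψ ∘ f` along characteristics, labelled by the initial
  -- point. The threshold `ψ(M(v))` is constant on each of them.
  have key := ae_le_of_integral_nonpos (μ := (volume : Measure (Torus d × Vel d))) (B := 1 + C)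
    hmono hconv he' (g := fun t p => ψ (f t (move t p.1 p.2) p.2))
    (r := fun s p => collision β h (f s (move s p.1 p.2)) p.2 * ϱ (f s (move s p.1 p.2) p.2))
    (m := fun p => ψ (M p.2)) (T := T) (hψm.comp hfm) hrm
    (hψm.comp (hM.comp measurable_snd)) ?_ ?_ ?_ ?_ ?_ ?_
  · intro t ht
    have h1 := key t ht
    have h2 : ∀ᵐ p : Torus d × Vel d, f t (move t p.1 p.2) p.2 ≤ M p.2 := by
      filter_upwards [h1] with p hp
      exact (hψ.le_iff_le (hf0 t ht _ _) (hM0 _)).1 hp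
    have hm := measurePreserving_move (d := d) t
    rw [← hm.map_eq, ae_map_iff hm.measurable.aemeasurable]
    · exact h2
    · exact measurableSet_le (hf.comp (f := fun p : Torus d × Vel d => (t, p.1, p.2)) (by fun_prop))
        (hM.comp measurable_snd)
  · refine hcint.mul_bdd (c := 1) (hϱm.comp hfm).aestronglyMeasurable ?_
    filter_upwards [hmem T le_rfl] with z hz
    exact hϱ _ (hf0 _ hz _ _)
  · intro t ht
    filter_upwards [heq t ht] with p hp
    simp only [move_zero]
    exact hp
  · intro t ht
    filter_upwards [(measurePreserving_move (d := d) t).quasiMeasurePreserving.ae (hfC t ht)] with p hp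
    exact (hbd _ (hf0 t ht _ _)).trans (by linarith)
  · filter_upwards [(hflow T).quasiMeasurePreserving.ae hne, hmem T le_rfl] with z h1 h2 h3
    exact h1 (hψ.injOn (hf0 _ h2 _ _) (hM0 _) h3)
  · filter_upwards [hinit] with p hp
    simp only [move_zero]
    exact (hψ.le_iff_le (hf0 0 ⟨le_rfl, hT⟩ _ _) (hM0 _)).2 hp
  · intro t ht
    have h1 := integral_collision_nonpos (T := t) hK hh hM hf
      (fun s hs => hQ s ⟨hs.1, hs.2.trans ht.2⟩)
    rw [← (hflow t).map_eq, integral_map (hflow t).measurable.aemeasurable] at h1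
    · refine le_trans (le_of_eq (integral_congr_ae ?_)) h1
      filter_upwards [hmem t ht.2] with z hz
      have hp := hf0 _ hz (move z.1 z.2.1 z.2.2) z.2.2
      -- Monotonicity of `ψ` turns the threshold set into `{M < f}`, and `e'(ψ(f)) ϱ(f) = 1`
      -- restores the plain collision term.
      simp only [hψ.lt_iff_lt (mem_Ici.2 (hM0 z.2.2)) (mem_Ici.2 hp)]
      split_ifs
      · rw [mul_comm (collision β h _ _), ← mul_assoc, hinv _ hp, one_mul]
      · rw [zero_mul]
    · exact (Measurable.ite (measurableSet_lt (hM.comp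
        (f := fun z : ℝ × Torus d × Vel d => z.2.2) (by fun_prop)) hf) hcm
        measurable_const).aestronglyMeasurable

end Comparison

/-! ### One-dimensional weak equations and Fourier uniqueness -/

/-- A smooth compactly supported function on an interval with vanishing integral has a smooth
compactly supported primitive. -/
theorem exists_primitive_test {T : ℝ} {ξ : ℝ → ℝ} (hξ : ContDiff ℝ ∞ ξ)
    (hc : HasCompactSupport ξ) (hs : tsupport ξ ⊆ Ioo 0 T) (h0 : ∫ x, ξ x = 0) :
    ∃ χ : ℝ → ℝ, ContDiff ℝ ∞ χ ∧ HasCompactSupport χ ∧ tsupport χ ⊆ Ioo 0 T ∧ deriv χ = ξ := by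
  set χ : ℝ → ℝ := fun t => ∫ s in (0)..t, ξ s with hχ
  have hder : ∀ t, HasDerivAt χ (ξ t) t := fun t =>
    intervalIntegral.integral_hasDerivAt_right (hξ.continuous.intervalIntegrable _ _)
      (hξ.continuous.stronglyMeasurableAtFilter _ _) hξ.continuous.continuousAt
  have hderiv : deriv χ = ξ := funext fun t => (hder t).deriv
  obtain ⟨a, b, hab, ha, hb⟩ : ∃ a b, tsupport ξ ⊆ Icc a b ∧ 0 < a ∧ b < T := by
    rcases (tsupport ξ).eq_empty_or_nonempty with he | hne
    -- The interval may be empty here; only `0 < a` and `b < T` are used.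
    · exact ⟨1, T - 1, by simp [he], one_pos, by linarith⟩
    · obtain ⟨a, ha⟩ := hc.isCompact.exists_isLeast hne
      obtain ⟨b, hb⟩ := hc.isCompact.exists_isGreatest hne
      exact ⟨a, b, fun x hx => ⟨ha.2 hx, hb.2 hx⟩, (hs ha.1).1, (hs hb.1).2⟩
  have hz : ∀ x, x ∉ Icc a b → ξ x = 0 := fun x hx =>
    image_eq_zero_of_notMem_tsupport fun h => hx (hab h)
  have hχz : ∀ t, t ∉ Icc a b → χ t = 0 := by
    intro t ht
    by_cases hta : t < a
    · have : ∫ s in (0)..t, ξ s = ∫ s in (0)..t, (0 : ℝ) := by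
        refine intervalIntegral.integral_congr fun s hs => hz s fun h => ?_
        have := (mem_uIcc.1 hs)
        rcases this with h' | h' <;> linarith [h.1]
      simp only [hχ, this, intervalIntegral.integral_zero]
    · have htb : b < t := by
        by_contra hc
        exact ht ⟨not_lt.1 hta, not_lt.1 hc⟩
      have ht0 : 0 ≤ t := by linarith
      have : ∫ s in (0)..t, ξ s = ∫ s, ξ s := by
        rw [intervalIntegral.integral_of_le ht0]
        refine setIntegral_eq_integral_of_forall_compl_eq_zero fun s hs => hz s fun h => hs ?_
        exact ⟨ha.trans_le h.1, h.2.trans htb.le⟩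
      simp only [hχ, this, h0]
  have hsupp : tsupport χ ⊆ Icc a b :=
    closure_minimal (fun t ht => by_contra fun h => ht (hχz t h)) isClosed_Icc
  refine ⟨χ, ?_, HasCompactSupport.intro isCompact_Icc hχz,
    hsupp.trans (Icc_subset_Ioo ha hb), hderiv⟩
  rw [contDiff_infty_iff_deriv]
  exact ⟨fun t => (hder t).differentiableAt, hderiv ▸ hξ⟩

/-- The lemma of du Bois-Reymond: weak equation to integrated equation. -/
theorem integrated_of_weak {T : ℝ} (hT : 0 < T) {A B : ℝ → ℝ} (hA : ContinuousOn A (Icc 0 T))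
    (hB : IntervalIntegrable B volume 0 T)
    (hweak : ∀ χ : ℝ → ℝ, ContDiff ℝ ∞ χ → HasCompactSupport χ → tsupport χ ⊆ Ioo 0 T →
      -∫ t in Ioo 0 T, A t * deriv χ t = ∫ t in Ioo 0 T, B t * χ t) :
    ∀ t ∈ Icc 0 T, A t - A 0 = ∫ s in (0)..t, B s := by
  set P : ℝ → ℝ := fun t => ∫ s in (0)..t, B s with hP
  have hPc : ContinuousOn P (Icc 0 T) := by
    have := intervalIntegral.continuousOn_primitive_interval' hB left_mem_uIcc
    rwa [uIcc_of_le hT.le] at this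
  set D : ℝ → ℝ := fun t => A t - P t with hD
  have hDc : ContinuousOn D (Icc 0 T) := hA.sub hPc
  have hIoo : ∀ F : ℝ → ℝ, ∫ t in Ioo 0 T, F t = ∫ t in (0)..T, F t := fun F => by
    rw [intervalIntegral.integral_of_le hT.le, integral_Ioc_eq_integral_Ioo]
  have hend : ∀ χ : ℝ → ℝ, tsupport χ ⊆ Ioo 0 T → χ 0 = 0 ∧ χ T = 0 := fun χ hχ =>
    ⟨image_eq_zero_of_notMem_tsupport fun h => lt_irrefl _ (hχ h).1,
      image_eq_zero_of_notMem_tsupport fun h => lt_irrefl _ (hχ h).2⟩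
  have hDweak : ∀ χ : ℝ → ℝ, ContDiff ℝ ∞ χ → HasCompactSupport χ → tsupport χ ⊆ Ioo 0 T →
      ∫ t in (0)..T, D t * deriv χ t = 0 := by
    intro χ h1 h2 h3
    have hχd : Continuous (deriv χ) := h1.continuous_deriv (by simp)
    have hw := hweak χ h1 h2 h3
    rw [hIoo, hIoo] at hw
    -- Since `B` is merely integrable, its primitive is only absolutely continuous, which is enough
    -- to integrate by parts against `χ`.
    have hPac := hB.absolutelyContinuousOnInterval_intervalIntegral left_mem_uIcc
    have hχac : AbsolutelyContinuousOnInterval χ 0 T :=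
      (h1.contDiffOn.of_le (by simp)).absolutelyContinuousOnInterval
    have hparts := hPac.integral_mul_deriv_eq_deriv_mul hχac
    rw [(hend χ h3).1, (hend χ h3).2, mul_zero, mul_zero, sub_zero, zero_sub] at hparts
    have hPd : ∫ t in (0)..T, deriv P t * χ t = ∫ t in (0)..T, B t * χ t := by
      refine intervalIntegral.integral_congr_ae ?_
      filter_upwards [hB.ae_hasDerivAt_integral] with t ht hmem
      rw [(ht (uIoc_subset_uIcc hmem) 0 left_mem_uIcc).deriv]
    have hAi : IntervalIntegrable (fun t => A t * deriv χ t) volume 0 T :=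
      (ContinuousOn.mul (by rwa [uIcc_of_le hT.le]) hχd.continuousOn).intervalIntegrable
    have hPi : IntervalIntegrable (fun t => P t * deriv χ t) volume 0 T :=
      (ContinuousOn.mul (by rwa [uIcc_of_le hT.le]) hχd.continuousOn).intervalIntegrable
    simp only [hD, sub_mul]
    rw [intervalIntegral.integral_sub hAi hPi, hparts, hPd]
    linarith
  obtain ⟨ρ, hρ1, hρ2, hρ3, hρ4⟩ : ∃ ρ : ℝ → ℝ, ContDiff ℝ ∞ ρ ∧ HasCompactSupport ρ ∧
      tsupport ρ ⊆ Ioo 0 T ∧ ∫ x, ρ x = 1 := by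
    let b : ContDiffBump (T / 2) := ⟨T / 8, T / 4, by positivity, by linarith⟩
    refine ⟨b.normed volume, b.contDiff_normed, b.hasCompactSupport_normed, ?_, b.integral_normed⟩
    rw [b.tsupport_normed_eq, Real.closedBall_eq_Icc]
    exact Icc_subset_Ioo (by simp only [b]; linarith) (by simp only [b]; linarith)
  set k := ∫ t in (0)..T, D t * ρ t
  have hconst : ∀ ξ : ℝ → ℝ, ContDiff ℝ ∞ ξ → HasCompactSupport ξ → tsupport ξ ⊆ Ioo 0 T →
      ∫ x, ξ x • (D x - k) = 0 := by
    intro ξ h1 h2 h3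
    set κ := ∫ x, ξ x
    have hts : tsupport (fun x => ξ x - κ * ρ x) ⊆ Ioo 0 T := by
      refine (tsupport_sub _ _).trans (union_subset h3 ?_)
      exact (tsupport_mul_subset_right (f := fun _ => κ) (g := ρ)).trans hρ3
    -- Subtracting `κρ` makes the integral zero, so the difference is the derivative of an
    -- admissible test function.
    obtain ⟨χ, hχ1, hχ2, hχ3, hχ4⟩ := exists_primitive_test (T := T)
      (ξ := fun x => ξ x - κ * ρ x) (h1.sub (contDiff_const.mul hρ1))
      (h2.sub (hρ2.mul_left)) hts (by
        rw [integral_sub (h1.continuous.integrable_of_hasCompactSupport h2)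
          ((hρ1.continuous.integrable_of_hasCompactSupport hρ2).const_mul _),
          integral_const_mul, hρ4, mul_one, sub_self])
    have hw := hDweak χ hχ1 hχ2 hχ3
    rw [hχ4] at hw
    have hDξ : IntervalIntegrable (fun t => D t * ξ t) volume 0 T :=
      (ContinuousOn.mul (by rwa [uIcc_of_le hT.le]) h1.continuous.continuousOn).intervalIntegrable
    have hDρ : IntervalIntegrable (fun t => κ * (D t * ρ t)) volume 0 T :=
      ((ContinuousOn.mul (by rwa [uIcc_of_le hT.le])
        hρ1.continuous.continuousOn).intervalIntegrable).const_mul _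
    have e1 : ∫ t in (0)..T, D t * (ξ t - κ * ρ t) = (∫ t in (0)..T, D t * ξ t) - κ * k := by
      rw [← intervalIntegral.integral_const_mul, ← intervalIntegral.integral_sub hDξ hDρ]
      refine intervalIntegral.integral_congr fun t _ => ?_
      ring
    have hξT : ∫ t in (0)..T, ξ t = κ := by
      rw [← hIoo]
      exact setIntegral_eq_integral_of_forall_compl_eq_zero fun s hs =>
        image_eq_zero_of_notMem_tsupport fun h => hs (h3 h)
    calc ∫ x, ξ x • (D x - k) = ∫ x in Ioo 0 T, ξ x • (D x - k) := by
          refine (setIntegral_eq_integral_of_forall_compl_eq_zero fun s hs => ?_).symm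
          rw [image_eq_zero_of_notMem_tsupport fun h => hs (h3 h), zero_smul]
      _ = ∫ t in (0)..T, (D t * ξ t - k * ξ t) := by
          rw [hIoo]
          refine intervalIntegral.integral_congr fun t _ => ?_
          simp only [smul_eq_mul]
          ring
      _ = 0 := by
          rw [intervalIntegral.integral_sub hDξ
            ((h1.continuous.intervalIntegrable _ _).const_mul _),
            intervalIntegral.integral_const_mul, hξT]
          rw [e1] at hw
          linarith
  have hae := isOpen_Ioo.ae_eq_zero_of_integral_contDiff_smul_eq_zero (μ := volume)
    (f := fun x => D x - k)
    (((hDc.mono Ioo_subset_Icc_self).sub continuousOn_const).locallyIntegrableOn measurableSet_Ioo)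
    hconst
  -- Continuity upgrades equality almost everywhere to equality everywhere, including the endpoints
  -- `0` and `T`.
  have hDk : EqOn D (fun _ => k) (Icc 0 T) := by
    have h1 : D =ᵐ[volume.restrict (Icc 0 T)] fun _ => k := by
      rw [Measure.restrict_congr_set Ioo_ae_eq_Icc.symm, Filter.EventuallyEq,
        ae_restrict_iff' measurableSet_Ioo]
      filter_upwards [hae] with x hx hmem
      exact sub_eq_zero.1 (hx hmem)
    exact Measure.eqOn_Icc_of_ae_eq volume hT.ne h1 hDc continuousOn_const
  intro t ht
  have h1 := hDk ht
  have h2 := hDk (left_mem_Icc.2 hT.le)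
  simp only [hD, hP, intervalIntegral.integral_same] at h1 h2
  linarith

/-- Uniqueness of Fourier coefficients of integrable functions on the torus. -/
theorem ae_eq_zero_of_mFourier {d : ℕ} {u : Torus d → ℝ} (hu : Integrable u)
    (h : ∀ n : Fin d → ℤ, ∫ y, (u y : ℂ) * UnitAddTorus.mFourier n y = 0) : u =ᵐ[volume] 0 := by
  have huc : Integrable fun y => (u y : ℂ) := hu.ofReal
  have hint : ∀ E : C(Torus d, ℂ), Integrable fun y => (u y : ℂ) * E y := fun E =>
    huc.mul_bdd (c := ‖E‖) E.continuous.aestronglyMeasurable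
      (Eventually.of_forall fun y => E.norm_coe_le_norm y)
  let ℓ : C(Torus d, ℂ) →ₗ[ℂ] ℂ :=
    { toFun := fun E => ∫ y, (u y : ℂ) * E y
      map_add' := fun E F => by
        simp only [ContinuousMap.add_apply, mul_add]
        exact integral_add (hint E) (hint F)
      map_smul' := fun c E => by
        simp only [ContinuousMap.smul_apply, smul_eq_mul, RingHom.id_apply]
        rw [← integral_const_mul]
        refine integral_congr_ae (Eventually.of_forall fun y => ?_)
        simp only
        ring }
  let L : C(Torus d, ℂ) →L[ℂ] ℂ := ℓ.mkContinuous (∫ y, ‖(u y : ℂ)‖) fun E => by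
    calc ‖∫ y, (u y : ℂ) * E y‖ ≤ ∫ y, ‖(u y : ℂ)‖ * ‖E‖ := by
          refine norm_integral_le_of_norm_le (huc.norm.mul_const _) (Eventually.of_forall fun y => ?_)
          rw [norm_mul]
          gcongr
          exact E.norm_coe_le_norm y
      _ = _ := integral_mul_const _ _
  -- The kernel of a continuous functional is closed and here contains the characters, whose span is
  -- dense.
  have hker : (L : C(Torus d, ℂ) →ₗ[ℂ] ℂ).ker = ⊤ := by
    refine top_unique ?_
    rw [← UnitAddTorus.span_mFourier_closure_eq_top (d := Fin d)]
    refine Submodule.topologicalClosure_minimal _ (Submodule.span_le.2 ?_) L.isClosed_ker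
    rintro _ ⟨n, rfl⟩
    exact h n
  have hall : ∀ φ : BoundedContinuousFunction (Torus d) ℝ, ∫ y, u y * φ y = 0 := fun φ => by
    let E : C(Torus d, ℂ) := ⟨fun y => (φ y : ℂ), by fun_prop⟩
    have h1 : L E = 0 := by
      have : E ∈ (L : C(Torus d, ℂ) →ₗ[ℂ] ℂ).ker := by rw [hker]; trivial
      exact this
    have h2 : ∫ y, ((u y * φ y : ℝ) : ℂ) = 0 := by
      push_cast
      exact h1
    rw [integral_complex_ofReal] at h2
    exact_mod_cast h2
  have hum := hu.aestronglyMeasurable.aemeasurable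
  -- The positive and negative parts of `u` define finite measures with the same integrals of
  -- bounded continuous functions; they therefore coincide.
  set ν₁ := (volume : Measure (Torus d)).withDensity fun y => ENNReal.ofReal (u y)
  set ν₂ := (volume : Measure (Torus d)).withDensity fun y => ENNReal.ofReal (-u y)
  have : IsFiniteMeasure ν₁ := isFiniteMeasure_withDensity_ofReal hu.2
  have : IsFiniteMeasure ν₂ := isFiniteMeasure_withDensity_ofReal hu.neg.2
  have hν : ν₁ = ν₂ := by
    refine ext_of_forall_integral_eq_of_IsFiniteMeasure fun φ => ?_
    rw [integral_withDensity_eq_integral_toReal_smul₀ hum.ennreal_ofReal (by simp),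
      integral_withDensity_eq_integral_toReal_smul₀ (f := fun y => ENNReal.ofReal (-u y))
        hum.neg.ennreal_ofReal (by simp), ← sub_eq_zero,
      ← integral_sub]
    · rw [← hall φ]
      refine integral_congr_ae (Eventually.of_forall fun y => ?_)
      simp only [smul_eq_mul, ENNReal.toReal_ofReal', ← sub_mul]
      congr 1
      exact max_zero_sub_max_neg_zero_eq_self (u y)
    · refine Integrable.mul_bdd (c := ‖φ‖) ?_ φ.continuous.aestronglyMeasurable
        (Eventually.of_forall fun y => φ.norm_coe_le_norm y)
      simp only [ENNReal.toReal_ofReal']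
      exact hu.pos_part
    · refine Integrable.mul_bdd (c := ‖φ‖) ?_ φ.continuous.aestronglyMeasurable
        (Eventually.of_forall fun y => φ.norm_coe_le_norm y)
      simp only [ENNReal.toReal_ofReal']
      exact hu.neg_part
  refine hu.ae_eq_zero_of_forall_setIntegral_eq_zero fun s hs _ => ?_
  rw [integral_eq_lintegral_pos_part_sub_lintegral_neg_part hu.integrableOn,
    ← withDensity_apply _ hs, ← withDensity_apply _ hs]
  exact sub_eq_zero.2 (by rw [show (volume : Measure (Torus d)).withDensity _ = _ from hν])

/-- For each character, varying `η` makes the partial Fourier coefficient vanish for almost every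
`v`. The characters are countable, so uniqueness on the torus applies for almost every `v`. Real and
imaginary parts are separate because the test functions are real. -/
theorem ae_eq_zero_of_test {d : ℕ} {F : Torus d × Vel d → ℝ} (hF : Integrable F)
    (hre : ∀ (n : Fin d → ℤ) (η : Vel d → ℝ), ContDiff ℝ ∞ η → HasCompactSupport η →
      ∫ p : Torus d × Vel d, F p * ((UnitAddTorus.mFourier n p.1).re * η p.2) = 0)
    (him : ∀ (n : Fin d → ℤ) (η : Vel d → ℝ), ContDiff ℝ ∞ η → HasCompactSupport η →
      ∫ p : Torus d × Vel d, F p * ((UnitAddTorus.mFourier n p.1).im * η p.2) = 0) :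
    F =ᵐ[volume] 0 := by
  have hEc : ∀ n : Fin d → ℤ, Continuous fun p : Torus d × Vel d => UnitAddTorus.mFourier n p.1 :=
    fun n => (UnitAddTorus.mFourier n).continuous.comp continuous_fst
  have hEb : ∀ (n : Fin d → ℤ) (y : Torus d), ‖UnitAddTorus.mFourier n y‖ ≤ 1 := fun n y =>
    ((UnitAddTorus.mFourier n).norm_coe_le_norm y).trans_eq UnitAddTorus.mFourier_norm
  have hFn : ∀ n : Fin d → ℤ, Integrable
      (fun p : Torus d × Vel d => (F p : ℂ) * UnitAddTorus.mFourier n p.1) := fun n =>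
    hF.ofReal.mul_bdd (c := 1) (hEc n).aestronglyMeasurable (Eventually.of_forall fun p => hEb n p.1)
  have hG : ∀ n : Fin d → ℤ, ∀ᵐ v : Vel d,
      ∫ y : Torus d, (F (y, v) : ℂ) * UnitAddTorus.mFourier n y = 0 := fun n => by
    have hFn' := hFn n
    rw [Measure.volume_eq_prod] at hFn'
    refine ae_eq_zero_of_integral_contDiff_smul_eq_zero hFn'.integral_prod_right.locallyIntegrable
      fun η h1 h2 => ?_
    obtain ⟨C, hC⟩ := h2.exists_bound_of_continuous h1.continuous
    have hint : Integrable (fun p : Torus d × Vel d =>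
        η p.2 • ((F p : ℂ) * UnitAddTorus.mFourier n p.1)) (volume.prod volume) :=
      hFn'.bdd_smul C (h1.continuous.comp continuous_snd).aestronglyMeasurable
        (Eventually.of_forall fun p => hC p.2)
    have h3 : ∫ p : Torus d × Vel d, η p.2 • ((F p : ℂ) * UnitAddTorus.mFourier n p.1) = 0 := by
      refine Complex.ext ?_ ?_
      · refine (integral_re hint).symm.trans (Eq.trans ?_ (hre n η h1 h2))
        refine integral_congr_ae (Eventually.of_forall fun p => ?_)
        simp
        ring
      · refine (integral_im hint).symm.trans (Eq.trans ?_ (him n η h1 h2))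
        refine integral_congr_ae (Eventually.of_forall fun p => ?_)
        simp
        ring
    rw [Measure.volume_eq_prod, integral_prod_symm _ hint] at h3
    rw [← h3]
    refine integral_congr_ae (Eventually.of_forall fun v => ?_)
    exact (integral_smul _ _).symm
  rw [Measure.volume_eq_prod] at hF ⊢
  have h1 : ∀ᵐ v : Vel d, ∀ᵐ y : Torus d, F (y, v) = 0 := by
    filter_upwards [ae_all_iff.2 hG, hF.prod_left_ae] with v hv hvi
    exact ae_eq_zero_of_mFourier hvi hv
  have h2 : AEStronglyMeasurable F (volume.prod volume) := hF.aestronglyMeasurable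
  have hswap : ∫⁻ p : Torus d × Vel d, ‖F p‖ₑ ∂(volume.prod volume) = 0 := by
    rw [lintegral_prod_symm _ h2.enorm, lintegral_eq_zero_iff' h2.enorm.lintegral_prod_left']
    filter_upwards [h1] with v hv
    rw [Pi.zero_apply]
    refine (lintegral_congr_ae ?_).trans lintegral_zero
    filter_upwards [hv] with y hy
    simp [hy]
  rw [lintegral_eq_zero_iff' h2.enorm] at hswap
  filter_upwards [hswap] with p hp
  simpa using hp

/-! ### From the renormalized equation to its integrated form -/

section Renormalized

variable {d : ℕ} {β T : ℝ} {h : ℝ → ℝ} {f : ℝ → Torus d → Vel d → ℝ} {E : Torus d → ℝ}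
  {η : Vel d → ℝ}

theorem move_neg_move (t : ℝ) (x : Torus d) (v : Vel d) : move (-t) (move t x v) v = x := by
  rw [← move_add, add_neg_cancel, move_zero]

/-- The factor `E(x - tv) η(v)` is constant along characteristics, so the transport derivative falls
on `χ(t)` alone and the equation becomes a weak ordinary differential equation in `t`. -/
theorem isTest_transported {χ : ℝ → ℝ} (hE : ContDiff ℝ ∞ fun y : Fin d → ℝ => E fun i => (y i : UnitAddCircle))
    (hη : ContDiff ℝ ∞ η) (hηc : HasCompactSupport η) (hχ : ContDiff ℝ ∞ χ)
    (hχc : HasCompactSupport χ) (hχT : tsupport χ ⊆ Ioo 0 T) :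
    IsTest T fun z : ℝ × Torus d × Vel d => χ z.1 * (E (move (-z.1) z.2.1 z.2.2) * η z.2.2) where
  smooth := by
    have h1 : (fun q : ℝ × (Fin d → ℝ) × Vel d =>
        E (move (-q.1) (fun i => ((q.2.1 i : ℝ) : UnitAddCircle)) q.2.2)) =
        (fun y : Fin d → ℝ => E fun i => (y i : UnitAddCircle)) ∘
          fun q : ℝ × (Fin d → ℝ) × Vel d => fun i => q.2.1 i - q.1 * q.2.2 i := by
      funext q
      refine congrArg E (funext fun i => ?_)
      change ((q.2.1 i : ℝ) : UnitAddCircle) + ((-q.1 * q.2.2 i : ℝ) : UnitAddCircle) =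
        ((q.2.1 i - q.1 * q.2.2 i : ℝ) : UnitAddCircle)
      rw [← AddCircle.coe_add, neg_mul, sub_eq_add_neg]
    have h2 : ContDiff ℝ ∞ fun q : ℝ × (Fin d → ℝ) × Vel d =>
        fun i => q.2.1 i - q.1 * q.2.2 i := by
      fun_prop
    have h3 := hE.comp h2
    rw [← h1] at h3
    have h4 : ContDiff ℝ ∞ fun q : ℝ × (Fin d → ℝ) × Vel d => η q.2.2 :=
      hη.comp (contDiff_snd.comp contDiff_snd)
    have h5 : ContDiff ℝ ∞ fun q : ℝ × (Fin d → ℝ) × Vel d => χ q.1 := hχ.comp contDiff_fst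
    exact h5.mul (h3.mul h4)
  compact := by
    refine HasCompactSupport.intro (K := tsupport χ ×ˢ (univ ×ˢ tsupport η))
      (hχc.isCompact.prod (isCompact_univ.prod hηc.isCompact)) fun z hz => ?_
    by_cases h1 : z.1 ∈ tsupport χ
    · have h2 : z.2.2 ∉ tsupport η := fun h2 => hz ⟨h1, mem_univ _, h2⟩
      simp [image_eq_zero_of_notMem_tsupport h2]
    · simp [image_eq_zero_of_notMem_tsupport h1]
  support := by
    refine (closure_minimal (t := tsupport χ ×ˢ univ) (fun z hz => ⟨?_, mem_univ _⟩)
      ((isClosed_tsupport χ).prod isClosed_univ)).trans (prod_mono hχT subset_rfl)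
    by_contra h1
    refine hz ?_
    simp [image_eq_zero_of_notMem_tsupport h1]

theorem transport_transported {χ : ℝ → ℝ} (z : ℝ × Torus d × Vel d) :
    transport (fun z : ℝ × Torus d × Vel d => χ z.1 * (E (move (-z.1) z.2.1 z.2.2) * η z.2.2)) z =
      deriv χ z.1 * (E (move (-z.1) z.2.1 z.2.2) * η z.2.2) := by
  unfold transport
  have : ∀ s, move (-(z.1 + s)) (move s z.2.1 z.2.2) z.2.2 = move (-z.1) z.2.1 z.2.2 := fun s => by
    rw [← move_add]
    congr 1
    ring
  simp only [this]
  rw [deriv_mul_const_field, deriv_comp_const_add, add_zero]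

theorem setIntegral_flow {F : ℝ × Torus d × Vel d → ℝ}
    (hF : Integrable F ((volume.restrict (Ioo 0 T)).prod volume)) :
    ∫ z in Ioo 0 T ×ˢ (univ : Set (Torus d × Vel d)), F z =
      ∫ t in Ioo 0 T, ∫ p : Torus d × Vel d, F (t, move t p.1 p.2, p.2) := by
  have hm := measurePreserving_flow (d := d) (volume.restrict (Ioo 0 T))
  have h1 : (volume : Measure (ℝ × Torus d × Vel d)).restrict (Ioo 0 T ×ˢ univ) =
      (volume.restrict (Ioo 0 T)).prod volume := by
    rw [Measure.volume_eq_prod, ← Measure.prod_restrict, Measure.restrict_univ]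
  rw [h1]
  have h2 := integral_map hm.measurable.aemeasurable (f := F)
    (by rw [hm.map_eq]; exact hF.aestronglyMeasurable)
  rw [hm.map_eq] at h2
  have h3 : Integrable (fun z : ℝ × Torus d × Vel d => F (z.1, move z.1 z.2.1 z.2.2, z.2.2))
      ((volume.restrict (Ioo 0 T)).prod volume) :=
    (hm.integrable_comp hF.aestronglyMeasurable).2 hF
  rw [h2, integral_prod _ h3]

theorem abs_log_one_add_sub_le {a b : ℝ} (ha : 0 ≤ a) (hb : 0 ≤ b) :
    |Real.log (1 + a) - Real.log (1 + b)| ≤ |a - b| := by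
  wlog hab : b ≤ a generalizing a b
  · rw [abs_sub_comm, abs_sub_comm a b]
    exact this hb ha (le_of_not_ge hab)
  have h1 : Real.log (1 + b) ≤ Real.log (1 + a) := Real.log_le_log (by positivity) (by linarith)
  rw [abs_of_nonneg (sub_nonneg.2 h1), abs_of_nonneg (sub_nonneg.2 hab),
    ← Real.log_div (by positivity) (by positivity)]
  refine (Real.log_le_sub_one_of_pos (by positivity)).trans ?_
  have : (1 + a) / (1 + b) - 1 = (a - b) / (1 + b) := by field_simp; ring
  rw [this]
  exact div_le_self (sub_nonneg.2 hab) (by linarith)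

theorem IsNonnegL1Curve.integrable_log (hf : IsNonnegL1Curve T f) {t : ℝ} (ht : t ∈ Icc 0 T) :
    Integrable fun p : Torus d × Vel d => Real.log (1 + f t p.1 p.2) := by
  have hm : Measurable fun p : Torus d × Vel d => f t p.1 p.2 :=
    hf.measurable.comp (f := fun p : Torus d × Vel d => (t, p.1, p.2)) (by fun_prop)
  refine (hf.integrable t ht).mono
    (Real.measurable_log.comp (hm.const_add 1)).aestronglyMeasurable (Eventually.of_forall fun p => ?_)
  simpa using abs_log_one_add_sub_le (hf.nonneg t ht p.1 p.2) le_rfl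

/-- Continuity in time of the transported pairings. -/
theorem IsNonnegL1Curve.continuousOn_pairing (hf : IsNonnegL1Curve T f) (hE : Continuous E)
    (hη : Continuous η) {C : ℝ} (hC : ∀ x v, |E x * η v| ≤ C) :
    ContinuousOn (fun t => ∫ p : Torus d × Vel d,
      Real.log (1 + f t (move t p.1 p.2) p.2) * (E p.1 * η p.2)) (Icc 0 T) := by
  have hfm : ∀ t, Measurable fun p : Torus d × Vel d => f t p.1 p.2 := fun t =>
    hf.measurable.comp (f := fun p : Torus d × Vel d => (t, p.1, p.2)) (by fun_prop)
  -- The flow is moved from `f`, which is continuous in time only in `L¹`, onto the continuous test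
  -- function.
  set w : ℝ → Torus d × Vel d → ℝ := fun t p => E (move (-t) p.1 p.2) * η p.2 with hw
  have hmove : ∀ t : ℝ, Continuous fun p : Torus d × Vel d => move (-t) p.1 p.2 := fun t =>
    continuous_move.comp (f := fun p : Torus d × Vel d => (-t, p.1, p.2)) (by fun_prop)
  have hwc : ∀ t, Continuous (w t) := fun t => (hE.comp (hmove t)).mul (hη.comp continuous_snd)
  have hwt : ∀ p, Continuous fun t => w t p := fun p =>
    (hE.comp (continuous_move.comp (f := fun t : ℝ => (-t, p.1, p.2)) (by fun_prop))).mul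
      continuous_const
  have hwb : ∀ t p, ‖w t p‖ ≤ C := fun t p => hC _ _
  have hA : ∀ t, ∫ p : Torus d × Vel d, Real.log (1 + f t (move t p.1 p.2) p.2) * (E p.1 * η p.2) =
      ∫ p : Torus d × Vel d, Real.log (1 + f t p.1 p.2) * w t p := fun t => by
    have hm := measurePreserving_move (d := d) t
    have h2 := integral_map (μ := volume) hm.measurable.aemeasurable
      (f := fun p : Torus d × Vel d => Real.log (1 + f t p.1 p.2) * w t p)
      (Measurable.aestronglyMeasurable
        ((Real.measurable_log.comp ((hfm t).const_add 1)).mul (hwc t).measurable))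
    rw [hm.map_eq] at h2
    rw [h2]
    simp only [hw, move_neg_move]
  simp only [hA]
  intro t ht
  have hlogt := hf.integrable_log ht
  have t1 : Tendsto (fun s => ∫ p : Torus d × Vel d, Real.log (1 + f t p.1 p.2) * w s p)
      (𝓝[Icc 0 T] t) (𝓝 (∫ p : Torus d × Vel d, Real.log (1 + f t p.1 p.2) * w t p)) := by
    refine tendsto_integral_filter_of_dominated_convergence
      (fun p => |Real.log (1 + f t p.1 p.2)| * C) ?_ ?_ (hlogt.abs.mul_const C) ?_
    · exact Eventually.of_forall fun s =>
        hlogt.aestronglyMeasurable.mul (hwc s).aestronglyMeasurable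
    · refine Eventually.of_forall fun s => Eventually.of_forall fun p => ?_
      rw [norm_mul, Real.norm_eq_abs]
      gcongr
      exact hwb s p
    · exact Eventually.of_forall fun p =>
        ((hwt p).tendsto t |>.mono_left nhdsWithin_le_nhds).const_mul _
  -- `log (1 + ·)` is 1-Lipschitz on `[0, ∞)`, so this difference is bounded by the `L¹` distance of
  -- the two time slices.
  have t2 : Tendsto (fun s => ∫ p : Torus d × Vel d,
      (Real.log (1 + f s p.1 p.2) - Real.log (1 + f t p.1 p.2)) * w s p) (𝓝[Icc 0 T] t) (𝓝 0) := by
    have h0 := hf.continuous t ht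
    have h1 := ((ENNReal.tendsto_toReal ENNReal.zero_ne_top).comp h0).mul_const C
    simp only [ENNReal.toReal_zero, zero_mul] at h1
    refine squeeze_zero_norm' ?_ h1
    filter_upwards [self_mem_nhdsWithin] with s hs
    have hi : Integrable fun p : Torus d × Vel d => f s p.1 p.2 - f t p.1 p.2 :=
      (hf.integrable s hs).sub (hf.integrable t ht)
    calc _ ≤ ∫ p : Torus d × Vel d, ‖f s p.1 p.2 - f t p.1 p.2‖ * C := by
          refine norm_integral_le_of_norm_le (hi.norm.mul_const C) (Eventually.of_forall fun p => ?_)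
          rw [norm_mul]
          have := abs_log_one_add_sub_le (hf.nonneg s hs p.1 p.2) (hf.nonneg t ht p.1 p.2)
          exact mul_le_mul this (hwb s p) (norm_nonneg _) (norm_nonneg _)
      _ = _ := by
          rw [integral_mul_const, integral_norm_eq_lintegral_enorm hi.aestronglyMeasurable,
            Function.comp, eLpNorm_one_eq_lintegral_enorm]
  have t3 := t2.add t1
  rw [zero_add] at t3
  refine t3.congr' ?_
  filter_upwards [self_mem_nhdsWithin] with s hs
  have hlogs := hf.integrable_log hs
  have i1 : Integrable fun p : Torus d × Vel d =>
      (Real.log (1 + f s p.1 p.2) - Real.log (1 + f t p.1 p.2)) * w s p :=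
    (hlogs.sub hlogt).mul_bdd (c := C) (hwc s).aestronglyMeasurable
      (Eventually.of_forall fun p => hwb s p)
  have i2 : Integrable fun p : Torus d × Vel d => Real.log (1 + f t p.1 p.2) * w s p :=
    hlogt.mul_bdd (c := C) (hwc s).aestronglyMeasurable (Eventually.of_forall fun p => hwb s p)
  rw [← integral_add i1 i2]
  refine integral_congr_ae (Eventually.of_forall fun p => ?_)
  simp only
  ring

/-- The renormalized equation tested against functions that are constant along characteristics. -/
theorem IsRenormalizedSolution.pairing (hT : 0 < T) (hf : IsNonnegL1Curve T f)
    (hR : IsRenormalizedSolution β h T f)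
    (hfint : Integrable (fun z : ℝ × Torus d × Vel d => f z.1 z.2.1 z.2.2)
      ((volume.restrict (Ioc 0 T)).prod volume))
    (hcint : Integrable (fun z : ℝ × Torus d × Vel d => collision β h (f z.1 z.2.1) z.2.2)
      ((volume.restrict (Ioc 0 T)).prod volume))
    (hE : ContDiff ℝ ∞ fun y : Fin d → ℝ => E fun i => (y i : UnitAddCircle)) (hEc : Continuous E)
    (hη : ContDiff ℝ ∞ η) (hηc : HasCompactSupport η) :
    ∀ t ∈ Icc 0 T, ∫ p : Torus d × Vel d, (Real.log (1 + f t (move t p.1 p.2) p.2) -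
      Real.log (1 + f 0 p.1 p.2) - ∫ s in (0)..t, collision β h (f s (move s p.1 p.2)) p.2 *
        (1 + f s (move s p.1 p.2) p.2)⁻¹) * (E p.1 * η p.2) = 0 := by
  obtain ⟨C₁, hC₁⟩ := hηc.exists_bound_of_continuous hη.continuous
  obtain ⟨C₂, hC₂⟩ := (isCompact_range hEc).isBounded.exists_norm_le
  have hC : ∀ x v, |E x * η v| ≤ C₂ * C₁ := fun x v => by
    rw [abs_mul]
    have h1 : |E x| ≤ C₂ := hC₂ _ (mem_range_self x)
    exact mul_le_mul h1 (hC₁ v) (abs_nonneg _) ((abs_nonneg _).trans h1)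
  have hIoo : (volume.restrict (Ioo 0 T) : Measure ℝ) = volume.restrict (Ioc 0 T) :=
    Measure.restrict_congr_set Ioo_ae_eq_Ioc
  have hflow := measurePreserving_flow (d := d) (volume.restrict (Ioc 0 T))
  have hmemT : ∀ᵐ z : ℝ × Torus d × Vel d ∂((volume.restrict (Ioc 0 T)).prod volume),
      z.1 ∈ Icc 0 T := by
    have h1 : ∀ᵐ s ∂(volume.restrict (Ioc 0 T)), s ∈ Icc 0 T := by
      filter_upwards [ae_restrict_mem measurableSet_Ioc] with s hs
      exact ⟨hs.1.le, hs.2⟩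
    exact Measure.quasiMeasurePreserving_fst.ae h1
  have hfm := hf.measurable
  have hlogint : Integrable (fun z : ℝ × Torus d × Vel d => Real.log (1 + f z.1 z.2.1 z.2.2))
      ((volume.restrict (Ioc 0 T)).prod volume) := by
    refine hfint.mono (Real.measurable_log.comp (hfm.const_add 1)).aestronglyMeasurable ?_
    filter_upwards [hmemT] with z hz
    simpa using abs_log_one_add_sub_le (hf.nonneg z.1 hz z.2.1 z.2.2) le_rfl
  have hrint : Integrable (fun z : ℝ × Torus d × Vel d => collision β h (f z.1 z.2.1) z.2.2 *
      (1 + f z.1 z.2.1 z.2.2)⁻¹) ((volume.restrict (Ioc 0 T)).prod volume) := by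
    refine hcint.mul_bdd (c := 1) (by fun_prop) ?_
    filter_upwards [hmemT] with z hz
    have := hf.nonneg z.1 hz z.2.1 z.2.2
    rw [Real.norm_of_nonneg (by positivity)]
    exact inv_le_one_of_one_le₀ (by linarith)
  have hr'int : Integrable (fun z : ℝ × Torus d × Vel d =>
      collision β h (f z.1 (move z.1 z.2.1 z.2.2)) z.2.2 *
      (1 + f z.1 (move z.1 z.2.1 z.2.2) z.2.2)⁻¹) ((volume.restrict (Ioc 0 T)).prod volume) :=
    (hflow.integrable_comp hrint.aestronglyMeasurable).2 hrint
  have hw : Continuous fun z : ℝ × Torus d × Vel d => E (move (-z.1) z.2.1 z.2.2) * η z.2.2 :=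
    (hEc.comp (continuous_move.comp
      (f := fun z : ℝ × Torus d × Vel d => (-z.1, z.2.1, z.2.2)) (by fun_prop))).mul
      (hη.continuous.comp (by fun_prop))
  have hw0 : Continuous fun p : Torus d × Vel d => E p.1 * η p.2 :=
    (hEc.comp continuous_fst).mul (hη.continuous.comp continuous_snd)
  have hr'w : Integrable (fun z : ℝ × Torus d × Vel d =>
      (collision β h (f z.1 (move z.1 z.2.1 z.2.2)) z.2.2 *
      (1 + f z.1 (move z.1 z.2.1 z.2.2) z.2.2)⁻¹) * (E z.2.1 * η z.2.2))
      ((volume.restrict (Ioc 0 T)).prod volume) :=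
    hr'int.mul_bdd (c := C₂ * C₁) (hw0.comp continuous_snd).aestronglyMeasurable
      (Eventually.of_forall fun z => hC _ _)
  set A : ℝ → ℝ := fun t => ∫ p : Torus d × Vel d,
      Real.log (1 + f t (move t p.1 p.2) p.2) * (E p.1 * η p.2) with hA
  set B : ℝ → ℝ := fun s => ∫ p : Torus d × Vel d, (collision β h (f s (move s p.1 p.2)) p.2 *
        (1 + f s (move s p.1 p.2) p.2)⁻¹) * (E p.1 * η p.2) with hB
  have hAc : ContinuousOn A (Icc 0 T) := hf.continuousOn_pairing hEc hη.continuous hC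
  have hBi : IntervalIntegrable B volume 0 T :=
    (intervalIntegrable_iff_integrableOn_Ioc_of_le hT.le).2 hr'w.integral_prod_left
  have hweak : ∀ χ : ℝ → ℝ, ContDiff ℝ ∞ χ → HasCompactSupport χ → tsupport χ ⊆ Ioo 0 T →
      -∫ t in Ioo 0 T, A t * deriv χ t = ∫ t in Ioo 0 T, B t * χ t := by
    intro χ h1 h2 h3
    have hχd : Continuous (deriv χ) := h1.continuous_deriv (by simp)
    obtain ⟨D₁, hD₁⟩ := h2.exists_bound_of_continuous h1.continuous
    obtain ⟨D₂, hD₂⟩ := h2.deriv.exists_bound_of_continuous hχd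
    have heq := hR.equation _ (isTest_transported hE hη hηc h1 h2 h3)
    simp only [transport_transported] at heq
    rw [setIntegral_flow, setIntegral_flow] at heq
    -- In coordinates following the flow, `E` is evaluated at the starting point and no longer
    -- depends on `t`.
    · simp only [move_neg_move] at heq
      have e1 : ∀ t, ∫ p : Torus d × Vel d, Real.log (1 + f t (move t p.1 p.2) p.2) *
          (deriv χ t * (E p.1 * η p.2)) = A t * deriv χ t := fun t => by
        rw [hA, ← integral_mul_const]
        refine integral_congr_ae (Eventually.of_forall fun p => ?_)
        simp only
        ring
      have e2 : ∀ t, ∫ p : Torus d × Vel d, collision β h (f t (move t p.1 p.2)) p.2 /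
          (1 + f t (move t p.1 p.2) p.2) * (χ t * (E p.1 * η p.2)) = B t * χ t := fun t => by
        rw [hB, ← integral_mul_const]
        refine integral_congr_ae (Eventually.of_forall fun p => ?_)
        simp only [div_eq_mul_inv]
        ring
      simp only [e1, e2] at heq
      exact heq
    · rw [hIoo]
      simp only [div_eq_mul_inv]
      refine hrint.mul_bdd (c := D₁ * (C₂ * C₁))
        ((h1.continuous.comp continuous_fst).mul hw).aestronglyMeasurable
        (Eventually.of_forall fun z => ?_)
      rw [norm_mul]
      exact mul_le_mul (hD₁ _) (hC _ _) (norm_nonneg _) ((norm_nonneg _).trans (hD₁ z.1))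
    · rw [hIoo]
      refine hlogint.mul_bdd (c := D₂ * (C₂ * C₁))
        ((hχd.comp continuous_fst).mul hw).aestronglyMeasurable
        (Eventually.of_forall fun z => ?_)
      rw [norm_mul]
      exact mul_le_mul (hD₂ _) (hC _ _) (norm_nonneg _) ((norm_nonneg _).trans (hD₂ z.1))
  have hmain := integrated_of_weak hT hAc hBi hweak
  intro t ht
  have hlog : ∀ s ∈ Icc 0 T, Integrable fun p : Torus d × Vel d =>
      Real.log (1 + f s (move s p.1 p.2) p.2) * (E p.1 * η p.2) := fun s hs => by
    have h1 := hf.integrable_log hs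
    have h2 := ((measurePreserving_move (d := d) s).integrable_comp h1.aestronglyMeasurable).2 h1
    exact h2.mul_bdd (c := C₂ * C₁) hw0.aestronglyMeasurable (Eventually.of_forall fun z => hC _ _)
  have hac : (volume.restrict (Ioc 0 t)).prod (volume : Measure (Torus d × Vel d)) ≤
      (volume.restrict (Ioc 0 T)).prod volume :=
    Measure.prod_mono (Measure.restrict_mono (Ioc_subset_Ioc_right ht.2) le_rfl) le_rfl
  have hBt := hr'w.mono_measure hac
  have hBswap : ∫ s in (0)..t, B s = ∫ p : Torus d × Vel d,
      (∫ s in (0)..t, collision β h (f s (move s p.1 p.2)) p.2 *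
        (1 + f s (move s p.1 p.2) p.2)⁻¹) * (E p.1 * η p.2) := by
    rw [intervalIntegral.integral_of_le ht.1, hB]
    rw [integral_integral_swap hBt]
    refine integral_congr_ae (Eventually.of_forall fun p => ?_)
    simp only
    rw [intervalIntegral.integral_of_le ht.1, integral_mul_const]
  have hI : Integrable fun p : Torus d × Vel d =>
      (∫ s in (0)..t, collision β h (f s (move s p.1 p.2)) p.2 *
        (1 + f s (move s p.1 p.2) p.2)⁻¹) * (E p.1 * η p.2) := by
    have := hBt.integral_prod_right
    refine this.congr (Eventually.of_forall fun p => ?_)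
    simp only
    rw [intervalIntegral.integral_of_le ht.1, integral_mul_const]
  have hm := hmain t ht
  rw [hBswap] at hm
  have h0 := hlog 0 (left_mem_Icc.2 hT.le)
  have ht' := hlog t ht
  simp only [move_zero] at h0
  simp only [sub_mul]
  have h5 : Integrable fun p : Torus d × Vel d =>
      Real.log (1 + f t (move t p.1 p.2) p.2) * (E p.1 * η p.2) -
        Real.log (1 + f 0 p.1 p.2) * (E p.1 * η p.2) := ht'.sub h0
  rw [integral_sub h5 hI, integral_sub ht' h0]
  simp only [hA, move_zero] at hm
  linarith

theorem contDiff_mFourier_lift (n : Fin d → ℤ) :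
    ContDiff ℝ ∞ fun y : Fin d → ℝ => UnitAddTorus.mFourier n fun i => (y i : UnitAddCircle) := by
  have : (fun y : Fin d → ℝ => UnitAddTorus.mFourier n fun i => (y i : UnitAddCircle)) =
      fun y : Fin d → ℝ => ∏ i, Complex.exp (2 * Real.pi * Complex.I * n i * (y i : ℂ)) := by
    ext y
    simp only [UnitAddTorus.mFourier, ContinuousMap.coe_mk, fourier_coe_apply]
    refine Finset.prod_congr rfl fun i _ => ?_
    simp
  rw [this]
  refine contDiff_prod fun i _ => ContDiff.cexp (contDiff_const.mul ?_)
  exact Complex.ofRealCLM.contDiff.comp (contDiff_apply ℝ ℝ i)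

/-- A renormalized solution with integrable collision term satisfies the renormalized equation in
integrated form along almost every characteristic. -/
theorem IsRenormalizedSolution.integrated (hT : 0 < T) (hf : IsNonnegL1Curve T f)
    (hR : IsRenormalizedSolution β h T f)
    (hfint : Integrable (fun z : ℝ × Torus d × Vel d => f z.1 z.2.1 z.2.2)
      ((volume.restrict (Ioc 0 T)).prod volume))
    (hcint : Integrable (fun z : ℝ × Torus d × Vel d => collision β h (f z.1 z.2.1) z.2.2)
      ((volume.restrict (Ioc 0 T)).prod volume)) :
    ∀ t ∈ Icc 0 T, ∀ᵐ p : Torus d × Vel d, Real.log (1 + f t (move t p.1 p.2) p.2) -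
      Real.log (1 + f 0 p.1 p.2) = ∫ s in (0)..t, collision β h (f s (move s p.1 p.2)) p.2 *
        (1 + f s (move s p.1 p.2) p.2)⁻¹ := by
  intro t ht
  have hflow := measurePreserving_flow (d := d) (volume.restrict (Ioc 0 T))
  have hfm := hf.measurable
  have hcint' : Integrable (fun z : ℝ × Torus d × Vel d =>
      collision β h (f z.1 (move z.1 z.2.1 z.2.2)) z.2.2 *
      (1 + f z.1 (move z.1 z.2.1 z.2.2) z.2.2)⁻¹) ((volume.restrict (Ioc 0 T)).prod volume) := by
    refine ((hflow.integrable_comp hcint.aestronglyMeasurable).2 hcint).mul_bdd (c := 1) ?_ ?_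
    · have := hfm.comp hflow.measurable
      exact ((this.const_add 1).inv).aestronglyMeasurable
    · have h1 : ∀ᵐ s ∂(volume.restrict (Ioc 0 T)), s ∈ Icc 0 T := by
        filter_upwards [ae_restrict_mem measurableSet_Ioc] with s hs
        exact ⟨hs.1.le, hs.2⟩
      filter_upwards [Measure.quasiMeasurePreserving_fst.ae h1] with z hz
      have := hf.nonneg z.1 hz (move z.1 z.2.1 z.2.2) z.2.2
      rw [Real.norm_of_nonneg (by positivity)]
      exact inv_le_one_of_one_le₀ (by linarith)
  have hac : (volume.restrict (Ioc 0 t)).prod (volume : Measure (Torus d × Vel d)) ≤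
      (volume.restrict (Ioc 0 T)).prod volume :=
    Measure.prod_mono (Measure.restrict_mono (Ioc_subset_Ioc_right ht.2) le_rfl) le_rfl
  have h1 := hf.integrable_log ht
  have h2 := ((measurePreserving_move (d := d) t).integrable_comp h1.aestronglyMeasurable).2 h1
  have h3 := hf.integrable_log (left_mem_Icc.2 hT.le)
  have h4 : Integrable fun p : Torus d × Vel d => ∫ s in (0)..t,
      collision β h (f s (move s p.1 p.2)) p.2 * (1 + f s (move s p.1 p.2) p.2)⁻¹ := by
    refine (hcint'.mono_measure hac).integral_prod_right.congr (Eventually.of_forall fun p => ?_)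
    simp only
    rw [intervalIntegral.integral_of_le ht.1]
  -- With `t` fixed, the pairings against all characters times bumps in `v` vanish, which determines
  -- the defect for almost every starting point.
  have hzero := ae_eq_zero_of_test ((h2.sub h3).sub h4)
    (fun n η hη hηc => hR.pairing hT hf hfint hcint
      (E := fun x => (UnitAddTorus.mFourier n x).re)
      (Complex.reCLM.contDiff.comp (contDiff_mFourier_lift n))
      (Complex.continuous_re.comp (UnitAddTorus.mFourier n).continuous) hη hηc t ht)
    (fun n η hη hηc => hR.pairing hT hf hfint hcint
      (E := fun x => (UnitAddTorus.mFourier n x).im)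
      (Complex.imCLM.contDiff.comp (contDiff_mFourier_lift n))
      (Complex.continuous_im.comp (UnitAddTorus.mFourier n).continuous) hη hηc t ht)
  filter_upwards [hzero] with p hp
  exact sub_eq_zero.1 hp

end Renormalized

/-! ### Moment bounds from the hypotheses and the choice of the constant -/

section Bounds

variable {d : ℕ} {β T : ℝ} {h : ℝ → ℝ} {f : ℝ → Torus d → Vel d → ℝ}

theorem measurable_maxwellian (a c : ℝ) : Measurable (maxwellian a c : Vel d → ℝ) := by
  unfold maxwellian
  fun_prop

theorem hasMoments_ofReal {ρ a c C : ℝ} {F : Vel d → ℝ} (hF : Measurable F)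
    (hmass : ENNReal.ofReal ρ ≤ ∫⁻ v, ENNReal.ofReal (F v))
    (hmoment : ∫⁻ v, ENNReal.ofReal (F v / maxwellian a c v) ≤ ENNReal.ofReal C) :
    HasMoments ρ a c C fun v => ENNReal.ofReal (F v) where
  measurable := hF.ennreal_ofReal
  mass := hmass
  moment := by
    refine le_of_eq_of_le (lintegral_congr fun v => ?_) hmoment
    rw [← ENNReal.ofReal_mul' (Real.exp_pos _).le, maxwellian, div_eq_mul_inv, ← Real.exp_neg]
    congr 3
    ring

theorem HasMoments.lintegral_le {ρ a c C : ℝ} (ha : 0 ≤ a) {P : Vel d → ℝ≥0∞}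
    (hP : HasMoments ρ a c C P) : ∫⁻ v, P v ≤ ENNReal.ofReal (Real.exp c) * ENNReal.ofReal C := by
  have := hP.lintegral_mul_le (K := fun _ => 1) (κ := ENNReal.ofReal (Real.exp c))
    MeasurableSet.univ fun w _ => by
      rw [mul_one]
      have : 0 ≤ a * ‖w‖ ^ 2 := by positivity
      exact ENNReal.ofReal_le_ofReal (Real.exp_le_exp.2 (by linarith))
  simpa only [Measure.restrict_univ, mul_one] using this

theorem ae_le_of_eLpNorm_top_le {F : Vel d → ℝ} {C : ℝ} (hF : eLpNorm F ⊤ volume ≤ ENNReal.ofReal C) :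
    ∀ᵐ v, F v ≤ max C 0 := by
  rw [eLpNorm_exponent_top] at hF
  filter_upwards [ae_le_eLpNormEssSup (f := F) (μ := volume)] with v hv
  have h1 : ENNReal.ofReal ‖F v‖ ≤ ENNReal.ofReal (max C 0) := by
    rw [ofReal_norm]
    exact (hv.trans hF).trans (ENNReal.ofReal_le_ofReal (le_max_left _ _))
  exact (le_abs_self _).trans ((ENNReal.ofReal_le_ofReal_iff (le_max_right _ _)).1 h1)

theorem IsNonnegL1Curve.measurable_slice (hf : IsNonnegL1Curve T f) (t : ℝ) (x : Torus d) :
    Measurable (f t x) :=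
  hf.measurable.comp (f := fun v : Vel d => (t, x, v)) (by fun_prop)

theorem IsNonnegL1Curve.measurable_time (hf : IsNonnegL1Curve T f) (t : ℝ) :
    Measurable fun p : Torus d × Vel d => f t p.1 p.2 :=
  hf.measurable.comp (f := fun p : Torus d × Vel d => (t, p.1, p.2)) (by fun_prop)

/-- For all but countably many `c`, the solution avoids the Maxwellian with parameter `c`. -/
theorem exists_mem_Ioo_ae_ne_maxwellian
    (hf : Measurable fun p : ℝ × Torus d × Vel d => f p.1 p.2.1 p.2.2) (a : ℝ) {c c' : ℝ}
    (hc : c < c') : ∃ b ∈ Ioo c c', ∀ᵐ z : ℝ × Torus d × Vel d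
      ∂((volume.restrict (Ioc 0 T)).prod volume), f z.1 z.2.1 z.2.2 ≠ maxwellian a b z.2.2 := by
  have hG : Measurable fun z : ℝ × Torus d × Vel d =>
      Real.log (f z.1 z.2.1 z.2.2) + a * ‖z.2.2‖ ^ 2 :=
    (Real.measurable_log.comp hf).add (by fun_prop)
  have hcount := Measure.countable_meas_level_set_pos
    (μ := (volume.restrict (Ioc 0 T)).prod (volume : Measure (Torus d × Vel d))) hG
  -- The sets `{log f + a|v|² = b}` are disjoint, so in a σ-finite measure only countably many have
  -- positive measure; the complement of these `b` is dense.
  obtain ⟨b, hb, hb'⟩ := (hcount.dense_compl ℝ).exists_between hc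
  refine ⟨b, hb', ?_⟩
  simp only [mem_compl_iff, mem_ofPred_eq, not_lt, nonpos_iff_eq_zero] at hb
  refine measure_mono_null (fun z hz => ?_) hb
  -- Only the inclusion of `{f = M}` in the level set is needed. There `f = M > 0`, so the
  -- convention `log 0 = 0` plays no role.
  have hz' : f z.1 z.2.1 z.2.2 = maxwellian a b z.2.2 := not_not.1 hz
  change Real.log _ + _ = b
  rw [hz', maxwellian, Real.log_exp]
  ring

end Bounds

theorem exists_maxwellian_bound {d : ℕ} (hd : 2 ≤ d) {β α Ch : ℝ} (hβ0 : 0 < β) (hβ1 : β ≤ 1)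
    (hα : α < (d : ℝ) - 1) (a₀ c₀ a₁ c₁ ρ₀ C₀ C₁ a : ℝ) (ha₁ : 0 < a₁) (ha₁₀ : a₁ < a₀)
    (hρ₀ : 0 < ρ₀) (ha : 0 < a) (haa₁ : a < a₁) :
    ∃ c : ℝ, ∀ h : ℝ → ℝ, IsCutoff d α Ch h → ∀ T : ℝ, 0 < T →
      ∀ f : ℝ → Torus d → Vel d → ℝ, IsNonnegL1Curve T f →
        (IsMildSolution β h T f ∨ IsRenormalizedSolution β h T f) →
        (∀ᵐ p : Torus d × Vel d, f 0 p.1 p.2 ≤ maxwellian a₀ c₀ p.2) →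
        (∀ t ∈ Icc 0 T, ∀ᵐ x : Torus d, ENNReal.ofReal ρ₀ ≤ ∫⁻ v, ENNReal.ofReal (f t x v)) →
        (∀ t ∈ Icc 0 T, ∀ᵐ x : Torus d, eLpNorm (f t x) ⊤ volume ≤ ENNReal.ofReal C₀) →
        (∀ t ∈ Icc 0 T, ∀ᵐ x : Torus d,
          ∫⁻ v, ENNReal.ofReal (f t x v / maxwellian a₁ c₁ v) ≤ ENNReal.ofReal C₁) →
        ∀ t ∈ Icc 0 T, ∀ᵐ p : Torus d × Vel d, f t p.1 p.2 ≤ maxwellian a c p.2 := by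
  obtain ⟨R, hR⟩ := exists_radius_gain_le (Ch := Ch) hd hα hβ0 hβ1 ha haa₁ hρ₀ c₁ C₁
  -- The first entry dominates the initial datum. The second gives `M ≥ max C₀ 1` on the ball of
  -- radius `R`, with `1` keeping the logarithm's argument positive.
  set c := max c₀ (Real.log (max C₀ 1) + a * R ^ 2) with hc
  refine ⟨c + 1, fun h hh T hT f hf hsol hinit hmass hsup hmoment => ?_⟩
  -- The comparison is run at a level `b` in `(c, c + 1)` that `f` avoids almost everywhere; `b` may
  -- depend on `f`, but the final constant `c + 1` does not.
  obtain ⟨b, ⟨hcb, hb⟩, hne⟩ := exists_mem_Ioo_ae_ne_maxwellian (T := T) hf.measurable a (lt_add_one c)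
  set K : ℝ≥0∞ := (ENNReal.ofReal (Real.exp (c₁ + 1 / (4 * a₁))) * ENNReal.ofReal C₁) ^ 2 with hKdef
  have hK : K ≠ ⊤ := by finiteness
  have hmom : ∀ t ∈ Icc 0 T, ∀ᵐ x : Torus d,
      HasMoments ρ₀ a₁ c₁ C₁ fun v => ENNReal.ofReal (f t x v) := fun t ht => by
    filter_upwards [hmass t ht, hmoment t ht] with x h1 h2
    exact hasMoments_ofReal (hf.measurable_slice t x) h1 h2
  have hfC : ∀ t ∈ Icc 0 T, ∀ᵐ p : Torus d × Vel d, f t p.1 p.2 ≤ max C₀ 0 := fun t ht => by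
    rw [Measure.volume_eq_prod, Measure.ae_prod_iff_ae_ae
      (measurableSet_le (hf.measurable_time t) measurable_const)]
    filter_upwards [hsup t ht] with x hx using ae_le_of_eLpNorm_top_le hx
  have hsmall : ∀ v : Vel d, ‖v‖ < R → max C₀ 0 ≤ maxwellian a b v := fun v hv => by
    have h1 : ‖v‖ ^ 2 ≤ R ^ 2 := by gcongr
    have h2 : Real.log (max C₀ 1) + a * R ^ 2 ≤ c := le_max_right _ _
    have h3 : a * ‖v‖ ^ 2 ≤ a * R ^ 2 := by gcongr
    calc max C₀ 0 ≤ max C₀ 1 := max_le_max le_rfl zero_le_one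
      _ = Real.exp (Real.log (max C₀ 1)) := (Real.exp_log (by positivity)).symm
      _ ≤ _ := Real.exp_le_exp.2 (by linarith)
  have hQ : ∀ t ∈ Icc 0 T, ∀ᵐ x : Torus d, HasCollisionBounds β h (maxwellian a b) K (f t x) :=
    fun t ht => by
    filter_upwards [hmom t ht, hsup t ht] with x h1 h2
    have h3 := hf.measurable_slice t x
    have h4 := lintegral_gain_eq_loss hd hβ0 hh h3 (hf.nonneg t ht x)
    have h5 := h1.lintegral_mul_frequency_le hβ0 hβ1 ha₁
    refine ⟨h4.1.trans_le h5, h4.2.trans_le h5, setLIntegral_gain_le_loss hd hβ0 hh h3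
      (hf.nonneg t ht x) (hR h hh _ h1 b) ?_⟩
    filter_upwards [ae_le_of_eLpNorm_top_le h2] with v hv hvR using hv.trans (hsmall v hvR)
  have hinit' : ∀ᵐ p : Torus d × Vel d, f 0 p.1 p.2 ≤ maxwellian a b p.2 := by
    filter_upwards [hinit] with p hp
    refine hp.trans (Real.exp_le_exp.2 ?_)
    have h1 : c₀ ≤ c := le_max_left _ _
    have h2 : a * ‖p.2‖ ^ 2 ≤ a₀ * ‖p.2‖ ^ 2 := by gcongr; linarith
    linarith
  have hmain : ∀ t ∈ Icc 0 T, ∀ᵐ p : Torus d × Vel d, f t p.1 p.2 ≤ maxwellian a b p.2 := by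
    rcases hsol with hsol | hsol
    · refine ae_le_of_characteristics (ψ := id) (ϱ := fun _ => 1) (e := id) (e' := fun _ => 1)
        strictMono_id (by simp) continuous_const measurable_id measurable_const
        (strictMono_id.strictMonoOn _) (by simp) (by simp) (fun y hy => by simpa using hy) hK
        hh.measurable (measurable_maxwellian a b) (fun v => (Real.exp_pos _).le) hf.measurable
        hf.nonneg hfC hQ (fun t ht => ?_) hne hinit'
      filter_upwards [hsol.equation 0 t le_rfl ht.1 ht.2] with p hp
      simpa only [move_zero, mul_one, id] using hp
    · have hfint : Integrable (fun z : ℝ × Torus d × Vel d => f z.1 z.2.1 z.2.2)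
          ((volume.restrict (Ioc 0 T)).prod volume) := by
        have hfin := lintegral_phase_le (T := T) hf.measurable.ennreal_ofReal
          (K := ENNReal.ofReal (Real.exp c₁) * ENNReal.ofReal C₁) fun t ht => by
            filter_upwards [hmom t ht] with x hx using hx.lintegral_le ha₁.le
        have hfin' := integrable_toReal_of_lintegral_ne_top
          hf.measurable.ennreal_ofReal.aemeasurable (hfin.trans_lt (by finiteness)).ne
        refine hfin'.congr ?_
        have h1 : ∀ᵐ s ∂(volume.restrict (Ioc 0 T)), s ∈ Icc 0 T := by
          filter_upwards [ae_restrict_mem measurableSet_Ioc] with s hs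
          exact ⟨hs.1.le, hs.2⟩
        filter_upwards [Measure.quasiMeasurePreserving_fst.ae h1] with z hz
        exact ENNReal.toReal_ofReal (hf.nonneg z.1 hz z.2.1 z.2.2)
      have hexp : ∀ y : ℝ, 0 ≤ y → Real.exp (Real.log (1 + y)) = 1 + y := fun y hy =>
        Real.exp_log (by positivity)
      -- As `exp (log (1 + f)) = 1 + f`, the positive part being controlled is again `(f - M)₊`, and
      -- the derivative of `exp` cancels the renormalizing factor `(1 + f)⁻¹`.
      refine ae_le_of_characteristics (ψ := fun y => Real.log (1 + y)) (ϱ := fun y => (1 + y)⁻¹)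
        (e := Real.exp) (e' := Real.exp) Real.exp_strictMono (fun x y => ?_) Real.continuous_exp
        (by fun_prop) (by fun_prop) (fun x hx y hy hxy => ?_) (fun y hy => ?_) (fun y hy => ?_)
        (fun y hy => ?_) hK hh.measurable (measurable_maxwellian a b)
        (fun v => (Real.exp_pos _).le) hf.measurable hf.nonneg hfC hQ
        (hsol.integrated hT hf hfint (integrable_collision hK hh.measurable hf.measurable hQ))
        hne hinit'
      · have h1 := Real.add_one_le_exp (y - x)
        have h2 : Real.exp y = Real.exp x * Real.exp (y - x) := by rw [← Real.exp_add]; simp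
        rw [h2]
        nlinarith [Real.exp_pos x]
      · have hx' : 0 ≤ x := hx
        exact Real.log_lt_log (by positivity) (by linarith)
      · rw [hexp y hy, mul_inv_cancel₀ (by positivity)]
      · rw [abs_of_nonneg (by positivity)]
        exact inv_le_one_of_one_le₀ (by linarith)
      · rw [hexp y hy, abs_of_nonneg (by positivity)]
  intro t ht
  filter_upwards [hmain t ht] with p hp
  exact hp.trans (Real.exp_le_exp.2 (by linarith))

end Boltzmann

theorem theorem3 (d : ℕ) (hd : 2 ≤ d)
    (β α Ch : ℝ) (hβ0 : 0 < β) (hβ1 : β ≤ 1) (hα : α < (d : ℝ) - 1)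
    (a₀ c₀ a₁ c₁ ρ₀ C₀ C₁ a : ℝ) (ha₁ : 0 < a₁) (ha₁₀ : a₁ < a₀) (hρ₀ : 0 < ρ₀)
    (ha : 0 < a) (haa₁ : a < a₁) :
    ∃ c : ℝ, ∀ h : ℝ → ℝ, Boltzmann.IsCutoff d α Ch h →
      ∀ T : ℝ, 0 < T → ∀ f : ℝ → Boltzmann.Torus d → Boltzmann.Vel d → ℝ,
        Boltzmann.IsNonnegL1Curve T f →
        (Boltzmann.IsMildSolution β h T f ∨ Boltzmann.IsRenormalizedSolution β h T f) →
        (∀ᵐ p : Boltzmann.Torus d × Boltzmann.Vel d,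
          f 0 p.1 p.2 ≤ Boltzmann.maxwellian a₀ c₀ p.2) →
        (∀ t ∈ Icc 0 T, ∀ᵐ x : Boltzmann.Torus d,
          ENNReal.ofReal ρ₀ ≤ ∫⁻ v, ENNReal.ofReal (f t x v)) →
        (∀ t ∈ Icc 0 T, ∀ᵐ x : Boltzmann.Torus d,
          eLpNorm (f t x) ⊤ volume ≤ ENNReal.ofReal C₀) →
        (∀ t ∈ Icc 0 T, ∀ᵐ x : Boltzmann.Torus d,
          ∫⁻ v, ENNReal.ofReal (f t x v / Boltzmann.maxwellian a₁ c₁ v) ≤ ENNReal.ofReal C₁) →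
        ∀ t ∈ Icc 0 T, ∀ᵐ p : Boltzmann.Torus d × Boltzmann.Vel d,
          f t p.1 p.2 ≤ Boltzmann.maxwellian a c p.2 := by
  exact Boltzmann.exists_maxwellian_bound hd hβ0 hβ1 hα a₀ c₀ a₁ c₁ ρ₀ C₀ C₁ a ha₁ ha₁₀ hρ₀ ha haa₁
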